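/- An attack graph is a finite directed graph with $n$ nodes and $m$ edges, with a destination node DA that can be reached from every node, a set $E_b$ of blockable edges, and a non-empty set of $s$ entry nodes $s_1,\dots,s_s$. Let $f:\{0,1,2,\dots\}\cup\{\infty\}\to\mathbb{R}$ be decreasing (not necessarily strictly) with $f(\infty)=0$, and let $b\ge 1$ be the defender's budget. For a set $B$ of blocked edges, let $|SP(v,G-B)|$ be the number of edges of a shortest path from $v$ to DA in $G-B$ ($\infty$ if there is none). The defender's problem is $$\min_{B\subseteq E_b,\ |B|\le b}\ \frac1s\sum_{i=1}^{s} f\bigl(|SP(s_i,G-B)|\bigr).$$ Let $h=m-(n-1)$ be the number of feedback edges, and let $l$ be the maximum attack path length, i.e. the length of a longest path (without repeated nodes) of $G$ that ends at DA. A splitting node is a node other than DA with at least two out-going edges. A strategy of the attacker chooses, at every splitting node, one of its out-going edges ("route") or none. The simple path of a route starts with that edge and runs on until it reaches the next splitting node or DA (all nodes in between have exactly one out-going edge). The algorithm SplitFPT goes through all strategies of the attacker. For each of them (1) it labels all edges on the simple paths of the chosen routes as not blockable; (2) it computes the distances from the splitting nodes to DA that result from the strategy (infinite where no route is chosen, or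 where the chosen routes do not lead to DA); (3) for every route that is not chosen, whose simple path is not yet blocked and which would be shorter than the chosen one, it blocks the blockable edge of its simple path that is closest to DA, and the strategy is invalid if there is no such edge, or if more than $b$ edges get blocked altogether; (4) if the strategy is valid, then in the tree that remains when only the chosen routes are kept at the splitting nodes, it spends the remaining budget greedily on the blockable edges that have no further blockable edge between them and DA, a most beneficial one at a time. It returns the best defence found, and its value. Then the number of strategies of the attacker is at most $3^h$, and SplitFPT, implemented as a fixed program on a unit-cost random access machine (natural numbers with addition, subtraction and comparison; exact real arithmetic for the values of $f$), always halts with an optimal solution $B$ of the defender's problem and its value, after $$O\bigl(3^{h}\,(h^2+hl+bn)\bigr)$$ steps, where the implied constant is absolute. -/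

import Mathlib

/-! ## Attack graphs and the defender's problem -/

/-- A directed attack graph with nodes `0, …, n - 1` and edges numbered `0, …, m - 1`, a
destination `da`, a set of blockable edges and a set of entry nodes. -/
structure AttackGraph where
  n : ℕ
  m : ℕ
  tail : Fin m → Fin n
  head : Fin m → Fin n
  da : Fin n
  blockable : Finset (Fin m)
  entry : Finset (Fin n)

namespace AttackGraph

variable (G : AttackGraph)

/-- `G.IsWalk p u v`: the list of edges `p` is a directed walk from `u` to `v`. -/
def IsWalk : List (Fin G.m) → Fin G.n → Fin G.n → Prop
  | [], u, v => u = v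
  | e :: p, u, v => G.tail e = u ∧ IsWalk p (G.head e) v

/-- A walk that visits no node twice. -/
def IsPath (p : List (Fin G.m)) (u v : Fin G.n) : Prop :=
  G.IsWalk p u v ∧ (u :: p.map G.head).Nodup

/-- Number of hops of a shortest path from `u` to the destination in `G - B`
(`⊤` if there is none). -/
noncomputable def dist (B : Finset (Fin G.m)) (u : Fin G.n) : ℕ∞ :=
  ⨅ p ∈ {p : List (Fin G.m) | G.IsWalk p u G.da ∧ ∀ e ∈ p, e ∉ B}, (p.length : ℕ∞)

/-- The attacker's expected success rate if the edges in `B` are blocked. -/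
noncomputable def successRate (f : ℕ∞ → ℝ) (B : Finset (Fin G.m)) : ℝ :=
  (1 / (G.entry.card : ℝ)) * ∑ v ∈ G.entry, f (G.dist B v)

/-- The defences that are available with budget `b`. -/
def Feasible (b : ℕ) (B : Finset (Fin G.m)) : Prop :=
  B ⊆ G.blockable ∧ B.card ≤ b

/-- `B` is an optimal defence for budget `b`. -/
def IsOptimal (f : ℕ∞ → ℝ) (b : ℕ) (B : Finset (Fin G.m)) : Prop :=
  G.Feasible b B ∧ ∀ B', G.Feasible b B' → G.successRate f B ≤ G.successRate f B'

/-- Number of feedback edges, `m - (n - 1)` (not truncated if every node can reach `da`). -/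
def feedback : ℕ := G.m - (G.n - 1)

/-- Maximum attack path length: the length of a longest path (no node is repeated) that ends at the
destination. -/
noncomputable def maxPathLength : ℕ :=
  sSup {k : ℕ | ∃ u p, G.IsPath p u G.da ∧ p.length = k}

def outDegree (v : Fin G.n) : ℕ := (Finset.univ.filter fun e => G.tail e = v).card

/-- Splitting nodes: the nodes, other than the destination, with several out-going edges. -/
def splitting : Finset (Fin G.n) :=
  Finset.univ.filter fun v => v ≠ G.da ∧ 2 ≤ G.outDegree v

/-- Number of strategies of the attacker: one of the out-going edges, or none, at every
splitting node. -/
def strategyCount : ℕ := ∏ v ∈ G.splitting, (G.outDegree v + 1)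

end AttackGraph

/-! ## A real RAM with unit costs

Natural number variables and arrays, real variables and arrays. The only operations on natural
numbers are addition, truncated subtraction and comparison. A program is a term of the type `Cmd`,
so it cannot depend on the input; every operation, memory access and test costs one step. -/

/-- Natural number variables. -/
inductive Var
  | n | m | b | da | t | run | carry | found | valid | used
  | i | j | k | p | e | u | v | c | w | r | len | cand | hit | qh | qt
  deriving DecidableEq

/-- Natural number arrays. -/
inductive Arr
  | tail | head | blk | entry | first | next | deg | isEnd | sp | cur
  | mark | blocked | rend | rlen | dist | up | child | sib | queue | depth | front | isFront | out
  deriving DecidableEq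

/-- Real variables. -/
inductive RVar
  | s | total | best
  deriving DecidableEq

/-- Real arrays. -/
inductive RArr
  | f | ben
  deriving DecidableEq

/-- The contents of the memory. -/
structure Mem where
  var : Var → ℕ
  arr : Arr → ℕ → ℕ
  rvar : RVar → ℝ
  rarr : RArr → ℕ → ℝ

/-- Expressions for natural numbers. -/
inductive NExp
  | lit (k : ℕ)
  | var (x : Var)
  | get (a : Arr) (i : NExp)
  | add (x y : NExp)
  | sub (x y : NExp)

/-- Expressions for real numbers. -/
inductive RExp
  | zero
  | one
  | var (x : RVar)
  | get (a : RArr) (i : NExp)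
  | add (x y : RExp)
  | sub (x y : RExp)
  | div (x y : RExp)

/-- Tests. -/
inductive Test
  | eq (x y : NExp)
  | lt (x y : NExp)
  | rlt (x y : RExp)
  | neg (s : Test)
  | and (s t : Test)
  | or (s t : Test)

/-- Programs. -/
inductive Cmd
  | skip
  | set (x : Var) (y : NExp)
  | put (a : Arr) (i y : NExp)
  | rset (x : RVar) (y : RExp)
  | rput (a : RArr) (i : NExp) (y : RExp)
  | seq (c d : Cmd)
  | ite (s : Test) (c d : Cmd)
  | while (s : Test) (c : Cmd)

namespace NExp

def eval (M : Mem) : NExp → ℕ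
  | lit k => k
  | var x => M.var x
  | get a i => M.arr a (i.eval M)
  | add x y => x.eval M + y.eval M
  | sub x y => x.eval M - y.eval M

def cost : NExp → ℕ
  | lit _ => 1
  | var _ => 1
  | get _ i => i.cost + 1
  | add x y => x.cost + y.cost + 1
  | sub x y => x.cost + y.cost + 1

end NExp

namespace RExp

noncomputable def eval (M : Mem) : RExp → ℝ
  | zero => 0
  | one => 1
  | var x => M.rvar x
  | get a i => M.rarr a (i.eval M)
  | add x y => x.eval M + y.eval M
  | sub x y => x.eval M - y.eval M
  | div x y => x.eval M / y.eval M

def cost : RExp → ℕ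
  | zero => 1
  | one => 1
  | var _ => 1
  | get _ i => i.cost + 1
  | add x y => x.cost + y.cost + 1
  | sub x y => x.cost + y.cost + 1
  | div x y => x.cost + y.cost + 1

end RExp

namespace Test

def Holds (M : Mem) : Test → Prop
  | eq x y => x.eval M = y.eval M
  | lt x y => x.eval M < y.eval M
  | rlt x y => x.eval M < y.eval M
  | neg s => ¬ s.Holds M
  | and s t => s.Holds M ∧ t.Holds M
  | or s t => s.Holds M ∨ t.Holds M

def cost : Test → ℕ
  | eq x y => x.cost + y.cost + 1
  | lt x y => x.cost + y.cost + 1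
  | rlt x y => x.cost + y.cost + 1
  | neg s => s.cost + 1
  | and s t => s.cost + t.cost + 1
  | or s t => s.cost + t.cost + 1

end Test

namespace Mem

def setVar (M : Mem) (x : Var) (k : ℕ) : Mem :=
  { M with var := Function.update M.var x k }

def setArr (M : Mem) (a : Arr) (i k : ℕ) : Mem :=
  { M with arr := Function.update M.arr a (Function.update (M.arr a) i k) }

noncomputable def setRVar (M : Mem) (x : RVar) (y : ℝ) : Mem :=
  { M with rvar := Function.update M.rvar x y }

noncomputable def setRArr (M : Mem) (a : RArr) (i : ℕ) (y : ℝ) : Mem :=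
  { M with rarr := Function.update M.rarr a (Function.update (M.rarr a) i y) }

end Mem

/-- `Exec c M M' k`: started in `M`, the program `c` halts in `M'` after exactly `k` steps. -/
inductive Exec : Cmd → Mem → Mem → ℕ → Prop
  | skip (M : Mem) : Exec .skip M M 1
  | set (M : Mem) (x : Var) (y : NExp) :
      Exec (.set x y) M (M.setVar x (y.eval M)) (y.cost + 1)
  | put (M : Mem) (a : Arr) (i y : NExp) :
      Exec (.put a i y) M (M.setArr a (i.eval M) (y.eval M)) (i.cost + y.cost + 1)
  | rset (M : Mem) (x : RVar) (y : RExp) :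
      Exec (.rset x y) M (M.setRVar x (y.eval M)) (y.cost + 1)
  | rput (M : Mem) (a : RArr) (i : NExp) (y : RExp) :
      Exec (.rput a i y) M (M.setRArr a (i.eval M) (y.eval M)) (i.cost + y.cost + 1)
  | seq {c d : Cmd} {M M' M'' : Mem} {k l : ℕ} (hc : Exec c M M' k) (hd : Exec d M' M'' l) :
      Exec (.seq c d) M M'' (k + l)
  | iteTrue {s : Test} {c d : Cmd} {M M' : Mem} {k : ℕ} (hs : s.Holds M) (hc : Exec c M M' k) :
      Exec (.ite s c d) M M' (s.cost + k + 1)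
  | iteFalse {s : Test} {c d : Cmd} {M M' : Mem} {k : ℕ} (hs : ¬ s.Holds M)
      (hd : Exec d M M' k) : Exec (.ite s c d) M M' (s.cost + k + 1)
  | whileFalse {s : Test} {c : Cmd} {M : Mem} (hs : ¬ s.Holds M) :
      Exec (.while s c) M M (s.cost + 1)
  | whileTrue {s : Test} {c : Cmd} {M M' M'' : Mem} {k l : ℕ} (hs : s.Holds M)
      (hc : Exec c M M' k) (hw : Exec (.while s c) M' M'' l) :
      Exec (.while s c) M M'' (s.cost + k + l + 1)

/-! ### Abbreviations for writing programs -/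

instance instOfNatNExp (k : ℕ) : OfNat NExp k := ⟨.lit k⟩
instance instCoeVarNExp : Coe Var NExp := ⟨.var⟩
instance instAddNExp : Add NExp := ⟨.add⟩
instance instSubNExp : Sub NExp := ⟨.sub⟩
instance instCoeRVarRExp : Coe RVar RExp := ⟨.var⟩
instance instAddRExp : Add RExp := ⟨.add⟩
instance instSubRExp : Sub RExp := ⟨.sub⟩
instance instDivRExp : Div RExp := ⟨.div⟩

/-- `a⟦i⟧` is the `i`-th cell of the array `a`. -/
notation:max a:max "⟦" i "⟧" => NExp.get a i

namespace Test

def ne (x y : NExp) : Test := .neg (.eq x y)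

def le (x y : NExp) : Test := .neg (.lt y x)

end Test

namespace Cmd

/-- Run the programs of a list one after the other. -/
def block : List Cmd → Cmd
  | [] => .skip
  | [c] => c
  | c :: cs => .seq c (block cs)

/-- `if s then c`. -/
def when (s : Test) (c : Cmd) : Cmd := .ite s c .skip

/-- `for x = 0, 1, …, y - 1 do c`. -/
def forTo (x : Var) (y : NExp) (c : Cmd) : Cmd :=
  .seq (.set x 0) (.while (.lt x y) (.seq c (.set x (x + 1))))

end Cmd

/-! ## The algorithm

Optional values are stored with `0` for "none" and `a + 1` for `a`. -/

namespace SplitFPT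

/-- Preparation: lists of out-going edges (`first`, `next`), out-degrees, the list `sp` of the `t`
splitting nodes, the flags `isEnd` of the nodes at which simple paths end (splitting nodes and the
destination), the number `s` of entry nodes. The first strategy takes no route anywhere. -/
def prepare : Cmd := .block [
  .forTo .e Var.m (.block [
    .set .u Arr.tail⟦Var.e⟧,
    .put .next Var.e Arr.first⟦Var.u⟧,
    .put .first Var.u (Var.e + 1),
    .put .deg Var.u (Arr.deg⟦Var.u⟧ + 1)]),
  .set .t 0,
  .rset .s .zero,
  .forTo .v Var.n (.block [
    .ite (.eq Var.v Var.da)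
      (.put .isEnd Var.v 1)
      (.when (.le 2 Arr.deg⟦Var.v⟧) (.block [
        .put .isEnd Var.v 1,
        .put .sp Var.t Var.v,
        .put .cur Var.t 0,
        .set .t (Var.t + 1)])),
    .when (.eq Arr.entry⟦Var.v⟧ 1) (.rset .s (RVar.s + .one))])]

/-- Forget what was computed for the previous strategy. -/
def reset : Cmd := .block [
  .forTo .e Var.m (.block [
    .put .mark Var.e 0,
    .put .blocked Var.e 0]),
  .forTo .v Var.n (.put .dist Var.v 0)]

/-- Follow the simple path of every route that the attacker takes, label its edges as not
blockable (`mark`), and note its end node and its length. -/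
def markTaken : Cmd :=
  .forTo .k Var.t (.when (.ne Arr.cur⟦Var.k⟧ 0) (.block [
    .set .e (Arr.cur⟦Var.k⟧ - 1),
    .put .mark Var.e 1,
    .set .v Arr.head⟦Var.e⟧,
    .set .len 1,
    .while (.eq Arr.isEnd⟦Var.v⟧ 0) (.block [
      .set .e (Arr.first⟦Var.v⟧ - 1),
      .put .mark Var.e 1,
      .set .v Arr.head⟦Var.e⟧,
      .set .len (Var.len + 1)]),
    .put .rend Var.k Var.v,
    .put .rlen Var.k Var.len]))

/-- The distances of the splitting nodes to the destination if the attacker follows his strategy.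
`dist` holds `0` for an infinite distance, and the distance plus one otherwise. -/
def distances : Cmd := .block [
  .put .dist Var.da 1,
  .forTo .i Var.t
    (.forTo .k Var.t
      (.when (.and (.ne Arr.cur⟦Var.k⟧ 0) (.ne Arr.dist⟦Arr.rend⟦Var.k⟧⟧ 0))
        (.put .dist Arr.sp⟦Var.k⟧ (Arr.rlen⟦Var.k⟧ + Arr.dist⟦Arr.rend⟦Var.k⟧⟧))))]

/-- Examine the edge `e` of a route that is not taken: is it already blocked (`hit`), and can it
be blocked (then it is the last such edge so far, `cand`)? -/
def examine : Cmd := .block [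
  .when (.eq Arr.blocked⟦Var.e⟧ 1) (.set .hit 1),
  .when (.and (.eq Arr.blk⟦Var.e⟧ 1) (.eq Arr.mark⟦Var.e⟧ 0)) (.set .cand (Var.e + 1))]

/-- Follow the simple path of every route that is not taken. If it is not blocked and shorter than
what the attacker has chosen, block its blockable edge that is closest to the destination; if there
is no such edge, the strategy is invalid. -/
def forceBlocks : Cmd := .block [
  .set .valid 1,
  .set .used 0,
  .forTo .k Var.t (.block [
    .set .u Arr.sp⟦Var.k⟧,
    .set .p Arr.first⟦Var.u⟧,
    .while (.ne Var.p 0) (.block [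
      .when (.ne Var.p Arr.cur⟦Var.k⟧) (.block [
        .set .hit 0,
        .set .cand 0,
        .set .e (Var.p - 1),
        examine,
        .set .v Arr.head⟦Var.e⟧,
        .set .len 1,
        .while (.eq Arr.isEnd⟦Var.v⟧ 0) (.block [
          .set .e (Arr.first⟦Var.v⟧ - 1),
          examine,
          .set .v Arr.head⟦Var.e⟧,
          .set .len (Var.len + 1)]),
        .when (.and (.eq Var.hit 0) (.and (.ne Arr.dist⟦Var.v⟧ 0)
            (.or (.eq Arr.dist⟦Var.u⟧ 0) (.lt (Var.len + Arr.dist⟦Var.v⟧) Arr.dist⟦Var.u⟧))))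
          (.ite (.eq Var.cand 0)
            (.set .valid 0)
            (.block [
              .put .blocked (Var.cand - 1) 1,
              .set .used (Var.used + 1)]))]),
      .set .p Arr.next⟦Var.p - 1⟧])])]

/-- The tree that is left: `up` holds the only edge that the attacker can rationally use at a node;
`child` and `sib` list the nodes whose `up` edge, not being blocked, leads to a given node. -/
def buildTree : Cmd := .block [
  .forTo .v Var.n (.block [
    .put .up Var.v 0,
    .when (.eq Arr.isEnd⟦Var.v⟧ 0) (.put .up Var.v Arr.first⟦Var.v⟧),
    .put .child Var.v 0,
    .put .isFront Var.v 0]),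
  .forTo .k Var.t (.put .up Arr.sp⟦Var.k⟧ Arr.cur⟦Var.k⟧),
  .forTo .v Var.n
    (.when (.and (.ne Arr.up⟦Var.v⟧ 0) (.eq Arr.blocked⟦Arr.up⟦Var.v⟧ - 1⟧ 0)) (.block [
      .set .u Arr.head⟦Arr.up⟦Var.v⟧ - 1⟧,
      .put .sib Var.v Arr.child⟦Var.u⟧,
      .put .child Var.u (Var.v + 1)]))]

/-- Visit the node `c`, a child of `u`, in the search: determine its distance and the frontier
blockable edge between it and the destination (given by the tail of the edge), add its share to the
total success rate and to the benefit of blocking that edge. -/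
def visit : Cmd := .block [
  .put .depth Var.c (Arr.depth⟦Var.u⟧ + 1),
  .put .front Var.c Arr.front⟦Var.u⟧,
  .set .e (Arr.up⟦Var.c⟧ - 1),
  .when (.and (.eq Arr.front⟦Var.u⟧ 0)
      (.and (.eq Arr.blk⟦Var.e⟧ 1) (.eq Arr.mark⟦Var.e⟧ 0))) (.block [
    .put .front Var.c (Var.c + 1),
    .put .isFront Var.c 1,
    .rput .ben Var.c .zero]),
  .when (.eq Arr.entry⟦Var.c⟧ 1) (.block [
    .rset .total (RVar.total + .get .f Arr.depth⟦Var.c⟧),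
    .when (.ne Arr.front⟦Var.c⟧ 0)
      (.rput .ben (Arr.front⟦Var.c⟧ - 1)
        (.get .ben (Arr.front⟦Var.c⟧ - 1) + .get .f Arr.depth⟦Var.c⟧))])]

/-- Breadth-first search in the tree from the destination. -/
def search : Cmd := .block [
  .rset .total .zero,
  .put .depth Var.da 0,
  .put .front Var.da 0,
  .when (.eq Arr.entry⟦Var.da⟧ 1) (.rset .total (RVar.total + .get .f 0)),
  .put .queue 0 Var.da,
  .set .qh 0,
  .set .qt 1,
  .while (.lt Var.qh Var.qt) (.block [
    .set .u Arr.queue⟦Var.qh⟧,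
    .set .qh (Var.qh + 1),
    .set .p Arr.child⟦Var.u⟧,
    .while (.ne Var.p 0) (.block [
      .set .c (Var.p - 1),
      visit,
      .put .queue Var.qt Var.c,
      .set .qt (Var.qt + 1),
      .set .p Arr.sib⟦Var.c⟧])])]

/-- Spend the remaining budget: block a most beneficial frontier edge, again and again. -/
def greedy : Cmd := .block [
  .set .r Var.used,
  .while (.lt Var.r Var.b) (.block [
    .set .w 0,
    .forTo .v Var.n
      (.when (.and (.eq Arr.isFront⟦Var.v⟧ 1)
          (.or (.eq Var.w 0) (.rlt (.get .ben (Var.w - 1)) (.get .ben Var.v))))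
        (.set .w (Var.v + 1))),
    .when (.ne Var.w 0) (.block [
      .put .isFront (Var.w - 1) 0,
      .put .blocked (Arr.up⟦Var.w - 1⟧ - 1) 1,
      .rset .total (RVar.total - .get .ben (Var.w - 1))]),
    .set .r (Var.r + 1)])]

/-- Keep the best defence found so far. -/
def record : Cmd :=
  .when (.or (.eq Var.found 0) (.rlt RVar.total RVar.best)) (.block [
    .set .found 1,
    .rset .best RVar.total,
    .forTo .e Var.m (.put .out Var.e Arr.blocked⟦Var.e⟧)])

/-- Treat the current strategy of the attacker. -/
def tryStrategy : Cmd := .block [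
  reset,
  markTaken,
  distances,
  forceBlocks,
  .when (.and (.eq Var.valid 1) (.le Var.used Var.b)) (.block [
    buildTree,
    search,
    greedy,
    record])]

/-- Go to the next strategy. The routes at the splitting nodes are the digits of a counter; a digit
runs through "no route" and the out-going edges. -/
def nextStrategy : Cmd := .block [
  .set .k 0,
  .set .carry 1,
  .while (.and (.lt Var.k Var.t) (.eq Var.carry 1)) (.block [
    .ite (.eq Arr.cur⟦Var.k⟧ 0)
      (.put .cur Var.k Arr.first⟦Arr.sp⟦Var.k⟧⟧)
      (.put .cur Var.k Arr.next⟦Arr.cur⟦Var.k⟧ - 1⟧),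
    .when (.ne Arr.cur⟦Var.k⟧ 0) (.set .carry 0),
    .set .k (Var.k + 1)]),
  .when (.eq Var.carry 1) (.set .run 0)]

/-- The whole algorithm. -/
def program : Cmd := .block [
  prepare,
  .set .found 0,
  .set .run 1,
  .while (.eq Var.run 1) (.block [
    tryStrategy,
    nextStrategy]),
  .rset .best (RVar.best / RVar.s)]

/-- The memory at the start: the graph, the budget and the values `f 0, …, f (n - 1)`; everything
else is zero. -/
noncomputable def input (G : AttackGraph) (f : ℕ∞ → ℝ) (b : ℕ) : Mem where
  var
    | .n => G.n
    | .m => G.m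
    | .b => b
    | .da => G.da
    | _ => 0
  arr
    | .tail, i => if h : i < G.m then G.tail ⟨i, h⟩ else 0
    | .head, i => if h : i < G.m then G.head ⟨i, h⟩ else 0
    | .blk, i => if ∃ h : i < G.m, (⟨i, h⟩ : Fin G.m) ∈ G.blockable then 1 else 0
    | .entry, i => if ∃ h : i < G.n, (⟨i, h⟩ : Fin G.n) ∈ G.entry then 1 else 0
    | _, _ => 0
  rvar _ := 0
  rarr
    | .f, i => if i < G.n then f i else 0
    | _, _ => 0

/-- The defence in the memory at the end. -/
def output (G : AttackGraph) (M : Mem) : Finset (Fin G.m) :=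
  Finset.univ.filter fun e => M.arr .out e = 1

end SplitFPT

/-!
Fix a defence `B` and let every splitting node choose an out-going edge on a shortest path to the
destination that avoids `B`, or none if there is no such path: this is the strategy
`AttackGraph.response B`. Simple paths do not branch, so whether it is correct is decided by the
splitting nodes alone: a defence `B` is consistent with a strategy `σ` (`AttackGraph.Consistent`)
if it blocks nothing on the chosen simple paths and hits every route that would be shorter than the
chosen one. If `B` is consistent with `σ`, then every splitting node has under `B` the distance
that results from `σ` (`AttackGraph.Consistent.dist_eq`), and any other node has the same distance
as in the tree of the chosen routes, unless `B` blocks an edge of the simple path that starts at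
it. Every defence is consistent with its own response (`AttackGraph.Reaching.consistent_response`),
so a program that finds for each strategy a best defence among the consistent ones finds an optimal
defence.

Among the defences that are consistent with `σ`, it does no harm to move each blocked edge to the
last free edge of its simple path, since all that was cut off stays cut off
(`AttackGraph.Consistent.exists_terminal`). The last free edges of routes that have to be blocked
are then forced, and the other last free edges can be added at will. The sets of entry nodes cut
off by different ones are disjoint, so the value of a defence is a constant minus the sum of the
gains of its edges (`AttackGraph.Consistent.totalRate_eq`), and choosing a most beneficial edge at
a time is optimal.

The strategies are the numbers of a mixed radix system with one digit at each splitting node `v`,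
of base `outDegree v + 1`, and `nextStrategy` adds one. Every node other than the destination has
an out-going edge, hence the excesses `outDegree v - 1` add up to at most the number `h` of feedback
edges, and `d + 2 ≤ 3 ^ d` for `d ≥ 1` gives the bound `3 ^ h` for the number of strategies
(`AttackGraph.Reaching.strategyCount_le`). For the time, the routes number at most `2 * h`, simple
paths are no longer than `l`, there are at most `h` splitting nodes, so that the distances settle
after `h` rounds, and each of the at most `b` greedy choices is a search of the tree, which has `n`
nodes.

Statements about programs are made with `Runs c M Q`: started in the memory `M`, the program `c`
halts, and `Q` holds of the final memory and the number of steps. That a program leaves variables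
alone which it does not mention is read off from its text (`Exec.same`).
-/

/-! ### A program logic with costs -/

namespace Mem

variable (M : Mem)

@[simp] theorem var_setVar (x y : Var) (k : ℕ) :
    (M.setVar x k).var y = if y = x then k else M.var y := by
  simp [setVar, Function.update_apply]
@[simp] theorem arr_setVar (x : Var) (k : ℕ) : (M.setVar x k).arr = M.arr := rfl
@[simp] theorem rvar_setVar (x : Var) (k : ℕ) : (M.setVar x k).rvar = M.rvar := rfl
@[simp] theorem rarr_setVar (x : Var) (k : ℕ) : (M.setVar x k).rarr = M.rarr := rfl

@[simp] theorem var_setArr (a : Arr) (i k : ℕ) : (M.setArr a i k).var = M.var := rfl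
@[simp] theorem arr_setArr (a a' : Arr) (i k : ℕ) :
    (M.setArr a i k).arr a' = if a' = a then Function.update (M.arr a) i k else M.arr a' := by
  simp [setArr, Function.update_apply]
@[simp] theorem rvar_setArr (a : Arr) (i k : ℕ) : (M.setArr a i k).rvar = M.rvar := rfl
@[simp] theorem rarr_setArr (a : Arr) (i k : ℕ) : (M.setArr a i k).rarr = M.rarr := rfl

@[simp] theorem var_setRVar (x : RVar) (y : ℝ) : (M.setRVar x y).var = M.var := rfl
@[simp] theorem arr_setRVar (x : RVar) (y : ℝ) : (M.setRVar x y).arr = M.arr := rfl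
@[simp] theorem rvar_setRVar (x z : RVar) (y : ℝ) :
    (M.setRVar x y).rvar z = if z = x then y else M.rvar z := by
  simp [setRVar, Function.update_apply]
@[simp] theorem rarr_setRVar (x : RVar) (y : ℝ) : (M.setRVar x y).rarr = M.rarr := rfl

@[simp] theorem var_setRArr (a : RArr) (i : ℕ) (y : ℝ) : (M.setRArr a i y).var = M.var := rfl
@[simp] theorem arr_setRArr (a : RArr) (i : ℕ) (y : ℝ) : (M.setRArr a i y).arr = M.arr := rfl
@[simp] theorem rvar_setRArr (a : RArr) (i : ℕ) (y : ℝ) : (M.setRArr a i y).rvar = M.rvar := rfl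
@[simp] theorem rarr_setRArr (a a' : RArr) (i : ℕ) (y : ℝ) :
    (M.setRArr a i y).rarr a' = if a' = a then Function.update (M.rarr a) i y else M.rarr a' := by
  simp [setRArr, Function.update_apply]

end Mem

namespace NExp

variable (M : Mem)

@[simp] theorem eval_ofNat (k : ℕ) : (ofNat(k) : NExp).eval M = k := rfl
@[simp] theorem eval_lit (k : ℕ) : (NExp.lit k).eval M = k := rfl
@[simp] theorem eval_var (x : Var) : (NExp.var x).eval M = M.var x := rfl
@[simp] theorem eval_get (a : Arr) (i : NExp) : (NExp.get a i).eval M = M.arr a (i.eval M) := rfl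
@[simp] theorem eval_add (x y : NExp) : (x + y).eval M = x.eval M + y.eval M := rfl
@[simp] theorem eval_sub (x y : NExp) : (x - y).eval M = x.eval M - y.eval M := rfl
@[simp] theorem cost_ofNat (k : ℕ) : (ofNat(k) : NExp).cost = 1 := rfl
@[simp] theorem cost_var (x : Var) : (NExp.var x).cost = 1 := rfl
@[simp] theorem cost_get (a : Arr) (i : NExp) : (NExp.get a i).cost = i.cost + 1 := rfl
@[simp] theorem cost_add (x y : NExp) : (x + y).cost = x.cost + y.cost + 1 := rfl
@[simp] theorem cost_sub (x y : NExp) : (x - y).cost = x.cost + y.cost + 1 := rfl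

end NExp

namespace RExp

variable (M : Mem)

@[simp] theorem eval_zero : RExp.zero.eval M = 0 := rfl
@[simp] theorem eval_one : RExp.one.eval M = 1 := rfl
@[simp] theorem eval_var (x : RVar) : (RExp.var x).eval M = M.rvar x := rfl
@[simp] theorem eval_get (a : RArr) (i : NExp) :
    (RExp.get a i).eval M = M.rarr a (i.eval M) := rfl
@[simp] theorem eval_add (x y : RExp) : (x + y).eval M = x.eval M + y.eval M := rfl
@[simp] theorem eval_sub (x y : RExp) : (x - y).eval M = x.eval M - y.eval M := rfl
@[simp] theorem eval_div (x y : RExp) : (x / y).eval M = x.eval M / y.eval M := rfl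
@[simp] theorem cost_zero : RExp.zero.cost = 1 := rfl
@[simp] theorem cost_one : RExp.one.cost = 1 := rfl
@[simp] theorem cost_var (x : RVar) : (RExp.var x).cost = 1 := rfl
@[simp] theorem cost_get (a : RArr) (i : NExp) : (RExp.get a i).cost = i.cost + 1 := rfl
@[simp] theorem cost_add (x y : RExp) : (x + y).cost = x.cost + y.cost + 1 := rfl
@[simp] theorem cost_sub (x y : RExp) : (x - y).cost = x.cost + y.cost + 1 := rfl
@[simp] theorem cost_div (x y : RExp) : (x / y).cost = x.cost + y.cost + 1 := rfl

end RExp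

namespace Test

variable (M : Mem)

@[simp] theorem holds_eq (x y : NExp) : (Test.eq x y).Holds M ↔ x.eval M = y.eval M := Iff.rfl
@[simp] theorem holds_ne (x y : NExp) : (Test.ne x y).Holds M ↔ x.eval M ≠ y.eval M := Iff.rfl
@[simp] theorem holds_lt (x y : NExp) : (Test.lt x y).Holds M ↔ x.eval M < y.eval M := Iff.rfl
@[simp] theorem holds_le (x y : NExp) : (Test.le x y).Holds M ↔ x.eval M ≤ y.eval M := not_lt
@[simp] theorem holds_rlt (x y : RExp) : (Test.rlt x y).Holds M ↔ x.eval M < y.eval M := Iff.rfl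
@[simp] theorem holds_and (s t : Test) : (Test.and s t).Holds M ↔ s.Holds M ∧ t.Holds M := Iff.rfl
@[simp] theorem holds_or (s t : Test) : (Test.or s t).Holds M ↔ s.Holds M ∨ t.Holds M := Iff.rfl
@[simp] theorem cost_eq (x y : NExp) : (Test.eq x y).cost = x.cost + y.cost + 1 := rfl
@[simp] theorem cost_ne (x y : NExp) : (Test.ne x y).cost = x.cost + y.cost + 2 := rfl
@[simp] theorem cost_lt (x y : NExp) : (Test.lt x y).cost = x.cost + y.cost + 1 := rfl
@[simp] theorem cost_le (x y : NExp) : (Test.le x y).cost = y.cost + x.cost + 2 := rfl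
@[simp] theorem cost_rlt (x y : RExp) : (Test.rlt x y).cost = x.cost + y.cost + 1 := rfl
@[simp] theorem cost_and (s t : Test) : (Test.and s t).cost = s.cost + t.cost + 1 := rfl
@[simp] theorem cost_or (s t : Test) : (Test.or s t).cost = s.cost + t.cost + 1 := rfl

end Test

namespace Cmd

/-- The program contains an assignment to the variable `x`. -/
def SetsVar (x : Var) : Cmd → Bool
  | .set y _ => decide (x = y)
  | .seq c d => SetsVar x c || SetsVar x d
  | .ite _ c d => SetsVar x c || SetsVar x d
  | .while _ c => SetsVar x c
  | _ => false

/-- The program contains an assignment to a cell of the array `a`. -/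
def SetsArr (a : Arr) : Cmd → Bool
  | .put a' _ _ => decide (a = a')
  | .seq c d => SetsArr a c || SetsArr a d
  | .ite _ c d => SetsArr a c || SetsArr a d
  | .while _ c => SetsArr a c
  | _ => false

/-- The program contains an assignment to the real variable `x`. -/
def SetsRVar (x : RVar) : Cmd → Bool
  | .rset y _ => decide (x = y)
  | .seq c d => SetsRVar x c || SetsRVar x d
  | .ite _ c d => SetsRVar x c || SetsRVar x d
  | .while _ c => SetsRVar x c
  | _ => false

/-- The program contains an assignment to a cell of the real array `a`. -/
def SetsRArr (a : RArr) : Cmd → Bool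
  | .rput a' _ _ => decide (a = a')
  | .seq c d => SetsRArr a c || SetsRArr a d
  | .ite _ c d => SetsRArr a c || SetsRArr a d
  | .while _ c => SetsRArr a c
  | _ => false

end Cmd

/-- The memories `M` and `M'` agree on everything that the program `c` has no assignment to. -/
structure Same (c : Cmd) (M M' : Mem) : Prop where
  var : ∀ x, c.SetsVar x = false → M'.var x = M.var x
  arr : ∀ a, c.SetsArr a = false → M'.arr a = M.arr a
  rvar : ∀ x, c.SetsRVar x = false → M'.rvar x = M.rvar x
  rarr : ∀ a, c.SetsRArr a = false → M'.rarr a = M.rarr a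

theorem Same.refl (c : Cmd) (M : Mem) : Same c M M :=
  ⟨fun _ _ => rfl, fun _ _ => rfl, fun _ _ => rfl, fun _ _ => rfl⟩

theorem Same.trans {c : Cmd} {M M' M'' : Mem} (h : Same c M M') (h' : Same c M' M'') :
    Same c M M'' :=
  ⟨fun x hx => (h'.var x hx).trans (h.var x hx), fun x hx => (h'.arr x hx).trans (h.arr x hx),
    fun x hx => (h'.rvar x hx).trans (h.rvar x hx),
    fun x hx => (h'.rarr x hx).trans (h.rarr x hx)⟩

theorem Same.mono {c d : Cmd} {M M' : Mem} (h : Same c M M')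
    (hv : ∀ x, d.SetsVar x = false → c.SetsVar x = false)
    (ha : ∀ x, d.SetsArr x = false → c.SetsArr x = false)
    (hrv : ∀ x, d.SetsRVar x = false → c.SetsRVar x = false)
    (hra : ∀ x, d.SetsRArr x = false → c.SetsRArr x = false) : Same d M M' :=
  ⟨fun x hx => h.var x (hv x hx), fun x hx => h.arr x (ha x hx),
    fun x hx => h.rvar x (hrv x hx), fun x hx => h.rarr x (hra x hx)⟩

theorem Same.seq_left {c d : Cmd} {M M' : Mem} (h : Same c M M') : Same (.seq c d) M M' := by
  apply h.mono <;> simp +contextual [Cmd.SetsVar, Cmd.SetsArr, Cmd.SetsRVar, Cmd.SetsRArr]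

theorem Same.seq_right {c d : Cmd} {M M' : Mem} (h : Same d M M') : Same (.seq c d) M M' := by
  apply h.mono <;> simp +contextual [Cmd.SetsVar, Cmd.SetsArr, Cmd.SetsRVar, Cmd.SetsRArr]

theorem Same.while {s : Test} {c : Cmd} {M M' : Mem} (h : Same c M M') :
    Same (.while s c) M M' := by
  apply h.mono <;> simp +contextual [Cmd.SetsVar, Cmd.SetsArr, Cmd.SetsRVar, Cmd.SetsRArr]

theorem Exec.same {c : Cmd} {M M' : Mem} {k : ℕ} (h : Exec c M M' k) : Same c M M' := by
  induction h with
  | skip M => exact Same.refl _ _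
  | set M x y =>
    constructor <;> simp +contextual [Cmd.SetsVar]
  | put M a i y =>
    constructor <;> simp +contextual [Cmd.SetsArr]
  | rset M x y =>
    constructor <;> simp +contextual [Cmd.SetsRVar]
  | rput M a i y =>
    constructor <;> simp +contextual [Cmd.SetsRArr]
  | seq _ _ ih ih' => exact ih.seq_left.trans ih'.seq_right
  | iteTrue _ _ ih =>
    apply ih.mono <;> simp +contextual [Cmd.SetsVar, Cmd.SetsArr, Cmd.SetsRVar, Cmd.SetsRArr]
  | iteFalse _ _ ih =>
    apply ih.mono <;> simp +contextual [Cmd.SetsVar, Cmd.SetsArr, Cmd.SetsRVar, Cmd.SetsRArr]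
  | whileFalse _ => exact Same.refl _ _
  | whileTrue _ _ _ ih ih' => exact ih.while.trans ih'

/-- Total correctness: `c`, started in `M`, halts in a memory and after a number of steps that
satisfy `Q`. -/
def Runs (c : Cmd) (M : Mem) (Q : Mem → ℕ → Prop) : Prop := ∃ M' k, Exec c M M' k ∧ Q M' k

section

variable {c d : Cmd} {M : Mem} {Q Q' : Mem → ℕ → Prop}

theorem Runs.mono (h : Runs c M Q) (hQ : ∀ M' k, Same c M M' → Q M' k → Q' M' k) :
    Runs c M Q' := by
  obtain ⟨M', k, hc, hq⟩ := h
  exact ⟨M', k, hc, hQ _ _ hc.same hq⟩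

@[simp] theorem runs_skip : Runs .skip M Q ↔ Q M 1 :=
  ⟨fun ⟨_, _, h, hq⟩ => by cases h; exact hq, fun h => ⟨_, _, .skip _, h⟩⟩

@[simp] theorem runs_set {x : Var} {y : NExp} :
    Runs (.set x y) M Q ↔ Q (M.setVar x (y.eval M)) (y.cost + 1) :=
  ⟨fun ⟨_, _, h, hq⟩ => by cases h; exact hq, fun h => ⟨_, _, .set _ _ _, h⟩⟩

@[simp] theorem runs_put {a : Arr} {i y : NExp} :
    Runs (.put a i y) M Q ↔ Q (M.setArr a (i.eval M) (y.eval M)) (i.cost + y.cost + 1) :=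
  ⟨fun ⟨_, _, h, hq⟩ => by cases h; exact hq, fun h => ⟨_, _, .put _ _ _ _, h⟩⟩

@[simp] theorem runs_rset {x : RVar} {y : RExp} :
    Runs (.rset x y) M Q ↔ Q (M.setRVar x (y.eval M)) (y.cost + 1) :=
  ⟨fun ⟨_, _, h, hq⟩ => by cases h; exact hq, fun h => ⟨_, _, .rset _ _ _, h⟩⟩

@[simp] theorem runs_rput {a : RArr} {i : NExp} {y : RExp} :
    Runs (.rput a i y) M Q ↔ Q (M.setRArr a (i.eval M) (y.eval M)) (i.cost + y.cost + 1) :=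
  ⟨fun ⟨_, _, h, hq⟩ => by cases h; exact hq, fun h => ⟨_, _, .rput _ _ _ _, h⟩⟩

@[simp] theorem runs_seq :
    Runs (.seq c d) M Q ↔ Runs c M fun M' k => Runs d M' fun M'' l => Q M'' (k + l) :=
  ⟨fun ⟨_, _, h, hq⟩ => by cases h with | seq hc hd => exact ⟨_, _, hc, _, _, hd, hq⟩,
    fun ⟨_, _, hc, _, _, hd, hq⟩ => ⟨_, _, .seq hc hd, hq⟩⟩

@[simp] theorem runs_ite {s : Test} :
    Runs (.ite s c d) M Q ↔ (s.Holds M → Runs c M fun M' k => Q M' (s.cost + k + 1)) ∧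
      (¬ s.Holds M → Runs d M fun M' k => Q M' (s.cost + k + 1)) := by
  constructor
  · rintro ⟨_, _, h, hq⟩
    cases h with
    | iteTrue hs hc => exact ⟨fun _ => ⟨_, _, hc, hq⟩, fun h => absurd hs h⟩
    | iteFalse hs hc => exact ⟨fun h => absurd h hs, fun _ => ⟨_, _, hc, hq⟩⟩
  · rintro ⟨h, h'⟩
    by_cases hs : s.Holds M
    · obtain ⟨_, _, hc, hq⟩ := h hs
      exact ⟨_, _, .iteTrue hs hc, hq⟩
    · obtain ⟨_, _, hc, hq⟩ := h' hs
      exact ⟨_, _, .iteFalse hs hc, hq⟩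

@[simp] theorem runs_when {s : Test} :
    Runs (.when s c) M Q ↔ (s.Holds M → Runs c M fun M' k => Q M' (s.cost + k + 1)) ∧
      (¬ s.Holds M → Q M (s.cost + 2)) := by
  simp [Cmd.when]

@[simp] theorem block_singleton : Cmd.block [c] = c := rfl

@[simp] theorem block_cons_cons {cs : List Cmd} :
    Cmd.block (c :: d :: cs) = .seq c (Cmd.block (d :: cs)) := rfl

theorem Runs.while_false {s : Test} (hs : ¬ s.Holds M) (h : Q M (s.cost + 1)) :
    Runs (.while s c) M Q :=
  ⟨_, _, .whileFalse hs, h⟩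

theorem Runs.while_true {s : Test} (hs : s.Holds M)
    (h : Runs c M fun M' k => Runs (.while s c) M' fun M'' l => Q M'' (s.cost + k + l + 1)) :
    Runs (.while s c) M Q := by
  obtain ⟨_, _, hc, _, _, hw, hq⟩ := h
  exact ⟨_, _, .whileTrue hs hc hw, hq⟩

/-- Rule for loops. `P M K` is the invariant together with the number `K` of steps that are still
available, so that the rule covers amortized costs. -/
theorem Runs.while {s : Test} (P : Mem → ℕ → Prop) {K : ℕ} (h0 : P M K)
    (step : ∀ M' K, Same (.while s c) M M' → P M' K → s.Holds M' →
      Runs c M' fun M'' k => ∃ K', P M'' K' ∧ k + s.cost + 1 + K' ≤ K) :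
    Runs (.while s c) M fun M' k => (∃ K', P M' K') ∧ ¬ s.Holds M' ∧ k ≤ K + s.cost + 1 := by
  have main : ∀ K M', Same (.while s c) M M' → P M' K →
      Runs (.while s c) M' fun M'' k => (∃ K', P M'' K') ∧ ¬ s.Holds M'' ∧
        k ≤ K + s.cost + 1 := by
    intro K
    induction K using Nat.strong_induction_on with
    | _ K ih =>
      intro M' hM' hP
      by_cases hs : s.Holds M'
      · obtain ⟨M1, k1, hc, K', hP', hk⟩ := step M' K hM' hP hs
        obtain ⟨M2, k2, hw, hP2, hs2, hk2⟩ := ih K' (by omega) M1 (hM'.trans hc.same.while) hP'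
        exact ⟨M2, _, .whileTrue hs hc hw, hP2, hs2, by omega⟩
      · exact ⟨M', _, .whileFalse hs, ⟨K, hP⟩, hs, by omega⟩
  exact main K M (Same.refl _ _) h0

/-- Rule for `for` loops. `I i` is the invariant before the round `i`, and `K i` bounds the number
of steps of this round. -/
theorem Runs.forTo {x z : Var} (I : ℕ → Mem → Prop) (K : ℕ → ℕ)
    (hz : (Cmd.forTo x (.var z) c).SetsVar z = false) (hx : c.SetsVar x = false)
    (h0 : I 0 (M.setVar x 0))
    (step : ∀ i M', i < M.var z → M'.var x = i → Same (.forTo x (.var z) c) M M' → I i M' →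
      Runs c M' fun M'' k => k ≤ K i ∧ I (i + 1) (M''.setVar x (i + 1))) :
    Runs (.forTo x (.var z) c) M fun M' k => I (M.var z) M' ∧
      k ≤ ∑ i ∈ Finset.range (M.var z), (K i + 8) + 6 := by
  set N := M.var z with hN
  have hzx : z ≠ x := by
    rintro rfl
    simp [Cmd.forTo, Cmd.SetsVar] at hz
  unfold Cmd.forTo
  rw [runs_seq, runs_set]
  have hS0 : Same (.forTo x (.var z) c) M (M.setVar x 0) :=
    (Exec.set M x (.lit 0)).same.seq_left
  have := Runs.while (s := .lt (.var x) (.var z)) (c := .seq c (.set x (.var x + 1)))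
    (M := M.setVar x 0)
    (fun M' k => ∃ i, i ≤ N ∧ M'.var x = i ∧ I i M' ∧ Same (.forTo x (.var z) c) M M' ∧
      k = ∑ j ∈ Finset.Ico i N, (K j + 8)) (K := ∑ j ∈ Finset.range N, (K j + 8))
    ⟨0, Nat.zero_le _, by simp, h0, hS0, by rw [Finset.range_eq_Ico]⟩ ?_
  · refine this.mono ?_
    rintro M' k - ⟨⟨_, i, hi, hxi, hI, hS, -⟩, hlt, hk⟩
    have hz' : M'.var z = N := hS.var z hz
    simp only [Test.holds_lt, NExp.eval_var, hxi, hz'] at hlt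
    obtain rfl : i = N := by omega
    refine ⟨hI, ?_⟩
    simp at hk ⊢
    omega
  · rintro M' k - ⟨i, hi, hxi, hI, hS, rfl⟩ hlt
    have hz' : M'.var z = N := hS.var z hz
    simp only [Test.holds_lt, NExp.eval_var, hxi, hz'] at hlt
    rw [runs_seq]
    refine (step i M' hlt hxi hS hI).mono ?_
    rintro M1 k1 hs1 ⟨hk1, hI1⟩
    have hx1 : M1.var x = i := (hs1.var x hx).trans hxi
    simp only [runs_set, NExp.eval_add, NExp.eval_var, NExp.eval_ofNat, hx1, NExp.cost_add,
      NExp.cost_var, NExp.cost_ofNat, Test.cost_lt]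
    refine ⟨∑ j ∈ Finset.Ico (i + 1) N, (K j + 8), ⟨i + 1, hlt, by simp, hI1, ?_, rfl⟩, ?_⟩
    · have h1 : Same (.forTo x (.var z) c) M' M1 := hs1.seq_left.while.seq_right
      have h2 : Same (.forTo x (.var z) c) M1 (M1.setVar x (i + 1)) := by
        constructor <;> simp +contextual [Cmd.forTo, Cmd.SetsVar]
      exact hS.trans (h1.trans h2)
    · rw [Finset.sum_eq_sum_Ico_succ_bot hlt]
      omega

/-- Rule for `for` loops all of whose rounds have the same bound `K` for the number of steps. -/
theorem Runs.forTo_const {x z : Var} (I : ℕ → Mem → Prop) (K : ℕ)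
    (hz : (Cmd.forTo x (.var z) c).SetsVar z = false) (hx : c.SetsVar x = false)
    (h0 : I 0 (M.setVar x 0))
    (step : ∀ i M', i < M.var z → M'.var x = i → Same (.forTo x (.var z) c) M M' → I i M' →
      Runs c M' fun M'' k => k ≤ K ∧ I (i + 1) (M''.setVar x (i + 1))) :
    Runs (.forTo x (.var z) c) M fun M' k => I (M.var z) M' ∧ k ≤ M.var z * (K + 8) + 6 := by
  simpa using Runs.forTo I (fun _ => K) hz hx h0 step

end

/-! ### Distances and simple paths -/

namespace AttackGraph

variable {G : AttackGraph}

/-- The destination can be reached from every node. -/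
def Reaching (G : AttackGraph) : Prop := ∀ v, ∃ p, G.IsWalk p v G.da

/-- The nodes at which simple paths end: the destination and the splitting nodes. -/
def IsEnd (G : AttackGraph) (v : Fin G.n) : Prop := v = G.da ∨ 2 ≤ G.outDegree v

instance instDecidableIsEnd (v : Fin G.n) : Decidable (G.IsEnd v) :=
  inferInstanceAs (Decidable (v = G.da ∨ 2 ≤ G.outDegree v))

theorem isEnd_da : G.IsEnd G.da := Or.inl rfl

theorem mem_splitting {v : Fin G.n} : v ∈ G.splitting ↔ v ≠ G.da ∧ G.IsEnd v := by
  simp only [splitting, IsEnd, Finset.mem_filter, Finset.mem_univ, true_and]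
  tauto

theorem Reaching.exists_edge (hG : G.Reaching) {v : Fin G.n} (hv : v ≠ G.da) :
    ∃ e, G.tail e = v := by
  obtain ⟨p, hp⟩ := hG v
  cases p with
  | nil => exact absurd hp hv
  | cons e p => exact ⟨e, hp.1⟩

theorem edge_unique {v : Fin G.n} (hv : ¬ G.IsEnd v) {e e' : Fin G.m} (he : G.tail e = v)
    (he' : G.tail e' = v) : e = e' := by
  have h : (Finset.univ.filter fun e => G.tail e = v).card ≤ 1 := by
    simp only [IsEnd, outDegree] at hv
    omega
  exact Finset.card_le_one.mp h e (by simpa using he) e' (by simpa using he')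

/-! #### The distance to the destination -/

theorem dist_da (B : Finset (Fin G.m)) : G.dist B G.da = 0 := by
  refine le_antisymm ?_ zero_le
  exact (iInf₂_le [] ⟨rfl, by simp⟩).trans (by simp)

theorem dist_tail_le {B : Finset (Fin G.m)} {e : Fin G.m} (he : e ∉ B) :
    G.dist B (G.tail e) ≤ G.dist B (G.head e) + 1 := by
  unfold dist
  rw [ENat.iInf_add]
  refine le_iInf fun p => ?_
  by_cases hp : p ∈ {p : List (Fin G.m) | G.IsWalk p (G.head e) G.da ∧ ∀ e ∈ p, e ∉ B}
  · rw [iInf_pos hp]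
    refine (iInf₂_le (e :: p) ⟨⟨rfl, hp.1⟩, ?_⟩).trans (by simp)
    simpa [he] using hp.2
  · rw [iInf_neg hp]
    simp

/-- A potential that vanishes at the destination and that drops by at most one along every edge
that is not blocked is a lower bound for the distance. -/
theorem le_dist {B : Finset (Fin G.m)} (φ : Fin G.n → ℕ∞) (h0 : φ G.da = 0)
    (h : ∀ e, e ∉ B → φ (G.tail e) ≤ φ (G.head e) + 1) (v : Fin G.n) : φ v ≤ G.dist B v := by
  refine le_iInf₂ fun p => ?_
  rintro ⟨hp, hB⟩
  induction p generalizing v with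
  | nil =>
    have hv : v = G.da := hp
    simp [hv, h0]
  | cons e p ih =>
    obtain ⟨rfl, hp⟩ := hp
    refine (h e (hB e (by simp))).trans ?_
    rw [List.length_cons, Nat.cast_add, Nat.cast_one]
    gcongr
    exact ih _ hp fun e he => hB e (by simp [he])

theorem exists_dist_step {B : Finset (Fin G.m)} {v : Fin G.n} (hv : v ≠ G.da)
    (hd : G.dist B v ≠ ⊤) :
    ∃ e, e ∉ B ∧ G.tail e = v ∧ G.dist B v = G.dist B (G.head e) + 1 := by
  by_contra! hcon
  -- Otherwise the distance stays a potential if its value at `v` is raised by one.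
  have key := le_dist (B := B) (Function.update (G.dist B) v (G.dist B v + 1))
    (by rw [Function.update_of_ne hv.symm, dist_da]) (fun e he => ?_) v
  · rw [Function.update_self] at key
    exact absurd key (by simp [ENat.lt_add_one_iff hd])
  · have hle : G.dist B (G.head e) ≤
        Function.update (G.dist B) v (G.dist B v + 1) (G.head e) := by
      rw [Function.update_apply]
      split_ifs with h
      · rw [h]; exact le_self_add
      · exact le_rfl
    refine le_trans ?_ (add_le_add_left hle 1)
    rw [Function.update_apply]
    split_ifs with h
    · have h1 := dist_tail_le he
      rw [h] at h1
      have h2 := lt_of_le_of_ne h1 (hcon e he h)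
      exact Order.add_one_le_of_lt h2
    · exact dist_tail_le he

/-! #### Simple paths -/

/-- Induction along simple paths, from their ends. -/
theorem Reaching.chain_induction (hG : G.Reaching) {P : Fin G.n → Prop}
    (hend : ∀ v, G.IsEnd v → P v)
    (hstep : ∀ e, ¬ G.IsEnd (G.tail e) → P (G.head e) → P (G.tail e)) (v : Fin G.n) : P v := by
  obtain ⟨p, hp⟩ := hG v
  induction p generalizing v with
  | nil =>
    have hv : v = G.da := hp
    exact hend v (hv ▸ isEnd_da)
  | cons e p ih =>
    obtain ⟨rfl, hp⟩ := hp
    by_cases he : G.IsEnd (G.tail e)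
    · exact hend _ he
    · exact hstep e he (ih _ hp)

/-- `IsChain v p w`: the walk `p` runs from `v` to the first node `w` at which simple paths end. -/
inductive IsChain (G : AttackGraph) : Fin G.n → List (Fin G.m) → Fin G.n → Prop
  | nil {v : Fin G.n} (hv : G.IsEnd v) : IsChain G v [] v
  | cons {e : Fin G.m} {p : List (Fin G.m)} {w : Fin G.n} (he : ¬ G.IsEnd (G.tail e))
      (hp : IsChain G (G.head e) p w) : IsChain G (G.tail e) (e :: p) w

theorem IsChain.unique {v w w' : Fin G.n} {p p' : List (Fin G.m)} (h : G.IsChain v p w)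
    (h' : G.IsChain v p' w') : p = p' ∧ w = w' := by
  induction h generalizing p' w' with
  | nil hv =>
    cases h' with
    | nil => exact ⟨rfl, rfl⟩
    | cons he _ => exact absurd hv he
  | @cons e p w he hp ih =>
    generalize hx : G.tail e = x at h'
    cases h' with
    | nil hv => exact absurd (hx ▸ hv) he
    | @cons e' _ _ he' hp' =>
      obtain rfl := edge_unique he rfl hx.symm
      obtain ⟨rfl, rfl⟩ := ih hp'
      exact ⟨rfl, rfl⟩

theorem Reaching.exists_isChain (hG : G.Reaching) (v : Fin G.n) :
    ∃ q : List (Fin G.m) × Fin G.n, G.IsChain v q.1 q.2 := by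
  induction v using hG.chain_induction with
  | hend v hv => exact ⟨([], v), .nil hv⟩
  | hstep e he ih =>
    obtain ⟨⟨p, w⟩, hq⟩ := ih
    exact ⟨(e :: p, w), .cons he hq⟩

open Classical in
/-- The edges of the walk from `v` to the first node at which simple paths end. -/
noncomputable def chain (G : AttackGraph) (v : Fin G.n) : List (Fin G.m) :=
  if h : ∃ q : List (Fin G.m) × Fin G.n, G.IsChain v q.1 q.2 then h.choose.1 else []

open Classical in
/-- The last node of `chain v`. -/
noncomputable def chainEnd (G : AttackGraph) (v : Fin G.n) : Fin G.n :=
  if h : ∃ q : List (Fin G.m) × Fin G.n, G.IsChain v q.1 q.2 then h.choose.2 else v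

theorem Reaching.isChain (hG : G.Reaching) (v : Fin G.n) :
    G.IsChain v (G.chain v) (G.chainEnd v) := by
  have h := hG.exists_isChain v
  simpa only [chain, chainEnd, dif_pos h] using h.choose_spec

/-- The simple path of the route that starts with the edge `e`. -/
noncomputable def route (G : AttackGraph) (e : Fin G.m) : List (Fin G.m) :=
  e :: G.chain (G.head e)

section

variable (hG : G.Reaching)
include hG

theorem Reaching.chain_of_isEnd {v : Fin G.n} (hv : G.IsEnd v) : G.chain v = [] :=
  ((hG.isChain v).unique (.nil hv)).1

theorem Reaching.chainEnd_of_isEnd {v : Fin G.n} (hv : G.IsEnd v) : G.chainEnd v = v :=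
  ((hG.isChain v).unique (.nil hv)).2

theorem Reaching.chain_tail {e : Fin G.m} (he : ¬ G.IsEnd (G.tail e)) :
    G.chain (G.tail e) = G.route e :=
  ((hG.isChain _).unique (.cons he (hG.isChain _))).1

theorem Reaching.chainEnd_tail {e : Fin G.m} (he : ¬ G.IsEnd (G.tail e)) :
    G.chainEnd (G.tail e) = G.chainEnd (G.head e) :=
  ((hG.isChain _).unique (.cons he (hG.isChain _))).2

theorem Reaching.isEnd_chainEnd (v : Fin G.n) : G.IsEnd (G.chainEnd v) := by
  induction v using hG.chain_induction with
  | hend v hv => rwa [hG.chainEnd_of_isEnd hv]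
  | hstep e he ih => rwa [hG.chainEnd_tail he]

theorem Reaching.not_isEnd_tail {v : Fin G.n} {e : Fin G.m} (he : e ∈ G.chain v) :
    ¬ G.IsEnd (G.tail e) := by
  induction v using hG.chain_induction with
  | hend v hv => simp [hG.chain_of_isEnd hv] at he
  | hstep e' he' ih =>
    rw [hG.chain_tail he', route, List.mem_cons] at he
    rcases he with rfl | he
    · exact he'
    · exact ih he

/-- Simple paths that meet have the rest of the way in common. -/
theorem Reaching.route_suffix_chain {v : Fin G.n} {e : Fin G.m} (he : e ∈ G.chain v) :
    G.route e <:+ G.chain v := by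
  induction v using hG.chain_induction with
  | hend v hv => simp [hG.chain_of_isEnd hv] at he
  | hstep e' he' ih =>
    rw [hG.chain_tail he']
    rw [hG.chain_tail he', route, List.mem_cons] at he
    rcases he with rfl | he
    · exact List.suffix_rfl
    · exact (ih he).trans (List.suffix_cons _ _)

theorem Reaching.route_suffix_route {r e : Fin G.m} (he : e ∈ G.route r) :
    G.route e <:+ G.route r := by
  rw [route, List.mem_cons] at he
  rcases he with rfl | he
  · exact List.suffix_rfl
  · exact (hG.route_suffix_chain he).trans (List.suffix_cons _ _)

theorem Reaching.dist_chain_le {B : Finset (Fin G.m)} {v : Fin G.n}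
    (h : ∀ e ∈ G.chain v, e ∉ B) :
    G.dist B v ≤ (G.chain v).length + G.dist B (G.chainEnd v) := by
  induction v using hG.chain_induction with
  | hend v hv => simp [hG.chain_of_isEnd hv, hG.chainEnd_of_isEnd hv]
  | hstep e he ih =>
    rw [hG.chain_tail he, route] at h ⊢
    rw [hG.chainEnd_tail he, List.length_cons]
    refine (dist_tail_le (h e (by simp))).trans ?_
    refine (add_le_add_left (ih fun e' he' => h e' (by simp [he'])) 1).trans (le_of_eq ?_)
    push_cast
    ring

theorem Reaching.dist_eq_chain {B : Finset (Fin G.m)} {v : Fin G.n}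
    (hv : G.dist B v ≠ ⊤) : (∀ e ∈ G.chain v, e ∉ B) ∧
      G.dist B v = (G.chain v).length + G.dist B (G.chainEnd v) := by
  induction v using hG.chain_induction with
  | hend v hend => simp [hG.chain_of_isEnd hend, hG.chainEnd_of_isEnd hend]
  | hstep e he ih =>
    have hne : G.tail e ≠ G.da := fun h => he (h ▸ isEnd_da)
    obtain ⟨e', he', ht, hd⟩ := exists_dist_step hne hv
    obtain rfl := edge_unique he rfl ht
    have hfin : G.dist B (G.head e) ≠ ⊤ := by
      intro h
      simp [hd, h] at hv
    obtain ⟨h1, h2⟩ := ih hfin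
    rw [hG.chain_tail he, hG.chainEnd_tail he, hd, h2, route, List.length_cons]
    refine ⟨?_, by push_cast; ring⟩
    simpa [he'] using h1

end

/-! #### Counting -/

theorem Reaching.dist_empty_ne_top (hG : G.Reaching) (v : Fin G.n) : G.dist ∅ v ≠ ⊤ := by
  obtain ⟨p, hp⟩ := hG v
  exact ne_top_of_le_ne_top (ENat.natCast_ne_top p.length) (iInf₂_le p ⟨hp, by simp⟩)

theorem exists_shortest_path {B : Finset (Fin G.m)} (k : ℕ) (v : Fin G.n)
    (hv : G.dist B v = k) :
    ∃ p, G.IsPath p v G.da ∧ p.length = k ∧ ∀ w ∈ p.map G.head, G.dist B w < k := by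
  induction k generalizing v with
  | zero =>
    have : v = G.da := by
      by_contra hne
      obtain ⟨e, -, -, he⟩ := exists_dist_step hne (by rw [hv]; exact ENat.natCast_ne_top _)
      rw [hv] at he
      exact absurd he.symm (by simp)
    exact ⟨[], ⟨this, by simp⟩, rfl, by simp⟩
  | succ k ih =>
    have hne : v ≠ G.da := by
      rintro rfl
      rw [dist_da] at hv
      exact absurd hv.symm (by push_cast; simp)
    obtain ⟨e, -, rfl, he⟩ := exists_dist_step hne (by rw [hv]; exact ENat.natCast_ne_top _)
    have hk : G.dist B (G.head e) = k := by
      rw [hv] at he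
      push_cast at he
      exact (WithTop.add_right_cancel ENat.one_ne_top he).symm
    obtain ⟨p, hp, hl, hw⟩ := ih _ hk
    have hlt : ((k : ℕ) : ℕ∞) < ((k + 1 : ℕ) : ℕ∞) := by
      exact_mod_cast Nat.lt_succ_self k
    have hw' : ∀ w ∈ (e :: p).map G.head, G.dist B w < (k + 1 : ℕ) := by
      intro w hmem
      rw [List.map_cons, List.mem_cons] at hmem
      rcases hmem with rfl | hmem
      · rw [hk]; exact hlt
      · exact (hw w hmem).trans hlt
    refine ⟨e :: p, ⟨⟨rfl, hp.1⟩, ?_⟩, by simp [hl], hw'⟩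
    rw [List.nodup_cons]
    exact ⟨fun h => absurd hv (hw' _ h).ne, by simpa using hp.2⟩

theorem lt_of_dist_eq {B : Finset (Fin G.m)} {k : ℕ} {v : Fin G.n} (hv : G.dist B v = k) :
    k < G.n := by
  obtain ⟨p, hp, rfl, -⟩ := exists_shortest_path k v hv
  simpa using hp.2.length_le_card

theorem Reaching.length_chain_le (hG : G.Reaching) (v : Fin G.n) :
    (G.chain v).length ≤ G.maxPathLength := by
  obtain ⟨k, hk⟩ := ENat.ne_top_iff_exists.mp (hG.dist_empty_ne_top v)
  obtain ⟨p, hp, hl, -⟩ := exists_shortest_path k v hk.symm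
  have h1 : (G.chain v).length ≤ k := by
    have h2 := (hG.dist_eq_chain (hG.dist_empty_ne_top v)).2
    rw [← hk] at h2
    have h3 : ((G.chain v).length : ℕ∞) ≤ k := h2 ▸ le_self_add
    exact_mod_cast h3
  refine h1.trans (le_csSup ⟨G.n, ?_⟩ ⟨v, p, hp, hl⟩)
  rintro _ ⟨u, q, hq, rfl⟩
  have := hq.2.length_le_card
  simp at this
  omega

theorem sum_outDegree : ∑ v, G.outDegree v = G.m := by
  have := Finset.card_eq_sum_card_fiberwise (s := (Finset.univ : Finset (Fin G.m)))
    (t := Finset.univ) (f := G.tail) (by simp)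
  simpa [outDegree] using this.symm

theorem Reaching.sum_splitting_le (hG : G.Reaching) :
    ∑ v ∈ G.splitting, (G.outDegree v - 1) ≤ G.feedback := by
  have h1 : ∀ v, v ≠ G.da → 1 ≤ G.outDegree v := by
    intro v hv
    obtain ⟨e, he⟩ := hG.exists_edge hv
    exact Finset.card_pos.mpr ⟨e, by simpa using he⟩
  have h2 : ∑ v ∈ G.splitting, (G.outDegree v - 1) ≤
      ∑ v ∈ Finset.univ.erase G.da, (G.outDegree v - 1) := by
    refine Finset.sum_le_sum_of_subset fun v hv => ?_
    simpa using (mem_splitting.mp hv).1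
  have h3 : ∑ v ∈ Finset.univ.erase G.da, (G.outDegree v - 1) + (G.n - 1) =
      ∑ v ∈ Finset.univ.erase G.da, G.outDegree v := by
    have : G.n - 1 = ∑ v ∈ Finset.univ.erase G.da, 1 := by simp
    rw [this, ← Finset.sum_add_distrib]
    refine Finset.sum_congr rfl fun v hv => ?_
    have := h1 v (by simpa using hv)
    omega
  have h4 : ∑ v ∈ Finset.univ.erase G.da, G.outDegree v ≤ G.m := by
    rw [← sum_outDegree (G := G)]
    exact Finset.sum_le_sum_of_subset (Finset.erase_subset _ _)
  unfold feedback
  omega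

theorem Reaching.card_splitting_le (hG : G.Reaching) : G.splitting.card ≤ G.feedback := by
  refine le_trans ?_ hG.sum_splitting_le
  rw [Finset.card_eq_sum_ones]
  refine Finset.sum_le_sum fun v hv => ?_
  simp only [splitting, Finset.mem_filter] at hv
  omega

theorem Reaching.sum_outDegree_splitting_le (hG : G.Reaching) :
    ∑ v ∈ G.splitting, G.outDegree v ≤ 2 * G.feedback := by
  refine le_trans ?_ (Nat.mul_le_mul_left 2 hG.sum_splitting_le)
  rw [Finset.mul_sum]
  refine Finset.sum_le_sum fun v hv => ?_
  simp only [splitting, Finset.mem_filter] at hv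
  omega

theorem m_le : G.m ≤ G.feedback + G.n := by
  unfold feedback
  omega

theorem Reaching.strategyCount_le (hG : G.Reaching) : G.strategyCount ≤ 3 ^ G.feedback := by
  have h3 : ∀ d : ℕ, d + 3 ≤ 3 ^ (d + 1) := by
    intro d
    induction d with
    | zero => simp
    | succ d ih => rw [pow_succ]; omega
  calc G.strategyCount ≤ ∏ v ∈ G.splitting, 3 ^ (G.outDegree v - 1) := by
        refine Finset.prod_le_prod' fun v hv => ?_
        simp only [splitting, Finset.mem_filter] at hv
        obtain ⟨d, hd⟩ := Nat.exists_eq_add_of_le hv.2.2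
        have := h3 d
        rw [hd, show 2 + d - 1 = d + 1 by omega]
        omega
    _ = 3 ^ ∑ v ∈ G.splitting, (G.outDegree v - 1) := Finset.prod_pow_eq_pow_sum _ _ _
    _ ≤ 3 ^ G.feedback := Nat.pow_le_pow_right (by norm_num) hG.sum_splitting_le

end AttackGraph

/-! ### Strategies of the attacker -/

/-- The last member of the list `p` that belongs to `F`. -/
def lastIn {α : Type*} [DecidableEq α] (F : Finset α) (p : List α) : Option α :=
  (p.filter (· ∈ F)).getLast?

section lastIn

variable {α : Type*} [DecidableEq α] {F : Finset α} {p q : List α} {e : α}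

@[simp] theorem lastIn_nil : lastIn F [] = none := rfl

theorem lastIn_append_singleton :
    lastIn F (p ++ [e]) = if e ∈ F then some e else lastIn F p := by
  unfold lastIn
  split_ifs with h <;> simp [List.filter_append, h]

theorem lastIn_cons :
    lastIn F (e :: p) = (lastIn F p).or (if e ∈ F then some e else none) := by
  unfold lastIn
  split_ifs with h <;> simp [h, List.getLast?_cons]

theorem mem_of_lastIn (h : lastIn F p = some e) : e ∈ p ∧ e ∈ F := by
  simpa using List.mem_filter.mp (List.mem_of_getLast? h)

theorem lastIn_eq_none : lastIn F p = none ↔ ∀ e ∈ p, e ∉ F := by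
  simp [lastIn]

theorem lastIn_of_suffix (hq : q <:+ p) (h : lastIn F q = some e) : lastIn F p = some e := by
  obtain ⟨s, rfl⟩ := hq
  unfold lastIn at h ⊢
  rw [List.filter_append, List.getLast?_append, h]
  rfl

theorem lastIn_eq_of_suffix (hq : q <:+ p) {a : α} (ha : a ∈ q) (haF : a ∈ F)
    (h : lastIn F p = some e) : lastIn F q = some e := by
  cases hc : lastIn F q with
  | none => exact absurd haF (lastIn_eq_none.mp hc a ha)
  | some e' => rw [← h, lastIn_of_suffix hq hc]

end lastIn

namespace AttackGraph

variable {G : AttackGraph}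

/-- A strategy of the attacker: one of the out-going edges, or `none`, at every splitting node. It
is `none` at the other nodes. -/
def IsStrategy (G : AttackGraph) (σ : Fin G.n → Option (Fin G.m)) : Prop :=
  ∀ v e, σ v = some e → v ∈ G.splitting ∧ G.tail e = v

/-- The edge `e` remains when only the chosen routes are kept at the splitting nodes. -/
def Kept (σ : Fin G.n → Option (Fin G.m)) (e : Fin G.m) : Prop :=
  ¬ G.IsEnd (G.tail e) ∨ σ (G.tail e) = some e

open Classical in
/-- The edges that the attacker does not use. -/
noncomputable def unkept (σ : Fin G.n → Option (Fin G.m)) : Finset (Fin G.m) :=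
  Finset.univ.filter fun e => ¬ Kept σ e

/-- The distance to the destination that results from the strategy `σ`. -/
noncomputable def stratDist (σ : Fin G.n → Option (Fin G.m)) (v : Fin G.n) : ℕ∞ :=
  G.dist (unkept σ) v

open Classical in
/-- The edges on the simple paths of the chosen routes. -/
noncomputable def marked (σ : Fin G.n → Option (Fin G.m)) : Finset (Fin G.m) :=
  Finset.univ.filter fun e => ∃ v r, σ v = some r ∧ e ∈ G.route r

/-- The edges that can be blocked against the strategy `σ`. -/
noncomputable def free (σ : Fin G.n → Option (Fin G.m)) : Finset (Fin G.m) :=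
  G.blockable \ marked σ

/-- The route `r` is not chosen by `σ`, although it is shorter than what `σ` chooses. -/
def Forced (σ : Fin G.n → Option (Fin G.m)) (r : Fin G.m) : Prop :=
  G.tail r ∈ G.splitting ∧ σ (G.tail r) ≠ some r ∧
    (G.route r).length + stratDist σ (G.chainEnd (G.head r)) < stratDist σ (G.tail r)

/-- If the edges in `B` are blocked, then the attacker can follow the strategy `σ`, and has no
reason to deviate from it. -/
def Consistent (σ : Fin G.n → Option (Fin G.m)) (B : Finset (Fin G.m)) : Prop :=
  (∀ e ∈ B, e ∉ marked σ) ∧ ∀ r, Forced σ r → ∃ e ∈ G.route r, e ∈ B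

variable {σ : Fin G.n → Option (Fin G.m)} {B : Finset (Fin G.m)}

theorem mem_unkept {e : Fin G.m} : e ∈ unkept σ ↔ ¬ Kept σ e := by
  simp [unkept]

theorem mem_marked {e : Fin G.m} : e ∈ marked σ ↔ ∃ v r, σ v = some r ∧ e ∈ G.route r := by
  simp [marked]

theorem mem_free {e : Fin G.m} : e ∈ free σ ↔ e ∈ G.blockable ∧ e ∉ marked σ := by
  simp [free]

theorem mem_route_self (r : Fin G.m) : r ∈ G.route r := by simp [route]

theorem IsStrategy.tail_ne_da (hσ : G.IsStrategy σ) {e : Fin G.m} (he : Kept σ e) :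
    G.tail e ≠ G.da := by
  rcases he with he | he
  · rintro h
    exact he (h ▸ isEnd_da)
  · exact (mem_splitting.mp (hσ _ _ he).1).1

theorem IsStrategy.kept_unique {e e' : Fin G.m} (he : Kept σ e)
    (he' : Kept σ e') (h : G.tail e = G.tail e') : e = e' := by
  rcases he with he | he
  · exact edge_unique he rfl h.symm
  · rcases he' with he' | he'
    · exact edge_unique he' h rfl
    · rw [h, he'] at he
      exact (Option.some.inj he).symm

theorem stratDist_da : stratDist σ G.da = 0 := dist_da _

theorem IsStrategy.stratDist_tail (hσ : G.IsStrategy σ) {e : Fin G.m} (he : Kept σ e) :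
    stratDist σ (G.tail e) = stratDist σ (G.head e) + 1 := by
  refine le_antisymm (dist_tail_le (by simpa [mem_unkept] using he)) ?_
  by_cases h : stratDist σ (G.tail e) = ⊤
  · rw [h]; exact le_top
  · obtain ⟨e', he', ht, hd⟩ := exists_dist_step (hσ.tail_ne_da he) h
    rw [mem_unkept, not_not] at he'
    obtain rfl := IsStrategy.kept_unique he he' ht.symm
    exact hd.ge

theorem stratDist_of_none {v : Fin G.n} (hv : v ∈ G.splitting) (h : σ v = none) :
    stratDist σ v = ⊤ := by
  by_contra hd
  obtain ⟨hne, hend⟩ := mem_splitting.mp hv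
  obtain ⟨e, he, rfl, -⟩ := exists_dist_step hne hd
  rw [mem_unkept, not_not] at he
  rcases he with he | he
  · exact he hend
  · simp [h] at he

section

variable (hG : G.Reaching) (hσ : G.IsStrategy σ)
include hG hσ

theorem IsStrategy.stratDist_eq_chain (v : Fin G.n) :
    stratDist σ v = (G.chain v).length + stratDist σ (G.chainEnd v) := by
  induction v using hG.chain_induction with
  | hend v hv => simp [hG.chain_of_isEnd hv, hG.chainEnd_of_isEnd hv]
  | hstep e he ih =>
    rw [hσ.stratDist_tail (.inl he), ih, hG.chain_tail he, hG.chainEnd_tail he, route,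
      List.length_cons]
    push_cast
    ring

theorem IsStrategy.stratDist_head (r : Fin G.m) : stratDist σ (G.head r) + 1 =
    (G.route r).length + stratDist σ (G.chainEnd (G.head r)) := by
  rw [hσ.stratDist_eq_chain hG, route, List.length_cons]
  push_cast
  ring

theorem IsStrategy.stratDist_of_some {v : Fin G.n} {r : Fin G.m} (h : σ v = some r) :
    stratDist σ v = (G.route r).length + stratDist σ (G.chainEnd (G.head r)) := by
  obtain ⟨-, rfl⟩ := hσ _ _ h
  rw [hσ.stratDist_tail (.inr h), hσ.stratDist_head hG]

/-- A strategy determines the distances in the graph without the blocked edges. -/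
theorem Consistent.dist_eq (hB : Consistent σ B) (v : Fin G.n) [Decidable (∃ e ∈ G.chain v, e ∈ B)] :
    G.dist B v = if ∃ e ∈ G.chain v, e ∈ B then ⊤ else stratDist σ v := by
  classical
  refine le_antisymm ?_ ?_
  · split_ifs with h
    · exact le_top
    push Not at h
    generalize hk : stratDist σ v = k
    cases k with
    | top => exact le_top
    | coe k =>
      induction k generalizing v with
      | zero =>
        by_cases hv : v = G.da
        · simp [hv, dist_da]
        · obtain ⟨e, -, -, he⟩ := exists_dist_step hv (B := unkept σ)
            (by rw [← stratDist, hk]; exact ENat.natCast_ne_top _)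
          rw [← stratDist, hk] at he
          exact absurd he.symm (by simp)
      | succ k ih =>
        have hv : v ≠ G.da := by
          rintro rfl
          rw [stratDist_da] at hk
          exact absurd hk.symm (by push_cast; simp)
        obtain ⟨e, he, rfl, hd⟩ := exists_dist_step hv (B := unkept σ)
          (by rw [← stratDist, hk]; exact ENat.natCast_ne_top _)
        rw [mem_unkept, not_not] at he
        have hd' : stratDist σ (G.head e) = k := by
          rw [← stratDist, hk] at hd
          exact (WithTop.add_right_cancel ENat.one_ne_top hd).symm
        have hroute : ∀ e' ∈ G.route e, e' ∉ B := by
          rcases he with he | he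
          · rwa [hG.chain_tail he] at h
          · exact fun e' he' hB' => hB.1 e' hB' (mem_marked.mpr ⟨_, _, he, he'⟩)
        refine (dist_tail_le (hroute e (mem_route_self e))).trans ?_
        push_cast
        exact add_le_add_left (ih _ (fun e' he' => hroute e' (List.mem_cons_of_mem _ he')) hd') 1
  · refine le_trans (le_of_eq ?_) (le_dist (B := B)
      (fun v => if ∃ e ∈ G.chain v, e ∈ B then ⊤ else stratDist σ v) ?_ ?_ v)
    · simp
    · simp [hG.chain_of_isEnd isEnd_da, stratDist_da]
    · intro e he
      by_cases hc : ∃ e' ∈ G.chain (G.head e), e' ∈ B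
      · simp [hc]
      have hroute : ¬ ∃ e' ∈ G.route e, e' ∈ B := by
        simpa [route, he] using hc
      rw [if_neg hc]
      by_cases hend : G.IsEnd (G.tail e)
      · rw [if_neg (by simp [hG.chain_of_isEnd hend])]
        by_cases hda : G.tail e = G.da
        · simp [hda, stratDist_da]
        by_cases hs : σ (G.tail e) = some e
        · exact (hσ.stratDist_tail (.inr hs)).le
        · by_contra hlt
          rw [not_le, hσ.stratDist_head hG] at hlt
          exact hroute (hB.2 e ⟨mem_splitting.mpr ⟨hda, hend⟩, hs, hlt⟩)
      · rw [hG.chain_tail hend, if_neg hroute]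
        exact (hσ.stratDist_tail (.inl hend)).le

theorem Consistent.dist_ne_top (hB : Consistent σ B) {v : Fin G.n} :
    G.dist B v ≠ ⊤ ↔ (∀ e ∈ G.chain v, e ∉ B) ∧ stratDist σ v ≠ ⊤ := by
  classical
  rw [hB.dist_eq hG hσ]
  split_ifs with h
  · simpa using fun h' => absurd h (by push Not; exact h')
  · push Not at h
    simp only [iff_and_self]
    exact fun _ => h

theorem Consistent.dist_eq_stratDist (hB : Consistent σ B) {v : Fin G.n}
    (hv : G.dist B v ≠ ⊤) : G.dist B v = stratDist σ v := by
  classical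
  rw [hB.dist_eq hG hσ] at hv ⊢
  split_ifs at hv ⊢ with h
  · exact absurd rfl hv
  · rfl

theorem Consistent.dist_tail (hB : Consistent σ B) {e : Fin G.m} (he : Kept σ e) (heB : e ∉ B) :
    G.dist B (G.tail e) = G.dist B (G.head e) + 1 := by
  classical
  rw [hB.dist_eq hG hσ, hB.dist_eq hG hσ, hσ.stratDist_tail he]
  have : (∃ e' ∈ G.chain (G.tail e), e' ∈ B) ↔ ∃ e' ∈ G.chain (G.head e), e' ∈ B := by
    by_cases hend : G.IsEnd (G.tail e)
    · have hs : σ (G.tail e) = some e := he.resolve_left (not_not_intro hend)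
      simp only [hG.chain_of_isEnd hend, List.not_mem_nil, false_and, exists_false, false_iff]
      rintro ⟨e', h1, h2⟩
      exact hB.1 e' h2 (mem_marked.mpr ⟨_, _, hs, List.mem_cons_of_mem _ h1⟩)
    · rw [hG.chain_tail hend, route]
      simp [heB]
  simp only [this]
  split_ifs <;> simp

theorem Consistent.exists_kept (hB : Consistent σ B) {v : Fin G.n} (hv : v ≠ G.da)
    (hd : G.dist B v ≠ ⊤) : ∃ e, Kept σ e ∧ e ∉ B ∧ G.tail e = v := by
  obtain ⟨hc, hs⟩ := (hB.dist_ne_top hG hσ).mp hd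
  obtain ⟨e, he, rfl, -⟩ := exists_dist_step hv hs
  rw [mem_unkept, not_not] at he
  refine ⟨e, he, ?_, rfl⟩
  by_cases hend : G.IsEnd (G.tail e)
  · have hs : σ (G.tail e) = some e := he.resolve_left (not_not_intro hend)
    exact fun h => hB.1 e h (mem_marked.mpr ⟨_, _, hs, mem_route_self e⟩)
  · rw [hG.chain_tail hend] at hc
    exact hc e (mem_route_self e)

omit hσ in
theorem lastIn_chain_tail {e : Fin G.m} (he : Kept σ e) :
    lastIn (free σ) (G.chain (G.tail e)) = (lastIn (free σ) (G.chain (G.head e))).or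
      (if e ∈ free σ then some e else none) := by
  by_cases hend : G.IsEnd (G.tail e)
  · have hs : σ (G.tail e) = some e := he.resolve_left (not_not_intro hend)
    have h1 : ∀ e' ∈ G.route e, e' ∉ free σ := fun e' he' h =>
      (mem_free.mp h).2 (mem_marked.mpr ⟨_, _, hs, he'⟩)
    have h2 : lastIn (free σ) (G.chain (G.head e)) = none :=
      lastIn_eq_none.mpr fun e' he' => h1 e' (List.mem_cons_of_mem _ he')
    rw [hG.chain_of_isEnd hend, h2, if_neg (h1 e (mem_route_self e))]
    rfl
  · rw [hG.chain_tail hend, route, lastIn_cons]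

end

/-! #### The best response to a defence -/

open Classical in
/-- The strategy that follows shortest paths in the graph without the edges in `B`. -/
noncomputable def response (G : AttackGraph) (B : Finset (Fin G.m)) (v : Fin G.n) :
    Option (Fin G.m) :=
  if h : v ∈ G.splitting ∧ G.dist B v ≠ ⊤ then
    some (exists_dist_step (mem_splitting.mp h.1).1 h.2).choose
  else none

theorem response_spec {v : Fin G.n} {r : Fin G.m} (h : G.response B v = some r) :
    v ∈ G.splitting ∧ G.dist B v ≠ ⊤ ∧ r ∉ B ∧ G.tail r = v ∧
      G.dist B v = G.dist B (G.head r) + 1 := by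
  unfold response at h
  split_ifs at h with hv
  obtain rfl := Option.some.inj h
  exact ⟨hv.1, hv.2, (exists_dist_step (mem_splitting.mp hv.1).1 hv.2).choose_spec⟩

theorem exists_response {v : Fin G.n} (hv : v ∈ G.splitting) (hd : G.dist B v ≠ ⊤) :
    ∃ r, G.response B v = some r := by
  simp [response, hv, hd]

theorem isStrategy_response : G.IsStrategy (G.response B) := fun _ _ h =>
  ⟨(response_spec h).1, (response_spec h).2.2.2.1⟩

/-- Following the best response, the attacker needs no more steps than on a shortest path. -/
theorem stratDist_response_le (k : ℕ) (v : Fin G.n) (hk : G.dist B v = k) :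
    stratDist (G.response B) v ≤ k := by
  have step : ∀ v, v ≠ G.da → G.dist B v ≠ ⊤ →
      ∃ e, Kept (G.response B) e ∧ G.tail e = v ∧ G.dist B v = G.dist B (G.head e) + 1 := by
    intro v hv hd
    by_cases hend : G.IsEnd v
    · obtain ⟨r, hr⟩ := exists_response (mem_splitting.mpr ⟨hv, hend⟩) hd
      obtain ⟨-, -, -, rfl, h⟩ := response_spec hr
      exact ⟨r, .inr hr, rfl, h⟩
    · obtain ⟨e, -, rfl, he⟩ := exists_dist_step hv hd
      exact ⟨e, .inl hend, rfl, he⟩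
  induction k generalizing v with
  | zero =>
    by_cases hv : v = G.da
    · simp [hv, stratDist_da]
    · obtain ⟨e, -, -, he⟩ := step v hv (by rw [hk]; exact ENat.natCast_ne_top _)
      rw [hk] at he
      exact absurd he.symm (by simp)
  | succ k ih =>
    have hv : v ≠ G.da := by
      rintro rfl
      rw [dist_da] at hk
      exact absurd hk.symm (by push_cast; simp)
    obtain ⟨e, he, rfl, hd⟩ := step v hv (by rw [hk]; exact ENat.natCast_ne_top _)
    rw [hk] at hd
    have hd' : G.dist B (G.head e) = k := (WithTop.add_right_cancel ENat.one_ne_top hd).symm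
    rw [isStrategy_response.stratDist_tail he]
    push_cast
    exact add_le_add_left (ih _ hd') 1

/-- Nodes inside a simple path may be cut off by `B` although the tree of the chosen routes reaches
the destination from them, so the bound is for the ends of simple paths only. In the proof, the
distance of the end of a simple path is carried back along the path without regard to `B`. -/
theorem Reaching.le_stratDist_response (hG : G.Reaching) {v : Fin G.n} (hv : G.IsEnd v) :
    G.dist B v ≤ stratDist (G.response B) v := by
  have := le_dist (B := unkept (G.response B))
    (fun v => ((G.chain v).length : ℕ∞) + G.dist B (G.chainEnd v)) ?_ ?_ v
  · simpa [hG.chain_of_isEnd hv, hG.chainEnd_of_isEnd hv, stratDist] using this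
  · simp [hG.chain_of_isEnd isEnd_da, hG.chainEnd_of_isEnd isEnd_da, dist_da]
  · intro e he
    rw [mem_unkept, not_not] at he
    by_cases hend : G.IsEnd (G.tail e)
    · have hs := he.resolve_left (not_not_intro hend)
      obtain ⟨-, hfin, -, -, hd⟩ := response_spec hs
      have hh : G.dist B (G.head e) ≠ ⊤ := by
        intro h
        simp [hd, h] at hfin
      simp only [hG.chain_of_isEnd hend, hG.chainEnd_of_isEnd hend, hd,
        ← (hG.dist_eq_chain hh).2]
      simp
    · simp only [hG.chain_tail hend, hG.chainEnd_tail hend, route, List.length_cons]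
      refine le_of_eq ?_
      push_cast
      ring

/-- Every defence is consistent with its own best response: a route that would be shorter than the
chosen one and is not blocked would give a shorter path than the shortest one. -/
theorem Reaching.consistent_response (hG : G.Reaching) (B : Finset (Fin G.m)) :
    Consistent (G.response B) B := by
  constructor
  · intro e heB he
    obtain ⟨v, r, hr, her⟩ := mem_marked.mp he
    obtain ⟨-, hfin, hrB, -, hd⟩ := response_spec hr
    have hh : G.dist B (G.head r) ≠ ⊤ := by
      intro h
      simp [hd, h] at hfin
    rw [route, List.mem_cons] at her
    rcases her with rfl | her
    · exact hrB heB
    · exact (hG.dist_eq_chain hh).1 e her heB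
  · rintro r ⟨-, -, hlt⟩
    by_contra! hcon
    refine absurd hlt (not_lt.mpr ?_)
    have hend := hG.isEnd_chainEnd (G.head r)
    have h1 : G.dist B (G.tail r) ≤ (G.route r).length +
        stratDist (G.response B) (G.chainEnd (G.head r)) := by
      refine (dist_tail_le (hcon r (mem_route_self r))).trans ?_
      refine (add_le_add_left (hG.dist_chain_le
        fun e he => hcon e (List.mem_cons_of_mem _ he)) 1).trans ?_
      rw [route, List.length_cons]
      refine (add_le_add_left (add_le_add_right (hG.le_stratDist_response hend) _) 1).trans
        (le_of_eq ?_)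
      push_cast
      ring
    by_cases htop : G.dist B (G.tail r) = ⊤
    · rw [htop, top_le_iff] at h1
      rw [h1]
      exact le_top
    · obtain ⟨k, hk⟩ := ENat.ne_top_iff_exists.mp htop
      exact (stratDist_response_le k _ hk.symm).trans (hk ▸ h1)

/-! #### The value of a defence -/

/-- `s` times the success rate of the attacker. -/
noncomputable def totalRate (G : AttackGraph) (f : ℕ∞ → ℝ) (B : Finset (Fin G.m)) : ℝ :=
  ∑ v ∈ G.entry, f (G.dist B v)

/-- What the success rates at the entry nodes lose, taken together, if `e` is blocked, provided
that `e` is the last free edge of all simple paths that it belongs to. -/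
noncomputable def gain (f : ℕ∞ → ℝ) (σ : Fin G.n → Option (Fin G.m)) (e : Fin G.m) : ℝ :=
  ∑ v ∈ G.entry with lastIn (free σ) (G.chain v) = some e, f (stratDist σ v)

/-- The edge `e` is free, and it is the last free edge on the simple path through it. -/
def Terminal (σ : Fin G.n → Option (Fin G.m)) (e : Fin G.m) : Prop :=
  lastIn (free σ) (G.route e) = some e

theorem Terminal.mem_free {e : Fin G.m} (he : Terminal σ e) : e ∈ free σ := (mem_of_lastIn he).2

theorem Reaching.terminal_of_lastIn (hG : G.Reaching) {r e : Fin G.m}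
    (h : lastIn (free σ) (G.route r) = some e) : Terminal σ e := by
  obtain ⟨h1, h2⟩ := mem_of_lastIn h
  exact lastIn_eq_of_suffix (hG.route_suffix_route h1) (mem_route_self e) h2 h

theorem Reaching.exists_mem_chain (hG : G.Reaching) (hB : ∀ e ∈ B, Terminal σ e) (v : Fin G.n) :
    (∃ e ∈ G.chain v, e ∈ B) ↔ ∃ e ∈ B, lastIn (free σ) (G.chain v) = some e := by
  constructor
  · rintro ⟨e, he, heB⟩
    exact ⟨e, heB, lastIn_of_suffix (hG.route_suffix_chain he) (hB e heB)⟩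
  · rintro ⟨e, heB, he⟩
    exact ⟨e, (mem_of_lastIn he).1, heB⟩

theorem sum_sub_sum_gain (f : ℕ∞ → ℝ) :
    ∑ v ∈ G.entry, f (stratDist σ v) - ∑ e ∈ B, gain f σ e =
      ∑ v ∈ G.entry, if ∃ e ∈ B, lastIn (free σ) (G.chain v) = some e then 0
        else f (stratDist σ v) := by
  simp only [gain, Finset.sum_filter]
  rw [Finset.sum_comm, ← Finset.sum_sub_distrib]
  refine Finset.sum_congr rfl fun v _ => ?_
  split_ifs with h
  · obtain ⟨e, heB, he⟩ := h
    rw [Finset.sum_eq_single e]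
    · simp [he]
    · intro e' _ hne
      rw [if_neg]
      rw [he]
      exact fun h => hne (Option.some.inj h).symm
    · exact fun h => absurd heB h
  · rw [Finset.sum_eq_zero, sub_zero]
    intro e heB
    rw [if_neg]
    exact fun he => h ⟨e, heB, he⟩

/-- A simple path has at most one last free edge, so no entry node is cut off by two edges of `B`,
and the gains add up. -/
theorem Consistent.totalRate_eq (hG : G.Reaching) (hσ : G.IsStrategy σ) (hB : Consistent σ B)
    (hT : ∀ e ∈ B, Terminal σ e) {f : ℕ∞ → ℝ} (hf : f ⊤ = 0) :
    G.totalRate f B = ∑ v ∈ G.entry, f (stratDist σ v) - ∑ e ∈ B, gain f σ e := by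
  classical
  rw [sum_sub_sum_gain, totalRate]
  refine Finset.sum_congr rfl fun v _ => ?_
  rw [hB.dist_eq hG hσ]
  simp only [hG.exists_mem_chain hT v]
  split_ifs
  · exact hf
  · rfl

theorem gain_nonneg {f : ℕ∞ → ℝ} (hf : Antitone f) (hf0 : f ⊤ = 0) (e : Fin G.m) :
    0 ≤ gain f σ e :=
  Finset.sum_nonneg fun _ _ => hf0 ▸ hf le_top

/-- Moving every edge of a consistent defence to the last free edge of its simple path does not
make the defence worse. -/
theorem Consistent.exists_terminal (hG : G.Reaching) (hσ : G.IsStrategy σ) (hB : Consistent σ B)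
    (hBb : B ⊆ G.blockable) {f : ℕ∞ → ℝ} (hf : Antitone f) (hf0 : f ⊤ = 0) :
    ∃ B' : Finset (Fin G.m), B'.card ≤ B.card ∧ (∀ e ∈ B', Terminal σ e) ∧
      (∀ r e, Forced σ r → lastIn (free σ) (G.route r) = some e → e ∈ B') ∧
      ∑ v ∈ G.entry, f (stratDist σ v) - ∑ e ∈ B', gain f σ e ≤ G.totalRate f B := by
  classical
  have hfree : ∀ e ∈ B, e ∈ free σ := fun e he => AttackGraph.mem_free.mpr ⟨hBb he, hB.1 e he⟩
  have hlast : ∀ e ∈ B, ∃ e', lastIn (free σ) (G.route e) = some e' := by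
    intro e he
    cases h : lastIn (free σ) (G.route e) with
    | none => exact absurd (hfree e he) (lastIn_eq_none.mp h e (mem_route_self e))
    | some e' => exact ⟨e', rfl⟩
  refine ⟨B.image fun e => (lastIn (free σ) (G.route e)).getD e, Finset.card_image_le, ?_, ?_, ?_⟩
  · intro e' he'
    obtain ⟨e, he, rfl⟩ := Finset.mem_image.mp he'
    obtain ⟨e', h⟩ := hlast e he
    rw [h]
    exact hG.terminal_of_lastIn h
  · intro r e hr h
    obtain ⟨e1, he1, he1B⟩ := hB.2 r hr
    refine Finset.mem_image.mpr ⟨e1, he1B, ?_⟩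
    rw [lastIn_eq_of_suffix (hG.route_suffix_route he1) (mem_route_self e1) (hfree e1 he1B) h]
    rfl
  · rw [sum_sub_sum_gain, totalRate]
    refine Finset.sum_le_sum fun v _ => ?_
    rw [hB.dist_eq hG hσ]
    by_cases hc : ∃ e ∈ G.chain v, e ∈ B
    · obtain ⟨e, he, heB⟩ := hc
      obtain ⟨e', h⟩ := hlast e heB
      rw [if_pos ⟨e', Finset.mem_image.mpr ⟨e, heB, by rw [h]; rfl⟩,
        lastIn_of_suffix (hG.route_suffix_chain he) h⟩]
      exact hf0 ▸ hf le_top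
    · rw [if_neg hc]
      split_ifs
      · exact hf0 ▸ hf le_top
      · exact le_rfl

theorem IsStrategy.stratDist_tail_ne_top (hG : G.Reaching) (hσ : G.IsStrategy σ) {v : Fin G.n}
    {e : Fin G.m} (he : e ∈ G.chain v) (hv : stratDist σ v ≠ ⊤) :
    stratDist σ (G.tail e) ≠ ⊤ := by
  induction v using hG.chain_induction with
  | hend v hend => simp [hG.chain_of_isEnd hend] at he
  | hstep e' he' ih =>
    rw [hG.chain_tail he', route, List.mem_cons] at he
    rcases he with rfl | he
    · exact hv
    · refine ih he fun h => hv ?_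
      rw [hσ.stratDist_tail (.inl he'), h]
      rfl

/-- The frontier edges: the edges that are worth blocking in addition to `B`. -/
def Frontier (σ : Fin G.n → Option (Fin G.m)) (B : Finset (Fin G.m)) (e : Fin G.m) : Prop :=
  ¬ G.IsEnd (G.tail e) ∧ Terminal σ e ∧ e ∉ B ∧ stratDist σ (G.tail e) ≠ ⊤

/-- Only frontier edges have to be considered. Any other edge that is not blocked is the first edge
of a route, which lies on `chain v` for no `v`, or is not the last free edge of its simple path, or
lies where the chosen routes do not lead to the destination anyway. -/
theorem gain_eq_zero (hG : G.Reaching) (hσ : G.IsStrategy σ) {f : ℕ∞ → ℝ} (hf0 : f ⊤ = 0)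
    {e : Fin G.m} (heB : e ∉ B) (he : ¬ Frontier σ B e) : gain f σ e = 0 := by
  refine Finset.sum_eq_zero fun v hv => ?_
  obtain ⟨-, hv⟩ := Finset.mem_filter.mp hv
  obtain ⟨h1, h2⟩ := mem_of_lastIn hv
  by_contra hne
  refine he ⟨hG.not_isEnd_tail h1, ?_, heB, hσ.stratDist_tail_ne_top hG h1 ?_⟩
  · exact lastIn_eq_of_suffix (hG.route_suffix_chain h1) (mem_route_self e) h2 hv
  · intro h
    rw [h] at hne
    exact hne hf0

end AttackGraph

/-! ### Representation of the graph in the memory -/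

namespace SplitFPT

/-- The number by which an optional value is stored. -/
def enc {k : ℕ} : Option (Fin k) → ℕ
  | none => 0
  | some e => e + 1

@[simp] theorem enc_none {k : ℕ} : enc (none : Option (Fin k)) = 0 := rfl

@[simp] theorem enc_some {k : ℕ} (e : Fin k) : enc (some e) = e + 1 := rfl

theorem enc_eq_zero {k : ℕ} {o : Option (Fin k)} : enc o = 0 ↔ o = none := by
  cases o <;> simp

theorem enc_injective {k : ℕ} : Function.Injective (enc (k := k)) := by
  intro a b h
  cases a <;> cases b <;> simp at h ⊢
  exact Fin.ext h

/-- `Linked next p l`: the linked list that starts with the stored value `p`, and whose links are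
given by `next`, is `l`. -/
def Linked {k : ℕ} (next : ℕ → ℕ) : ℕ → List (Fin k) → Prop
  | p, [] => p = 0
  | p, e :: l => p = e + 1 ∧ Linked next (next e) l

theorem Linked.congr {k : ℕ} {next next' : ℕ → ℕ} {p : ℕ} {l : List (Fin k)}
    (h : Linked next p l) (hn : ∀ e ∈ l, next' e = next e) : Linked next' p l := by
  induction l generalizing p with
  | nil => exact h
  | cons e l ih =>
    refine ⟨h.1, ?_⟩
    rw [hn e (by simp)]
    exact ih h.2 fun e he => hn e (by simp [he])

theorem Linked.eq_enc_head {k : ℕ} {next : ℕ → ℕ} {p : ℕ} {l : List (Fin k)}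
    (h : Linked next p l) : p = enc l.head? := by
  cases l with
  | nil => exact h
  | cons e l => exact h.1

open AttackGraph

/-- `S` lists the splitting nodes, and `L v` the out-going edges of `v`. -/
structure IsListing (G : AttackGraph) (S : List (Fin G.n)) (L : Fin G.n → List (Fin G.m)) :
    Prop where
  nodup_S : S.Nodup
  mem_S : ∀ v, v ∈ S ↔ v ∈ G.splitting
  nodup_L : ∀ v, (L v).Nodup
  mem_L : ∀ v e, e ∈ L v ↔ G.tail e = v

/-- The memory holds the graph, the budget and `f`, and what `prepare` computes. -/
structure Ready (G : AttackGraph) (f : ℕ∞ → ℝ) (b : ℕ) (S : List (Fin G.n))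
    (L : Fin G.n → List (Fin G.m)) (M : Mem) : Prop where
  n : M.var .n = G.n
  m : M.var .m = G.m
  b : M.var .b = b
  da : M.var .da = G.da
  t : M.var .t = S.length
  head : ∀ e : Fin G.m, M.arr .head e = G.head e
  blk : ∀ e : Fin G.m, M.arr .blk e = 1 ↔ e ∈ G.blockable
  entry : ∀ v : Fin G.n, M.arr .entry v = 1 ↔ v ∈ G.entry
  first : ∀ v : Fin G.n, Linked (M.arr .next) (M.arr .first v) (L v)
  isEnd : ∀ v : Fin G.n, M.arr .isEnd v = 0 ↔ ¬ G.IsEnd v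
  sp : ∀ (i : ℕ) (h : i < S.length), M.arr .sp i = S[i]
  f : ∀ i < G.n, M.rarr .f i = f i
  s : M.rvar .s = G.entry.card

/-- The program changes nothing of what `Ready` speaks about. -/
def keepsReady (c : Cmd) : Bool :=
  [Var.n, .m, .b, .da, .t].all (fun x => !c.SetsVar x) &&
    [Arr.head, .blk, .entry, .first, .next, .isEnd, .sp].all (fun a => !c.SetsArr a) &&
      !c.SetsRArr .f && !c.SetsRVar .s

variable {G : AttackGraph} {f : ℕ∞ → ℝ} {b : ℕ} {S : List (Fin G.n)}
  {L : Fin G.n → List (Fin G.m)} {M M' : Mem}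

theorem Ready.of_same {c : Cmd} (h : Ready G f b S L M) (hs : Same c M M')
    (hc : keepsReady c = true) : Ready G f b S L M' := by
  simp only [keepsReady, Bool.and_eq_true, List.all_cons, List.all_nil, Bool.not_eq_true',
    and_true] at hc
  obtain ⟨⟨⟨⟨h1, h2, h3, h4, h5⟩, h6, h7, h8, h9, h10, h11, h12⟩, h13⟩, h14⟩ := hc
  constructor
  · rw [hs.var _ h1, h.n]
  · rw [hs.var _ h2, h.m]
  · rw [hs.var _ h3, h.b]
  · rw [hs.var _ h4, h.da]
  · rw [hs.var _ h5, h.t]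
  · rw [hs.arr _ h6]; exact h.head
  · rw [hs.arr _ h7]; exact h.blk
  · rw [hs.arr _ h8]; exact h.entry
  · rw [hs.arr _ h9, hs.arr _ h10]; exact h.first
  · rw [hs.arr _ h11]; exact h.isEnd
  · rw [hs.arr _ h12]; exact h.sp
  · rw [hs.rarr _ h13]; exact h.f
  · rw [hs.rvar _ h14, h.s]

theorem IsListing.length_S_le (hG : G.Reaching) (hL : IsListing G S L) :
    S.length ≤ G.feedback := by
  have : S.toFinset = G.splitting := by ext v; simp [hL.mem_S]
  rw [← List.toFinset_card_of_nodup hL.nodup_S, this]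
  exact hG.card_splitting_le

theorem IsListing.length_L (hL : IsListing G S L) (v : Fin G.n) :
    (L v).length = G.outDegree v := by
  rw [← List.toFinset_card_of_nodup (hL.nodup_L v), outDegree]
  congr 1
  ext e
  simp [hL.mem_L]

theorem IsListing.prod_S (hL : IsListing G S L) (g : Fin G.n → ℕ) :
    (S.map g).prod = ∏ v ∈ G.splitting, g v := by
  have : S.toFinset = G.splitting := by ext v; simp [hL.mem_S]
  rw [← this, List.prod_toFinset _ hL.nodup_S]

theorem IsListing.sum_S (hL : IsListing G S L) (g : Fin G.n → ℕ) :
    (S.map g).sum = ∑ v ∈ G.splitting, g v := by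
  have : S.toFinset = G.splitting := by ext v; simp [hL.mem_S]
  rw [← this, List.sum_toFinset _ hL.nodup_S]

/-- A node at which no simple path ends has a single out-going edge. -/
theorem Ready.first_of_not_isEnd (h : Ready G f b S L M) (hL : IsListing G S L) {e : Fin G.m}
    (he : ¬ G.IsEnd (G.tail e)) : M.arr .first (G.tail e) = e + 1 := by
  have h1 := (h.first (G.tail e)).eq_enc_head
  rw [h1]
  cases hl : L (G.tail e) with
  | nil =>
    have := (hL.mem_L (G.tail e) e).mpr rfl
    simp [hl] at this
  | cons e' l =>
    have := (hL.mem_L (G.tail e) e').mp (by simp [hl])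
    rw [edge_unique he this rfl]
    simp

/-! ### Preparation -/

/-- The invariant of the first loop of `prepare`, after `i` edges. -/
def PrepEdges (G : AttackGraph) (L : Fin G.n → List (Fin G.m)) (i : ℕ) (M : Mem) : Prop :=
  ∀ v : Fin G.n, Linked (M.arr .next) (M.arr .first v) (L v) ∧ (L v).Nodup ∧
    (∀ e, e ∈ L v ↔ G.tail e = v ∧ e.val < i) ∧ M.arr .deg v = (L v).length

/-- The invariant of the second loop of `prepare`, after `i` nodes. -/
structure PrepNodes (G : AttackGraph) (S : List (Fin G.n)) (i : ℕ) (M : Mem) : Prop where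
  t : M.var .t = S.length
  nodup : S.Nodup
  mem : ∀ v, v ∈ S ↔ v ∈ G.splitting ∧ v.val < i
  sp : ∀ (j : ℕ) (h : j < S.length), M.arr .sp j = S[j]
  cur : ∀ j < S.length, M.arr .cur j = 0
  isEnd : ∀ v : Fin G.n, M.arr .isEnd v = if G.IsEnd v ∧ v.val < i then 1 else 0
  s : M.rvar .s = (G.entry.filter fun v => v.val < i).card

theorem prepare_spec (G : AttackGraph) (f : ℕ∞ → ℝ) (b : ℕ) :
    Runs prepare (input G f b) fun M k => k ≤ 100 * (G.m + G.n + 1) ∧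
      ∃ S L, IsListing G S L ∧ Ready G f b S L M ∧ ∀ i < S.length, M.arr .cur i = 0 := by
  unfold prepare
  rw [block_cons_cons, runs_seq]
  refine (Runs.forTo_const (fun i M => ∃ L, PrepEdges G L i M) 50 rfl rfl ?_ ?_).mono ?_
  · exact ⟨fun _ => [], fun v => by simp [Linked, input]⟩
  · rintro i M' hi hx hs ⟨L, hL⟩
    have ht : M'.arr .tail i = G.tail ⟨i, hi⟩ := by
      rw [hs.arr _ rfl]
      simp only [input]
      exact dif_pos (show i < G.m from hi)
    set e : Fin G.m := ⟨i, hi⟩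
    simp [hx, ht]
    refine ⟨Function.update L (G.tail e) (e :: L (G.tail e)), fun v => ?_⟩
    obtain ⟨h1, h2, h3, h4⟩ := hL v
    have hnot : ∀ v, e ∉ L v := fun v h => by simpa [e] using (((hL v).2.2.1 e).mp h).2
    have hcong : ∀ e' : Fin G.m, e' ≠ e →
        Function.update (M'.arr .next) i (M'.arr .first (G.tail e)) e' = M'.arr .next e' := by
      intro e' he'
      rw [Function.update_of_ne]
      exact fun h => he' (Fin.ext h)
    by_cases hv : v = G.tail e
    · subst hv
      simp only [Function.update_self, Mem.arr_setVar, Mem.arr_setArr]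
      simp only [reduceCtorEq, if_true, if_false, Function.update_self, List.nodup_cons,
        List.mem_cons, List.length_cons, h4, and_true]
      refine ⟨⟨rfl, ?_⟩, ⟨hnot _, h2⟩, fun e' => ?_⟩
      · rw [show (e : ℕ) = i from rfl, Function.update_self]
        exact h1.congr fun e' he' => hcong e' fun h => hnot _ (h ▸ he')
      · rw [h3]
        constructor
        · rintro (rfl | h)
          · simp [e]
          · exact ⟨h.1, by omega⟩
        · rintro ⟨h, h'⟩
          by_cases he' : e' = e
          · exact Or.inl he'
          · have : (e' : ℕ) ≠ i := fun h => he' (Fin.ext h)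
            exact Or.inr ⟨h, by omega⟩
    · have hv' : (v : ℕ) ≠ (G.tail e : ℕ) := fun h => hv (Fin.ext h)
      simp only [Function.update_of_ne hv, Mem.arr_setVar, Mem.arr_setArr]
      simp only [reduceCtorEq, if_true, if_false, Function.update_of_ne hv']
      refine ⟨h1.congr fun e' he' => hcong e' fun h => hnot _ (h ▸ he'), h2, fun e' => ?_, h4⟩
      rw [h3]
      refine and_congr_right fun h => ?_
      have : (e' : ℕ) ≠ i := by
        rintro h'
        exact hv (by rw [← h, show e' = e from Fin.ext h'])
      omega
  rintro M1 k1 hs1 ⟨⟨L, hL⟩, hk1⟩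
  have hL1 : ∀ v e, e ∈ L v ↔ G.tail e = v := fun v e => by
    rw [(hL v).2.2.1]
    exact and_iff_left e.isLt
  have hdeg : ∀ v : Fin G.n, M1.arr .deg v = G.outDegree v := by
    intro v
    rw [(hL v).2.2.2, ← List.toFinset_card_of_nodup (hL v).2.1, outDegree]
    congr 1
    ext e
    simp [hL1]
  simp only [block_cons_cons, block_singleton, runs_seq, runs_set, runs_rset]
  refine (Runs.forTo_const (fun i M => ∃ S, PrepNodes G S i M) 50 rfl rfl ?_ ?_).mono ?_
  · refine ⟨[], ?_⟩
    have h : M1.arr .isEnd = fun _ => 0 := hs1.arr _ rfl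
    constructor <;> simp [h]
  · rintro i M' hi hx hs ⟨S, hS⟩
    have hn : i < G.n := by
      have h : M1.var .n = G.n := hs1.var _ rfl
      simpa [h] using hi
    have hda : M'.var .da = G.da := by
      rw [hs.var _ rfl]
      exact hs1.var _ rfl
    set v : Fin G.n := ⟨i, hn⟩ with hv
    have hvi : (v : ℕ) = i := rfl
    have hd : M'.arr .deg i = G.outDegree v := by
      rw [hs.arr _ rfl]
      exact hdeg v
    have hen : M'.arr .entry i = 1 ↔ v ∈ G.entry := by
      rw [hs.arr _ rfl]
      have h : M1.arr .entry = (input G f b).arr .entry := hs1.arr _ rfl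
      simp only [Mem.arr_setRVar, Mem.arr_setVar, h, input]
      simp [hn, v]
    have hlt : ∀ w : Fin G.n, w.val < i + 1 ↔ w = v ∨ w.val < i := by
      intro w
      rw [Fin.ext_iff, hvi]
      omega
    have hs' : ((G.entry.filter fun w => w.val < i + 1).card : ℝ) =
        (G.entry.filter fun w => w.val < i).card + if v ∈ G.entry then 1 else 0 := by
      have h1 : (G.entry.filter fun w => w.val < i + 1) = (G.entry.filter fun w => w = v) ∪
          G.entry.filter fun w => w.val < i := by
        simp only [hlt, Finset.filter_or]
      rw [h1, Finset.card_union_of_disjoint]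
      · rw [Finset.filter_eq']
        split_ifs <;> simp [add_comm]
      · rw [Finset.disjoint_filter]
        rintro w - rfl
        simp [hvi]
    have hnm : v ∉ S := fun h => by simpa [hvi] using ((hS.mem v).mp h).2
    obtain ⟨g1, g2, g3, g4, g5, g6, g7⟩ := hS
    have upd : ∀ w : Fin G.n, Function.update (M'.arr .isEnd) i 1 w =
        if (w : ℕ) = i then 1 else M'.arr .isEnd w := fun w => Function.update_apply ..
    by_cases c1 : v = G.da
    · have hsp : v ∉ G.splitting := by simp [mem_splitting, c1]
      have e1 : i = G.da := by rw [← hvi, c1]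
      simp [hx, hda, ← e1, hen]
      have aux : ∀ M2 : Mem, M2.var = M'.var → M2.arr = (M'.setArr .isEnd i 1).arr →
          M2.rvar .s = M'.rvar .s + (if v ∈ G.entry then 1 else 0) →
          PrepNodes G S (i + 1) (M2.setVar .v (i + 1)) := by
        intro M2 h1 h2 h3
        constructor
        · simp [h1, g1]
        · exact g2
        · intro w
          rw [g3, hlt]
          constructor
          · rintro ⟨h, h'⟩; exact ⟨h, Or.inr h'⟩
          · rintro ⟨h, rfl | h'⟩
            · exact absurd h hsp
            · exact ⟨h, h'⟩
        · simpa [h2] using g4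
        · simpa [h2] using g5
        · intro w
          simp only [Mem.arr_setVar, h2, Mem.arr_setArr, if_true, upd, g6, hlt]
          by_cases hw : w = v
          · subst hw
            simp [c1, isEnd_da, e1]
          · have : (w : ℕ) ≠ i := fun h => hw (Fin.ext h)
            simp [this, hw]
        · simp only [Mem.rvar_setVar, h3, hs', g7]
      exact ⟨fun h => ⟨S, aux _ rfl rfl (by simp [h])⟩, fun h => ⟨S, aux _ rfl rfl (by simp [h])⟩⟩
    · have e1 : i ≠ G.da := fun h => c1 (Fin.ext h)
      by_cases c2 : 2 ≤ G.outDegree v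
      · have hend : G.IsEnd v := Or.inr c2
        have hsp : v ∈ G.splitting := mem_splitting.mpr ⟨c1, hend⟩
        simp [hx, hda, e1, hd, c2, hen]
        have aux : ∀ M2 : Mem, M2.var .t = M'.var .t + 1 →
            M2.arr = (((M'.setArr .isEnd i 1).setArr .sp (M'.var .t) i).setArr .cur
              (M'.var .t) 0).arr →
            M2.rvar .s = M'.rvar .s + (if v ∈ G.entry then 1 else 0) →
            PrepNodes G (S ++ [v]) (i + 1) (M2.setVar .v (i + 1)) := by
          intro M2 h1 h2 h3
          constructor
          · simp [h1, g1]
          · simp [List.nodup_append, g2]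
            rintro w hw rfl
            exact hnm hw
          · intro w
            rw [List.mem_append, g3, hlt, List.mem_singleton]
            constructor
            · rintro (⟨h, h'⟩ | rfl)
              · exact ⟨h, Or.inr h'⟩
              · exact ⟨hsp, Or.inl rfl⟩
            · rintro ⟨h, rfl | h'⟩
              · exact Or.inr rfl
              · exact Or.inl ⟨h, h'⟩
          · intro j hj
            simp only [List.length_append, List.length_singleton] at hj
            simp only [Mem.arr_setVar, h2, Mem.arr_setArr, reduceCtorEq, if_true, if_false, g1,
              Function.update_apply]
            split_ifs with hjS
            · subst hjS
              simp [hvi]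
            · rw [List.getElem_append_left (by omega), g4 j (by omega)]
          · intro j hj
            simp only [List.length_append, List.length_singleton] at hj
            simp only [Mem.arr_setVar, h2, Mem.arr_setArr, reduceCtorEq, if_true, if_false, g1,
              Function.update_apply]
            split_ifs with hjS
            · rfl
            · exact g5 j (by omega)
          · intro w
            simp only [Mem.arr_setVar, h2, Mem.arr_setArr, reduceCtorEq, if_true, if_false, upd,
              g6, hlt]
            by_cases hw : w = v
            · subst hw
              simp [hvi, hend]
            · have : (w : ℕ) ≠ i := fun h => hw (Fin.ext h)
              simp [this, hw]
          · simp only [Mem.rvar_setVar, h3, hs', g7]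
        refine ⟨fun h => ⟨S ++ [v], aux _ ?_ ?_ ?_⟩, fun h => ⟨S ++ [v], aux _ ?_ ?_ ?_⟩⟩ <;>
          simp [h, Mem.setArr]
      · have hend : ¬ G.IsEnd v := fun h => h.elim c1 c2
        have hsp : v ∉ G.splitting := fun h => hend (mem_splitting.mp h).2
        simp [hx, hda, e1, hd, c2, hen]
        have aux : ∀ M2 : Mem, M2.var = M'.var → M2.arr = M'.arr →
            M2.rvar .s = M'.rvar .s + (if v ∈ G.entry then 1 else 0) →
            PrepNodes G S (i + 1) (M2.setVar .v (i + 1)) := by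
          intro M2 h1 h2 h3
          constructor
          · simp [h1, g1]
          · exact g2
          · intro w
            rw [g3, hlt]
            constructor
            · rintro ⟨h, h'⟩; exact ⟨h, Or.inr h'⟩
            · rintro ⟨h, rfl | h'⟩
              · exact absurd h hsp
              · exact ⟨h, h'⟩
          · simpa [h2] using g4
          · simpa [h2] using g5
          · intro w
            simp only [Mem.arr_setVar, h2, g6, hlt]
            by_cases hw : w = v
            · subst hw
              simp [hend]
            · simp [hw]
          · simp only [Mem.rvar_setVar, h3, hs', g7]
        exact ⟨fun h => ⟨S, aux _ rfl rfl (by simp [h])⟩, fun h => ⟨S, aux _ rfl rfl (by simp [h])⟩⟩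
  rintro M2 k2 hs2 ⟨⟨S, hS⟩, hk2⟩
  have e1 : M1.var .n = G.n := hs1.var _ rfl
  have e2 : (input G f b).var .m = G.m := rfl
  simp only [Mem.var_setRVar, Mem.var_setVar, reduceCtorEq, if_false, e1] at hk2 hS
  have hlt : ∀ v : Fin G.n, v.val < G.n ↔ True := fun v => iff_true_intro v.isLt
  refine ⟨?_, S, L, ⟨hS.nodup, ?_, fun v => (hL v).2.1, hL1⟩, ?_, hS.cur⟩
  · rw [e2] at hk1
    simp
    omega
  · intro v
    rw [hS.mem, hlt, and_true]
  · have arr : ∀ a, (Cmd.SetsArr a prepare = false) → M2.arr a = (input G f b).arr a := by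
      intro a ha
      simp only [prepare, Cmd.block, Cmd.SetsArr, Bool.or_eq_false_iff] at ha
      rw [hs2.arr _ ha.2.2.2]
      exact hs1.arr _ ha.1
    constructor
    · exact (hs2.var _ rfl).trans (hs1.var _ rfl)
    · exact (hs2.var _ rfl).trans (hs1.var _ rfl)
    · exact (hs2.var _ rfl).trans (hs1.var _ rfl)
    · exact (hs2.var _ rfl).trans (hs1.var _ rfl)
    · exact hS.t
    · intro e
      rw [arr _ rfl]
      simp [input]
    · intro e
      rw [arr _ rfl]
      simp [input]
    · intro v
      rw [arr _ rfl]
      simp [input]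
    · intro v
      have h1 : M2.arr .next = M1.arr .next := hs2.arr _ rfl
      have h2 : M2.arr .first = M1.arr .first := hs2.arr _ rfl
      rw [h1, h2]
      exact (hL v).1
    · intro v
      simp [hS.isEnd]
    · exact hS.sp
    · intro i hi
      rw [hs2.rarr _ rfl]
      have h1 : M1.rarr .f = (input G f b).rarr .f := hs1.rarr _ rfl
      simp [h1, input, hi]
    · simpa using hS.s

end SplitFPT

/-! ### Distances that result from a strategy -/

namespace SplitFPT

open AttackGraph

variable {G : AttackGraph} {f : ℕ∞ → ℝ} {b : ℕ} {S : List (Fin G.n)}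
  {L : Fin G.n → List (Fin G.m)} {M : Mem} {σ : Fin G.n → Option (Fin G.m)}

/-- The memory holds the strategy `σ`. -/
def HoldsStrategy (S : List (Fin G.n)) (σ : Fin G.n → Option (Fin G.m)) (M : Mem) : Prop :=
  ∀ (i : ℕ) (h : i < S.length), M.arr .cur i = enc (σ S[i])

theorem reset_spec (hR : Ready G f b S L M) :
    Runs reset M fun M' k => k ≤ 100 * (G.m + G.n + 1) ∧
      (∀ e : Fin G.m, M'.arr .mark e = 0 ∧ M'.arr .blocked e = 0) ∧
      ∀ v : Fin G.n, M'.arr .dist v = 0 := by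
  simp only [reset, block_cons_cons, block_singleton, runs_seq]
  refine (Runs.forTo_const (fun i M' => ∀ j < i, M'.arr .mark j = 0 ∧ M'.arr .blocked j = 0)
    20 rfl rfl (by simp) ?_).mono ?_
  · intro i M' hi hx hs hI
    simp [hx, Function.update_apply]
    grind
  rintro M1 k1 hs1 ⟨h1, hk1⟩
  refine (Runs.forTo_const (fun i M' => ∀ j < i, M'.arr .dist j = 0) 20 rfl rfl (by simp) ?_).mono
    ?_
  · intro i M' hi hx hs hI
    simp [hx, Function.update_apply]
    grind
  rintro M2 k2 hs2 ⟨h2, hk2⟩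
  have e1 : M1.var .n = G.n := (hs1.var _ rfl).trans hR.n
  rw [e1] at hk2 h2
  rw [hR.m] at hk1 h1
  refine ⟨by omega, fun e => ?_, fun v => h2 v v.isLt⟩
  rw [hs2.arr _ rfl, hs2.arr _ rfl]
  exact h1 e e.isLt

/-- The loop that follows a simple path, counts its edges in `len`, and runs `c` for each edge. -/
def walk (c : Cmd) : Cmd :=
  .while (.eq Arr.isEnd⟦Var.v⟧ 0) (.block [
    .set .e (Arr.first⟦Var.v⟧ - 1),
    c,
    .set .v Arr.head⟦Var.e⟧,
    .set .len (Var.len + 1)])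

/-- `P p` is the invariant after the edges in the list `p`. -/
theorem walk_spec (hG : G.Reaching) (hL : IsListing G S L) {c : Cmd} (hc : keepsReady c = true)
    (hce : c.SetsVar .e = false) (hcl : c.SetsVar .len = false)
    (P : List (Fin G.m) → Mem → Prop) (K : ℕ)
    (hP : ∀ p M x k, (x = .e ∨ x = .v ∨ x = .len) → P p M → P p (M.setVar x k))
    (step : ∀ p (e : Fin G.m) M, Ready G f b S L M → M.var .e = e → P p M →
      Runs c M fun M' k => k ≤ K ∧ P (p ++ [e]) M')
    (v : Fin G.n) (p : List (Fin G.m)) (ℓ : ℕ) (M : Mem) (hR : Ready G f b S L M) (h0 : P p M)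
    (hv : M.var .v = v) (hl : M.var .len = ℓ) :
    Runs (walk c) M fun M' k => P (p ++ G.chain v) M' ∧ M'.var .v = G.chainEnd v ∧
      M'.var .len = ℓ + (G.chain v).length ∧ k ≤ (G.chain v).length * (K + 40) + 10 := by
  induction v using hG.chain_induction generalizing p ℓ M with
  | hend v hend =>
    refine Runs.while_false ?_ ?_
    · simp [hv, hR.isEnd, hend]
    · simp [hG.chain_of_isEnd hend, hG.chainEnd_of_isEnd hend, h0, hv, hl]
  | hstep e he ih =>
    refine Runs.while_true ?_ ?_
    · simp [hv, hR.isEnd, he]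
    · simp only [block_cons_cons, block_singleton, runs_seq, runs_set, NExp.eval_sub,
        NExp.eval_get, NExp.eval_var, NExp.eval_ofNat, hv, hR.first_of_not_isEnd hL he,
        Nat.add_sub_cancel]
      have hR1 : Ready G f b S L (M.setVar .e e) :=
        hR.of_same (c := .set .e (.lit e)) (Exec.set M .e (.lit e)).same rfl
      refine (step p e _ hR1 (by simp) (hP _ _ _ _ (by simp) h0)).mono ?_
      rintro M2 k2 hs2 ⟨hk2, hP2⟩
      have hR2 := hR1.of_same hs2 hc
      have he2 : M2.var .e = e := by rw [hs2.var _ hce]; simp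
      have hl2 : M2.var .len = ℓ := by rw [hs2.var _ hcl]; simp [hl]
      simp only [he2, hR2.head, NExp.eval_add, NExp.eval_var, NExp.eval_ofNat, Mem.var_setVar, hl2,
        reduceCtorEq, if_false]
      have hR3 : Ready G f b S L ((M2.setVar .v (G.head e)).setVar .len (ℓ + 1)) :=
        (hR2.of_same (c := .set .v (.lit (G.head e))) (Exec.set M2 .v _).same rfl).of_same
          (c := .set .len (.lit (ℓ + 1))) (Exec.set _ .len _).same rfl
      refine (ih (p ++ [e]) (ℓ + 1) _ hR3 ?_ (by simp) (by simp)).mono ?_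
      · exact hP _ _ _ _ (by simp) (hP _ _ _ _ (by simp) hP2)
      · rintro M4 k4 - ⟨h1, h2, h3, h4⟩
        rw [hG.chain_tail he, hG.chainEnd_tail he, route]
        refine ⟨by simpa using h1, h2, ?_, ?_⟩
        · rw [h3, List.length_cons]; omega
        · simp only [List.length_cons, NExp.cost_sub, NExp.cost_get, NExp.cost_var,
            NExp.cost_ofNat, NExp.cost_add, Test.cost_eq]
          rw [add_mul]
          omega

theorem markTaken_spec (hG : G.Reaching) (hσ : G.IsStrategy σ) (hL : IsListing G S L)
    (hR : Ready G f b S L M) (hC : HoldsStrategy S σ M)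
    (h0 : ∀ e : Fin G.m, M.arr .mark e = 0) :
    Runs markTaken M fun M' k => k ≤ S.length * (100 * (G.maxPathLength + 1)) + 6 ∧
      (∀ e : Fin G.m, M'.arr .mark e = 0 ↔ e ∉ marked σ) ∧
      ∀ (i : ℕ) (h : i < S.length) (r : Fin G.m), σ S[i] = some r →
        M'.arr .rend i = G.chainEnd (G.head r) ∧ M'.arr .rlen i = (G.route r).length := by
  unfold markTaken
  refine (Runs.forTo_const (fun k M' => (∀ e : Fin G.m, M'.arr .mark e = 0 ↔
      ∀ i < k, ∀ (h : i < S.length) (r : Fin G.m), σ S[i] = some r → e ∉ G.route r) ∧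
      ∀ (i : ℕ) (h : i < S.length) (r : Fin G.m), i < k → σ S[i] = some r →
        M'.arr .rend i = G.chainEnd (G.head r) ∧ M'.arr .rlen i = (G.route r).length)
    (100 * (G.maxPathLength + 1) - 8) rfl rfl ?_ ?_).mono ?_
  · simp [h0]
  · rintro k M' hk hx hs ⟨hm, hr⟩
    have hR' := hR.of_same hs rfl
    have hkS : k < S.length := hR.t ▸ hk
    have hcur : M'.arr .cur k = enc (σ S[k]) := by rw [hs.arr _ rfl]; exact hC k hkS
    cases hk' : σ S[k] with
    | none =>
      simp [hx, hcur, hk']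
      refine ⟨by omega, fun e => ?_, fun i hi r hik => ?_⟩
      · rw [hm]
        refine ⟨fun h i hik hi r h' => h i (lt_of_le_of_ne hik ?_) hi r h',
          fun h i hik hi r h' => h i hik.le hi r h'⟩
        rintro rfl
        exact absurd (hk'.symm.trans h') (by simp)
      · intro h
        refine hr i hi r (lt_of_le_of_ne (by omega) ?_) h
        rintro rfl
        exact absurd (hk'.symm.trans h) (by simp)
    | some r =>
      have key := fun M1 h1 h2 h3 h4 => walk_spec hG hL (c := .put .mark Var.e 1) rfl rfl rfl
        (fun p M'' => ∀ e : Fin G.m, M''.arr .mark e = 0 ↔ M'.arr .mark e = 0 ∧ e ∉ p) 10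
        (by simp) (f := f) (b := b) ?_ (G.head r) [r] 1 M1 h1 h2 h3 h4
      rotate_left
      · intro p e M2 h1 h2 h3
        refine (runs_put).mpr ⟨by simp, fun e' => ?_⟩
        simp [h2, Function.update_apply]
        by_cases hee : e' = e
        · simp [hee]
        · simp [hee, h3, Fin.val_inj]
      simp only [runs_when, Test.holds_ne, NExp.eval_get, NExp.eval_var, hx, hcur, hk', enc_some,
        NExp.eval_ofNat, ne_eq, Nat.add_eq_zero_iff, one_ne_zero, and_false, not_false_eq_true,
        true_imp_iff, not_true, false_imp_iff, and_true, block_cons_cons, block_singleton,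
        runs_seq, runs_set, runs_put, NExp.eval_sub, Nat.add_sub_cancel, Mem.var_setVar, if_true,
        Mem.var_setArr, Mem.arr_setVar, Mem.arr_setArr, reduceCtorEq, if_false, hR'.head]
      refine (key _ ?_ ?_ (by simp) (by simp)).mono ?_
      · exact hR'.of_same (Exec.seq (Exec.set M' .e (.lit r)) (Exec.seq (Exec.put _ .mark (.lit r)
          (.lit 1)) (Exec.seq (Exec.set _ .v (.lit (G.head r))) (Exec.set _ .len (.lit 1))))).same
            rfl
      · intro e
        simp [Function.update_apply, Fin.val_inj]
        by_cases her : e = r <;> simp [her]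
      · rintro M4 k4 hs4 ⟨g1, g2, g3, g4⟩
        have hx4 : M4.var .k = k := by rw [hs4.var _ rfl]; simp [hx]
        have hrend : M4.arr .rend = M'.arr .rend := by rw [hs4.arr _ rfl]; simp
        have hrlen : M4.arr .rlen = M'.arr .rlen := by rw [hs4.arr _ rfl]; simp
        have hlen := hG.length_chain_le (G.head r)
        simp [hx4, g2, g3, hrend, hrlen]
        refine ⟨?_, fun e => ?_, fun i hi r' hik h => ?_⟩
        · have : (G.chain (G.head r)).length * 50 ≤ 50 * G.maxPathLength := by omega
          omega
        · have h5 := g1 e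
          rw [hm] at h5
          rw [h5]
          have : [r] ++ G.chain (G.head r) = G.route r := rfl
          rw [this]
          constructor
          · rintro ⟨h6, h7⟩ i hik hi r' h
            by_cases hne : i = k
            · subst hne
              rw [hk'] at h
              obtain rfl := Option.some.inj h
              exact h7
            · exact h6 i (by omega) hi r' h
          · intro h
            exact ⟨fun i hik hi r' h6 => h i hik.le hi r' h6, h k le_rfl hkS r hk'⟩
        · simp only [Function.update_apply]
          by_cases hne : i = k
          · subst hne
            rw [hk'] at h
            obtain rfl := Option.some.inj h
            simp [route]
            omega
          · simpa [hne] using hr i hi r' (by omega) h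
  · rintro M1 k1 hs1 ⟨⟨h1, h2⟩, hk1⟩
    rw [hR.t] at h1 h2 hk1
    refine ⟨?_, fun e => ?_, fun i hi r hr => h2 i hi r hi hr⟩
    · have : 100 * (G.maxPathLength + 1) - 8 + 8 = 100 * (G.maxPathLength + 1) := by omega
      rwa [this] at hk1
    · rw [h1, mem_marked]
      constructor
      · rintro h ⟨v, r, hv, h'⟩
        obtain ⟨i, hi, rfl⟩ := List.getElem_of_mem ((hL.mem_S v).mpr (hσ v r hv).1)
        exact h i hi hi r hv h'
      · exact fun h i _ hi r hr h' => h ⟨S[i], r, hr, h'⟩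

/-- The number by which a distance is stored. -/
noncomputable def encDist (d : ℕ∞) : ℕ := if d = ⊤ then 0 else d.toNat + 1

theorem encDist_eq_zero {d : ℕ∞} : encDist d = 0 ↔ d = ⊤ := by
  unfold encDist
  split_ifs with h <;> simp [h]

@[simp] theorem encDist_top : encDist ⊤ = 0 := by simp [encDist]

@[simp] theorem encDist_coe (k : ℕ) : encDist k = k + 1 := by simp [encDist]

open Classical in
/-- The number of splitting nodes that are closer to the destination than `v`. -/
noncomputable def rank (σ : Fin G.n → Option (Fin G.m)) (v : Fin G.n) : ℕ :=
  (G.splitting.filter fun w => stratDist σ w < stratDist σ v).card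

theorem rank_lt {v w : Fin G.n} (hw : w ∈ G.splitting) (h : stratDist σ w < stratDist σ v) :
    rank σ w < rank σ v := by
  refine Finset.card_lt_card (Finset.ssubset_iff_of_subset ?_ |>.mpr ⟨w, ?_, ?_⟩)
  · exact fun x hx => by
      simp only [Finset.mem_filter] at hx ⊢
      exact ⟨hx.1, hx.2.trans h⟩
  · simp [hw, h]
  · simp

theorem rank_lt_card {v : Fin G.n} (hv : v ∈ G.splitting) : rank σ v < G.splitting.card := by
  refine Finset.card_lt_card (Finset.ssubset_iff_of_subset (Finset.filter_subset _ _) |>.mpr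
    ⟨v, hv, ?_⟩)
  simp

/-- After `i` rounds the distances of the splitting nodes of rank less than `i` are known. -/
theorem distances_spec (hG : G.Reaching) (hσ : G.IsStrategy σ) (hL : IsListing G S L)
    (hR : Ready G f b S L M) (hC : HoldsStrategy S σ M)
    (hr : ∀ (i : ℕ) (h : i < S.length) (r : Fin G.m), σ S[i] = some r →
      M.arr .rend i = G.chainEnd (G.head r) ∧ M.arr .rlen i = (G.route r).length)
    (h0 : ∀ v : Fin G.n, M.arr .dist v = 0) :
    Runs distances M fun M' k => k ≤ S.length * (S.length * 60 + 20) + 20 ∧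
      ∀ v : Fin G.n, G.IsEnd v → M'.arr .dist v = encDist (stratDist σ v) := by
  simp only [distances, block_cons_cons, block_singleton, runs_seq, runs_put]
  have hR0 : Ready G f b S L (M.setArr .dist (M.var .da) 1) :=
    hR.of_same (Exec.put M .dist (.var .da) (.lit 1)).same rfl
  -- All stored distances are correct, and those of rank less than `i` are stored. A round extends
  -- this to rank `i`, since the end of a chosen route with finite distance has smaller rank.
  let Inv (i : ℕ) (M' : Mem) : Prop := M'.arr .dist G.da = 1 ∧
    (∀ v : Fin G.n, M'.arr .dist v ≠ 0 → M'.arr .dist v = encDist (stratDist σ v)) ∧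
    ∀ v, v ∈ G.splitting → stratDist σ v ≠ ⊤ → rank σ v < i → M'.arr .dist v ≠ 0
  refine (Runs.forTo_const Inv (S.length * 60 + 6) rfl rfl ?_ ?_).mono ?_
  · refine ⟨by simp [hR.da], fun v => ?_, by simp⟩
    simp [hR.da, Function.update_apply, Fin.val_inj]
    split_ifs with h
    · intro _
      rw [h, stratDist_da]
      exact (encDist_coe 0).symm
    · exact fun h1 => absurd (h0 v) h1
  · rintro i M1 hi hx1 hs1 hI1
    have hR1 := hR0.of_same hs1 rfl
    refine (Runs.forTo_const (fun k M' => Inv i M' ∧ ∀ (j : ℕ) (h : j < S.length), j < k →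
      stratDist σ S[j] ≠ ⊤ → rank σ S[j] ≤ i → M'.arr .dist S[j] ≠ 0) 52 rfl rfl ?_ ?_).mono ?_
    · simpa [Inv] using hI1
    · rintro k M2 hk hx2 hs2 ⟨⟨hI1, hI2, hI3⟩, hI4⟩
      have hR2 := hR1.of_same hs2 rfl
      have hkS : k < S.length := hR1.t ▸ hk
      have arr : ∀ a, a ≠ .dist → M2.arr a = M.arr a := by
        intro a ha
        have h1 : M2.arr a = M1.arr a := hs2.arr a (by cases a <;> first | rfl | exact absurd rfl ha)
        have h2 : M1.arr a = _ := hs1.arr a (by cases a <;> first | rfl | exact absurd rfl ha)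
        rw [h1, h2]
        simp [ha]
      have hcur : M2.arr .cur k = enc (σ S[k]) := by rw [arr _ (by simp)]; exact hC k hkS
      have hSk : S[k] ∈ G.splitting := (hL.mem_S _).mp (List.getElem_mem _)
      cases hk' : σ S[k] with
      | none =>
        simp [hx2, hcur, hk', Inv]
        refine ⟨⟨hI1, hI2, hI3⟩, fun j hj hjk hd hrk => ?_⟩
        by_cases hne : j = k
        · subst hne
          exact absurd (stratDist_of_none hSk hk') hd
        · exact hI4 j hj (by omega) hd hrk
      | some r =>
        obtain ⟨hr1, hr2⟩ := hr k hkS r hk'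
        rw [← arr .rend (by simp)] at hr1
        rw [← arr .rlen (by simp)] at hr2
        have hD := hσ.stratDist_of_some hG hk'
        set w := G.chainEnd (G.head r) with hw
        have hwe : G.IsEnd w := hG.isEnd_chainEnd _
        simp [hx2, hcur, hk', hr1, hr2, hR2.sp k hkS]
        refine ⟨fun hdw => ?_, fun hdw => ?_⟩
        · have hval : (G.route r).length + M2.arr .dist w = encDist (stratDist σ S[k]) := by
            rw [hD, hI2 w hdw]
            have : stratDist σ w ≠ ⊤ := by
              intro h
              rw [hI2 w hdw, h] at hdw
              simp at hdw
            obtain ⟨d, hd⟩ := ENat.ne_top_iff_exists.mp this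
            rw [← hd, encDist_coe, ← Nat.cast_add, encDist_coe]
            omega
          have hne : (S[k] : ℕ) ≠ G.da := fun h => (mem_splitting.mp hSk).1 (Fin.ext h)
          have hpos : (G.route r).length + M2.arr .dist w ≠ 0 := by omega
          refine ⟨⟨?_, fun v => ?_, fun v hv hd hrk => ?_⟩, fun j hj hjk hd hrk => ?_⟩
          · simp [hne.symm, hI1]
          · simp only [Mem.arr_setVar, Mem.arr_setArr, if_true, Function.update_apply, Fin.val_inj]
            split_ifs with h
            · intro _
              rw [hval, h]
            · exact hI2 v
          · simp only [Mem.arr_setVar, Mem.arr_setArr, if_true, Function.update_apply, Fin.val_inj]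
            split_ifs with h
            · exact hpos
            · exact hI3 v hv hd hrk
          · simp only [Function.update_apply, Fin.val_inj]
            split_ifs with h
            · exact hpos
            · refine hI4 j hj (lt_of_le_of_ne (by omega) ?_) hd hrk
              rintro rfl
              exact h rfl
        · refine ⟨⟨hI1, hI2, hI3⟩, fun j hj hjk hd hrk => ?_⟩
          by_cases hne : j = k
          · subst hne
            exfalso
            rw [hD] at hd
            have hdw' : stratDist σ w ≠ ⊤ := by
              intro h
              simp [h] at hd
            by_cases hda : w = G.da
            · rw [hda, hI1] at hdw
              exact one_ne_zero hdw
            · have hws : w ∈ G.splitting := mem_splitting.mpr ⟨hda, hwe⟩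
              have hlt : stratDist σ w < stratDist σ S[j] := by
                rw [hD, route, List.length_cons]
                obtain ⟨d, hd⟩ := ENat.ne_top_iff_exists.mp hdw'
                rw [← hd]
                norm_cast
                omega
              exact hI3 w hws hdw' (by have := rank_lt hws hlt; omega) hdw
          · exact hI4 j hj (by omega) hd hrk
    · rintro M3 k3 hs3 ⟨⟨⟨g1, g2, g3⟩, g4⟩, hk3⟩
      rw [hR1.t] at hk3 g4
      refine ⟨by omega, ⟨by simpa using g1, by simpa using g2, fun v hv hd hrk => ?_⟩⟩
      obtain ⟨j, hj, rfl⟩ := List.getElem_of_mem ((hL.mem_S v).mpr hv)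
      simpa using g4 j hj hj hd (by omega)
  · rintro M1 k1 hs1 ⟨⟨g1, g2, g3⟩, hk1⟩
    have e1 : (M.setArr .dist (M.var .da) 1).var .t = S.length := hR0.t
    simp only [NExp.eval_var, NExp.eval_ofNat, e1] at hk1 g3
    refine ⟨?_, fun v hv => ?_⟩
    · simp only [NExp.cost_var, NExp.cost_ofNat]
      have : S.length * 60 + 6 + 8 ≤ S.length * 60 + 20 := by omega
      have := Nat.mul_le_mul_left S.length this
      omega
    · by_cases hd : M1.arr .dist v = 0
      · rw [hd, eq_comm, encDist_eq_zero]
        by_contra hne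
        have hda : v ≠ G.da := by
          rintro rfl
          rw [g1] at hd
          exact one_ne_zero hd
        have hvs := mem_splitting.mpr ⟨hda, hv⟩
        refine g3 v hvs hne ?_ hd
        have : S.toFinset = G.splitting := by ext v; simp [hL.mem_S]
        rw [← List.toFinset_card_of_nodup hL.nodup_S, this]
        exact rank_lt_card hvs
      · exact g2 v hd

end SplitFPT

/-! ### Blocking what the strategy of the attacker makes necessary -/

namespace SplitFPT

open AttackGraph

variable {G : AttackGraph} {f : ℕ∞ → ℝ} {b : ℕ} {S : List (Fin G.n)}
  {L : Fin G.n → List (Fin G.m)} {M : Mem} {σ : Fin G.n → Option (Fin G.m)}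
  {B : Finset (Fin G.m)}

/-- The array `blocked` holds the set `B`. -/
def HoldsBlocked (B : Finset (Fin G.m)) (M : Mem) : Prop :=
  ∀ e : Fin G.m, M.arr .blocked e = if e ∈ B then 1 else 0

/-- The array `mark` holds the set of the edges that the strategy `σ` makes unblockable. -/
def HoldsMark (σ : Fin G.n → Option (Fin G.m)) (M : Mem) : Prop :=
  ∀ e : Fin G.m, M.arr .mark e = 0 ↔ e ∉ marked σ

/-- The invariant of `examine`, after the edges in the list `p`. -/
structure Examined (σ : Fin G.n → Option (Fin G.m)) (B : Finset (Fin G.m))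
    (p : List (Fin G.m)) (M : Mem) : Prop where
  blocked : HoldsBlocked B M
  mark : HoldsMark σ M
  hit : M.var .hit = 0 ↔ ∀ e ∈ p, e ∉ B
  cand : M.var .cand = enc (lastIn (free σ) p)

theorem examine_spec {p : List (Fin G.m)} {e : Fin G.m} (hR : Ready G f b S L M)
    (he : M.var .e = e) (h : Examined σ B p M) :
    Runs examine M fun M' k => k ≤ 30 ∧ Examined σ B (p ++ [e]) M' := by
  obtain ⟨h1, h2, h3, h4⟩ := h
  have hb : M.arr .blocked e = 1 ↔ e ∈ B := by rw [h1]; simp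
  have hf : M.arr .blk e = 1 ∧ M.arr .mark e = 0 ↔ e ∈ free σ := by
    rw [hR.blk, h2, AttackGraph.mem_free]
  have aux : ∀ M' : Mem, M'.arr = M.arr → M'.var .hit = (if e ∈ B then 1 else M.var .hit) →
      M'.var .cand = (if e ∈ free σ then (e : ℕ) + 1 else M.var .cand) →
      Examined σ B (p ++ [e]) M' := by
    intro M' g1 g2 g3
    constructor
    · simpa only [HoldsBlocked, g1] using h1
    · simpa only [HoldsMark, g1] using h2
    · rw [g2]
      split_ifs with hB
      · simp only [List.mem_append, List.mem_singleton, false_iff]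
        exact fun h => h e (Or.inr rfl) hB
      · rw [h3]
        simp [or_imp, forall_and, hB]
    · rw [g3, lastIn_append_singleton]
      split_ifs
      · rfl
      · exact h4
  simp only [examine, block_cons_cons, block_singleton, runs_seq, runs_when, runs_set,
    Test.holds_and, Test.holds_eq, NExp.eval_get, NExp.eval_var, NExp.eval_ofNat, NExp.eval_add,
    Mem.var_setVar, Mem.arr_setVar, reduceCtorEq, if_false, he, hb, hf]
  refine ⟨fun c1 => ⟨fun c2 => ⟨?_, aux _ ?_ ?_ ?_⟩, fun c2 => ⟨?_, aux _ ?_ ?_ ?_⟩⟩,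
    fun c1 => ⟨fun c2 => ⟨?_, aux _ ?_ ?_ ?_⟩, fun c2 => ⟨?_, aux _ ?_ ?_ ?_⟩⟩⟩ <;> simp [c1, c2]

/-- The invariant of `forceBlocks`: `B` has been blocked, and the routes in `R` have been treated. -/
structure ForceInv (σ : Fin G.n → Option (Fin G.m)) (R : Fin G.m → Prop)
    (B : Finset (Fin G.m)) (M : Mem) : Prop where
  blocked : HoldsBlocked B M
  used : M.var .used = B.card
  valid : M.var .valid = 0 ∨ M.var .valid = 1
  free : ∀ e ∈ B, e ∈ free σ
  hit : M.var .valid = 1 → ∀ r, R r → Forced σ r → ∃ e ∈ G.route r, e ∈ B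
  origin : ∀ e ∈ B, ∃ r, Forced σ r ∧ lastIn (AttackGraph.free σ) (G.route r) = some e
  invalid : M.var .valid = 0 → ∃ r, Forced σ r ∧ lastIn (AttackGraph.free σ) (G.route r) = none

theorem ForceInv.congr {R R' : Fin G.m → Prop} {M' : Mem} (h : ForceInv σ R B M)
    (h1 : M'.arr .blocked = M.arr .blocked) (h2 : M'.var .used = M.var .used)
    (h3 : M'.var .valid = M.var .valid)
    (hR : ∀ r, R' r → Forced σ r → R r ∨ ∃ e ∈ G.route r, e ∈ B) : ForceInv σ R' B M' := by
  constructor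
  · simpa only [HoldsBlocked, h1] using h.blocked
  · rw [h2, h.used]
  · rw [h3]; exact h.valid
  · exact h.free
  · intro hv r hr hf
    rw [h3] at hv
    exact (hR r hr hf).elim (fun hr' => h.hit hv r hr' hf) id
  · exact h.origin
  · rw [h3]; exact h.invalid

theorem encDist_lt_iff {x y : ℕ∞} {l : ℕ} :
    encDist x ≠ 0 ∧ (encDist y = 0 ∨ l + encDist x < encDist y) ↔ l + x < y := by
  cases x with
  | top => simp
  | coe x =>
    cases y with
    | top => simp [← Nat.cast_add]
    | coe y =>
      rw [← Nat.cast_add, Nat.cast_lt, encDist_coe, encDist_coe]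
      omega

/-- What `forceBlocks` does for the route whose stored value is `p`. -/
def forceRoute : Cmd :=
  .when (.ne Var.p Arr.cur⟦Var.k⟧) (.block [
    .set .hit 0,
    .set .cand 0,
    .set .e (Var.p - 1),
    examine,
    .set .v Arr.head⟦Var.e⟧,
    .set .len 1,
    walk examine,
    .when (.and (.eq Var.hit 0) (.and (.ne Arr.dist⟦Var.v⟧ 0)
        (.or (.eq Arr.dist⟦Var.u⟧ 0) (.lt (Var.len + Arr.dist⟦Var.v⟧) Arr.dist⟦Var.u⟧))))
      (.ite (.eq Var.cand 0)
        (.set .valid 0)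
        (.block [
          .put .blocked (Var.cand - 1) 1,
          .set .used (Var.used + 1)]))])

/-- What the memory has to hold for `forceBlocks`. -/
structure ForceReady (G : AttackGraph) (f : ℕ∞ → ℝ) (b : ℕ) (S : List (Fin G.n))
    (L : Fin G.n → List (Fin G.m)) (σ : Fin G.n → Option (Fin G.m)) (M : Mem) : Prop where
  ready : Ready G f b S L M
  cur : HoldsStrategy S σ M
  mark : HoldsMark σ M
  dist : ∀ v : Fin G.n, G.IsEnd v → M.arr .dist v = encDist (stratDist σ v)

theorem ForceReady.of_same {c : Cmd} {M' : Mem} (h : ForceReady G f b S L σ M) (hs : Same c M M')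
    (hc : keepsReady c = true)
    (hc' : [Arr.cur, .mark, .dist].all (fun a => !c.SetsArr a) = true) :
    ForceReady G f b S L σ M' := by
  simp only [List.all_cons, List.all_nil, Bool.and_eq_true, Bool.not_eq_true', and_true] at hc'
  obtain ⟨h1, h2, h3⟩ := hc'
  constructor
  · exact h.ready.of_same hs hc
  · simpa only [HoldsStrategy, hs.arr _ h1] using h.cur
  · simpa only [HoldsMark, hs.arr _ h2] using h.mark
  · simpa only [hs.arr _ h3] using h.dist

theorem forceRoute_spec (hG : G.Reaching) (hL : IsListing G S L) {R : Fin G.m → Prop} {k : ℕ}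
    {hk : k < S.length} {r : Fin G.m} (hF : ForceReady G f b S L σ M) (hI : ForceInv σ R B M)
    (hp : M.var .p = r + 1) (hu : M.var .u = S[k]) (hkk : M.var .k = k)
    (hr : G.tail r = S[k]) :
    Runs forceRoute M fun M' K => K ≤ 200 * (G.maxPathLength + 1) ∧
      ∃ B', ForceInv σ (fun r' => R r' ∨ r' = r) B' M' := by
  have hSk : S[k] ∈ G.splitting := (hL.mem_S _).mp (List.getElem_mem _)
  have hcur : M.arr .cur k = enc (σ S[k]) := hF.cur k hk
  unfold forceRoute
  rw [runs_when]
  simp only [Test.holds_ne, NExp.eval_var, NExp.eval_get, hkk, hcur, hp]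
  rw [show (r : ℕ) + 1 = enc (some r) from rfl, enc_injective.ne_iff, not_not]
  refine ⟨fun hne => ?_, fun heq => ⟨?_, B, hI.congr rfl rfl rfl ?_⟩⟩
  rotate_left
  · simp; omega
  · rintro r' (hr' | rfl) hf
    · exact Or.inl hr'
    · exact absurd (by rw [hr, ← heq]) hf.2.1
  simp only [block_cons_cons, block_singleton, runs_seq, runs_set, NExp.eval_ofNat, NExp.eval_sub,
    NExp.eval_var, Mem.var_setVar, hp, reduceCtorEq, if_false, Nat.add_sub_cancel]
  have hF1 : ForceReady G f b S L σ (((M.setVar .hit 0).setVar .cand 0).setVar .e r) :=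
    hF.of_same (Exec.seq (Exec.set M .hit (.lit 0)) (Exec.seq (Exec.set _ .cand (.lit 0))
      (Exec.set _ .e (.lit r)))).same rfl rfl
  refine (examine_spec (σ := σ) (B := B) (p := []) (e := r) hF1.ready (by simp) ?_).mono ?_
  · exact ⟨hI.blocked, hF.mark, by simp, by simp⟩
  rintro M2 k2 hs2 ⟨hk2, hE2⟩
  have hF2 := hF1.of_same hs2 rfl rfl
  have he2 : M2.var .e = r := by rw [hs2.var _ rfl]; simp
  simp only [NExp.eval_get, NExp.eval_var, he2, hF2.ready.head]
  have hF3 : ForceReady G f b S L σ ((M2.setVar .v (G.head r)).setVar .len 1) :=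
    hF2.of_same (Exec.seq (Exec.set M2 .v (.lit (G.head r))) (Exec.set _ .len (.lit 1))).same
      rfl rfl
  refine (walk_spec hG hL (c := examine) rfl rfl rfl (Examined σ B) 30 ?_ ?_ (G.head r) [r] 1 _
    hF3.ready ?_ (by simp) (by simp)).mono ?_
  · rintro p M x k hx ⟨g1, g2, g3, g4⟩
    refine ⟨g1, g2, ?_, ?_⟩ <;> rcases hx with rfl | rfl | rfl <;> simpa
  · exact fun p e M h1 h2 h3 => examine_spec h1 h2 h3
  · obtain ⟨g1, g2, g3, g4⟩ := hE2
    exact ⟨g1, g2, by simpa using g3, by simpa using g4⟩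
  rintro M4 k4 hs4 ⟨⟨g1, g2, g3, g4⟩, g5, g6, g7⟩
  have hF4 := hF3.of_same hs4 rfl rfl
  rw [show [r] ++ G.chain (G.head r) = G.route r from rfl] at g3 g4
  have hlen : M4.var .len = (G.route r).length := by rw [g6, route, List.length_cons]; omega
  have hu4 : M4.var .u = G.tail r := by
    rw [hs4.var _ rfl, hr]
    simp only [Mem.var_setVar, reduceCtorEq, if_false]
    rw [hs2.var _ rfl]
    simpa using hu
  have hd1 := hF4.dist _ (hG.isEnd_chainEnd (G.head r))
  have hd2 := hF4.dist (G.tail r) (by rw [hr]; exact (mem_splitting.mp hSk).2)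
  have hval : M4.var .valid = M.var .valid := by
    rw [hs4.var _ rfl]
    simp only [Mem.var_setVar, reduceCtorEq, if_false]
    rw [hs2.var _ rfl]
    simp
  have hused : M4.var .used = M.var .used := by
    rw [hs4.var _ rfl]
    simp only [Mem.var_setVar, reduceCtorEq, if_false]
    rw [hs2.var _ rfl]
    simp
  have hblocked : M4.arr .blocked = M.arr .blocked := by
    rw [hs4.arr _ rfl]
    simp only [Mem.arr_setVar]
    rw [hs2.arr _ rfl]
    simp
  have hpath := hG.length_chain_le (G.head r)
  have htest : (M4.var .hit = 0 ∧ (M4.arr .dist (M4.var .v) ≠ 0 ∧ (M4.arr .dist (M4.var .u) = 0 ∨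
      M4.var .len + M4.arr .dist (M4.var .v) < M4.arr .dist (M4.var .u)))) ↔
      (∀ e ∈ G.route r, e ∉ B) ∧ Forced σ r := by
    rw [g3, g5, hu4, hd1, hd2, hlen, encDist_lt_iff, Forced]
    have h1 : G.tail r ∈ G.splitting := hr ▸ hSk
    have h2 : σ (G.tail r) ≠ some r := hr ▸ hne.symm
    tauto
  simp only [runs_when, Test.holds_and, Test.holds_or, Test.holds_eq, Test.holds_ne, Test.holds_lt,
    NExp.eval_add, NExp.eval_var, NExp.eval_get, NExp.eval_ofNat, htest, runs_ite, g4, runs_set,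
    runs_seq, runs_put, NExp.eval_sub, enc_eq_zero]
  simp only [NExp.cost_var, NExp.cost_get, NExp.cost_ofNat, NExp.cost_add, NExp.cost_sub,
    Test.cost_eq, Test.cost_ne, Test.cost_lt, Test.cost_and, Test.cost_or]
  refine ⟨fun ⟨hnot, hf⟩ => ⟨fun hnone => ⟨by omega, B, ?_⟩, fun hsome => ⟨by omega, ?_⟩⟩,
    fun hno => ⟨by omega, B, ?_⟩⟩
  · constructor
    · simpa only [HoldsBlocked, Mem.arr_setVar, hblocked] using hI.blocked
    · simp [hused, hI.used]
    · simp
    · exact hI.free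
    · simp
    · exact hI.origin
    · exact fun _ => ⟨r, hf, hnone⟩
  · obtain ⟨e, he⟩ := Option.ne_none_iff_exists'.mp hsome
    obtain ⟨he1, he2⟩ := mem_of_lastIn he
    have heB : e ∉ B := hnot e he1
    refine ⟨insert e B, ?_⟩
    simp only [he, enc_some, Nat.add_sub_cancel]
    constructor
    · intro e'
      simp only [Mem.arr_setVar, Mem.arr_setArr, if_true, hblocked, Function.update_apply,
        Fin.val_inj, Finset.mem_insert]
      by_cases hee : e' = e
      · simp [hee]
      · simp [hee, hI.blocked e']
    · simp [hused, hI.used, heB]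
    · simpa [hval] using hI.valid
    · simpa [he2] using hI.free
    · intro hv r' hr' hf'
      simp only [Mem.var_setVar, Mem.var_setArr, reduceCtorEq, if_false, hval] at hv
      rcases hr' with hr' | rfl
      · obtain ⟨e', h1, h2⟩ := hI.hit hv r' hr' hf'
        exact ⟨e', h1, Finset.mem_insert_of_mem h2⟩
      · exact ⟨e, he1, Finset.mem_insert_self _ _⟩
    · intro e' he'
      rcases Finset.mem_insert.mp he' with rfl | he'
      · exact ⟨r, hf, he⟩
      · exact hI.origin e' he'
    · simpa [hval] using hI.invalid
  · refine hI.congr hblocked hused hval ?_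
    rintro r' (hr' | rfl) hf
    · exact Or.inl hr'
    · right
      by_contra! hcon
      exact hno ⟨hcon, hf⟩

theorem forceList_spec (hG : G.Reaching) (hL : IsListing G S L) {R : Fin G.m → Prop} {k : ℕ}
    {hk : k < S.length} (l : List (Fin G.m)) (hl : ∀ r ∈ l, G.tail r = S[k])
    (hF : ForceReady G f b S L σ M) (hI : ForceInv σ R B M)
    (hp : Linked (M.arr .next) (M.var .p) l) (hu : M.var .u = S[k]) (hkk : M.var .k = k) :
    Runs (.while (.ne Var.p 0) (.block [forceRoute, .set .p Arr.next⟦Var.p - 1⟧])) M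
      fun M' K => K ≤ l.length * (300 * (G.maxPathLength + 1)) + 10 ∧
        ∃ B', ForceInv σ (fun r' => R r' ∨ r' ∈ l) B' M' := by
  induction l generalizing M B R with
  | nil =>
    have hp0 : M.var .p = 0 := hp
    refine Runs.while_false (by simp [hp0]) ⟨by simp, B, hI.congr rfl rfl rfl ?_⟩
    simpa using fun r hr _ => Or.inl hr
  | cons r l ih =>
    obtain ⟨hp1, hp2⟩ := hp
    refine Runs.while_true (by simp [hp1]) ?_
    simp only [block_cons_cons, block_singleton, runs_seq, runs_set]
    refine (forceRoute_spec hG hL (hk := hk) hF hI hp1 hu hkk (hl r (by simp))).mono ?_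
    rintro M1 k1 hs1 ⟨hk1, B1, hI1⟩
    have hF1 := hF.of_same hs1 rfl rfl
    have e1 : M1.var .p = r + 1 := (hs1.var _ rfl).trans hp1
    have e2 : M1.var .u = S[k] := (hs1.var _ rfl).trans hu
    have e3 : M1.var .k = k := (hs1.var _ rfl).trans hkk
    have e4 : M1.arr .next = M.arr .next := hs1.arr _ rfl
    simp only [NExp.eval_get, NExp.eval_sub, NExp.eval_var, NExp.eval_ofNat, e1,
      Nat.add_sub_cancel, e4]
    refine (ih (fun r' h => hl r' (by simp [h]))
      (hF1.of_same (Exec.set M1 .p (.lit (M.arr .next r))).same rfl rfl)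
      (hI1.congr rfl rfl rfl fun r' h _ => Or.inl h) ?_ (by simpa using e2)
      (by simpa using e3)).mono ?_
    · simpa [e4] using hp2
    · rintro M2 k2 - ⟨hk2, B2, hI2⟩
      refine ⟨?_, B2, hI2.congr rfl rfl rfl ?_⟩
      · simp only [List.length_cons, Test.cost_ne, NExp.cost_var, NExp.cost_ofNat, NExp.cost_get,
          NExp.cost_sub, add_mul]
        omega
      · intro r' hr' _
        rw [List.mem_cons] at hr'
        tauto

/-- At every splitting node the list of out-going edges is gone through once. Over all splitting
nodes, these lists have at most `2 * G.feedback` members. -/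
theorem forceBlocks_spec (hG : G.Reaching) (hL : IsListing G S L)
    (hF : ForceReady G f b S L σ M) (h0 : ∀ e : Fin G.m, M.arr .blocked e = 0) :
    Runs forceBlocks M fun M' K =>
      K ≤ 700 * G.feedback * (G.maxPathLength + 1) + 20 ∧
        ∃ B, ForceInv σ (fun _ => True) B M' := by
  have hfold : forceBlocks = .block [.set .valid 1, .set .used 0, .forTo .k Var.t (.block [
      .set .u Arr.sp⟦Var.k⟧, .set .p Arr.first⟦Var.u⟧,
      .while (.ne Var.p 0) (.block [forceRoute, .set .p Arr.next⟦Var.p - 1⟧])])] := rfl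
  rw [hfold]
  simp only [block_cons_cons, runs_seq, runs_set, block_singleton]
  have hF0 : ForceReady G f b S L σ ((M.setVar .valid ((1 : NExp).eval M)).setVar .used
      ((0 : NExp).eval (M.setVar .valid ((1 : NExp).eval M)))) :=
    hF.of_same (Exec.seq (Exec.set M .valid 1) (Exec.set _ .used 0)).same rfl rfl
  set M0 := (M.setVar .valid ((1 : NExp).eval M)).setVar .used
      ((0 : NExp).eval (M.setVar .valid ((1 : NExp).eval M))) with hM0
  have ht : M0.var .t = S.length := hF0.ready.t
  refine (Runs.forTo (fun k M' => ∃ B, ForceInv σ (fun r => ∃ (i : ℕ) (h : i < S.length),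
      i < k ∧ G.tail r = S[i]) B M')
    (fun i => (S.map G.outDegree).getD i 0 * (300 * (G.maxPathLength + 1)) + 50)
    rfl rfl ?_ ?_).mono ?_
  · refine ⟨∅, fun e => ?_, ?_, ?_, ?_, ?_, ?_, ?_⟩
    · simpa [hM0] using h0 e
    all_goals simp [hM0]
  · rintro k M' hk hx hs ⟨B, hI⟩
    have hF' := hF0.of_same hs rfl rfl
    have hkS : k < S.length := ht ▸ hk
    simp only [runs_seq, runs_set, NExp.eval_get, NExp.eval_var, hx, hF'.ready.sp k hkS,
      Mem.var_setVar, if_true, Mem.arr_setVar]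
    have hF1 : ForceReady G f b S L σ ((M'.setVar .u S[k]).setVar .p (M'.arr .first S[k])) :=
      hF'.of_same (Exec.seq (Exec.set M' .u (.lit S[k]))
        (Exec.set _ .p (.lit (M'.arr .first S[k])))).same rfl rfl
    refine (forceList_spec hG hL (hk := hkS) (L S[k]) (fun r hr => (hL.mem_L _ r).mp hr) hF1
      (hI.congr rfl rfl rfl fun r hr _ => Or.inl hr) ?_ (by simp) (by simpa using hx)).mono ?_
    · simpa using hF'.ready.first S[k]
    · rintro M2 k2 - ⟨hk2, B2, hI2⟩
      refine ⟨?_, B2, hI2.congr rfl rfl rfl ?_⟩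
      · rw [hL.length_L] at hk2
        simp [hkS]
        omega
      · rintro r ⟨i, hi, hik, hr⟩ -
        left
        by_cases hne : i = k
        · subst hne
          exact Or.inr ((hL.mem_L _ r).mpr hr)
        · exact Or.inl ⟨i, hi, by omega, hr⟩
  · rintro M1 k1 - ⟨⟨B, hI⟩, hk1⟩
    rw [ht] at hI hk1
    refine ⟨?_, B, hI.congr rfl rfl rfl ?_⟩
    · have h1 : ∀ l : List ℕ, ∑ i ∈ Finset.range l.length, l.getD i 0 = l.sum := by
        intro l
        induction l with
        | nil => rfl
        | cons a l ih =>
          rw [List.length_cons, Finset.sum_range_succ', List.sum_cons, add_comm, ← ih]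
          rfl
      have h2 : ∑ i ∈ Finset.range S.length, (S.map G.outDegree).getD i 0 ≤ 2 * G.feedback := by
        have := h1 (S.map G.outDegree)
        rw [List.length_map] at this
        rw [this, hL.sum_S]
        exact hG.sum_outDegree_splitting_le
      rw [Finset.sum_add_distrib, Finset.sum_add_distrib, ← Finset.sum_mul, Finset.sum_const,
        Finset.sum_const, Finset.card_range] at hk1
      have h3 := Nat.mul_le_mul_right (300 * (G.maxPathLength + 1)) h2
      have h4 := hL.length_S_le hG
      have h5 : 700 * G.feedback * (G.maxPathLength + 1) =
          2 * G.feedback * (300 * (G.maxPathLength + 1)) +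
            100 * G.feedback * G.maxPathLength + 100 * G.feedback := by ring
      simp only [smul_eq_mul, NExp.cost_ofNat] at hk1 ⊢
      omega
    · intro r _ hf
      left
      obtain ⟨i, hi, h⟩ := List.getElem_of_mem ((hL.mem_S _).mpr hf.1)
      exact ⟨i, hi, hi, h.symm⟩

end SplitFPT

/-! ### The tree that is left -/

namespace SplitFPT

open AttackGraph

variable {G : AttackGraph} {f : ℕ∞ → ℝ} {b : ℕ} {S : List (Fin G.n)}
  {L : Fin G.n → List (Fin G.m)} {M : Mem} {σ : Fin G.n → Option (Fin G.m)}
  {B : Finset (Fin G.m)}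

/-- The array `up` holds, for every node, the out-going edge that the attacker uses. -/
def HoldsUp (σ : Fin G.n → Option (Fin G.m)) (M : Mem) : Prop :=
  ∀ v : Fin G.n, ∃ o : Option (Fin G.m), M.arr .up v = enc o ∧
    ∀ e, o = some e ↔ Kept σ e ∧ G.tail e = v

/-- `Ch u` lists the nodes from which the attacker goes to `u`. -/
structure IsChildren (σ : Fin G.n → Option (Fin G.m)) (B : Finset (Fin G.m))
    (Ch : Fin G.n → List (Fin G.n)) : Prop where
  nodup : ∀ u, (Ch u).Nodup
  mem : ∀ u v, v ∈ Ch u ↔ ∃ e, Kept σ e ∧ e ∉ B ∧ G.tail e = v ∧ G.head e = u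

theorem HoldsUp.eq_add_one (h : HoldsUp σ M) {e : Fin G.m} (he : Kept σ e) :
    M.arr .up (G.tail e) = e + 1 := by
  obtain ⟨o, h1, h2⟩ := h (G.tail e)
  rw [h1, (h2 e).mpr ⟨he, rfl⟩]
  rfl

theorem holdsUp_of (hG : G.Reaching) (hσ : G.IsStrategy σ) (hL : IsListing G S L)
    (hR : Ready G f b S L M)
    (h1 : ∀ (i : ℕ) (h : i < S.length), M.arr .up S[i] = enc (σ S[i]))
    (h2 : ∀ v : Fin G.n, v ∉ S → M.arr .up v = if G.IsEnd v then 0 else M.arr .first v) :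
    HoldsUp σ M := by
  intro v
  by_cases hend : G.IsEnd v
  · by_cases hda : v = G.da
    · refine ⟨none, ?_, fun e => ?_⟩
      · rw [h2 v, if_pos hend]
        · rfl
        · rw [hL.mem_S, mem_splitting]
          exact fun h => h.1 hda
      · simp only [reduceCtorEq, false_iff]
        rintro ⟨he, rfl⟩
        exact hσ.tail_ne_da he hda
    · obtain ⟨i, hi, rfl⟩ := List.getElem_of_mem ((hL.mem_S v).mpr (mem_splitting.mpr ⟨hda, hend⟩))
      refine ⟨_, h1 i hi, fun e => ⟨fun h => ?_, ?_⟩⟩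
      · have ht := (hσ _ _ h).2
        exact ⟨Or.inr (by rw [ht, h]), ht⟩
      · rintro ⟨he, ht⟩
        rw [← ht]
        exact he.resolve_left (by rw [ht]; exact not_not_intro hend)
  · have hda : v ≠ G.da := fun h => hend (h ▸ isEnd_da)
    obtain ⟨e, rfl⟩ := hG.exists_edge hda
    refine ⟨some e, ?_, fun e' => ?_⟩
    · rw [h2, if_neg hend, hR.first_of_not_isEnd hL hend]
      · rfl
      · rw [hL.mem_S, mem_splitting]
        exact fun h => hend h.2
    · constructor
      · rintro h
        obtain rfl := Option.some.inj h
        exact ⟨Or.inl hend, rfl⟩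
      · rintro ⟨-, h⟩
        rw [edge_unique hend rfl h]

/-- The invariant of the last loop of `buildTree`, after `i` nodes. -/
def ChildrenInv (σ : Fin G.n → Option (Fin G.m)) (B : Finset (Fin G.m))
    (Ch : Fin G.n → List (Fin G.n)) (i : ℕ) (M : Mem) : Prop :=
  ∀ u : Fin G.n, Linked (M.arr .sib) (M.arr .child u) (Ch u) ∧ (Ch u).Nodup ∧
    ∀ v, v ∈ Ch u ↔ v.val < i ∧ ∃ e, Kept σ e ∧ e ∉ B ∧ G.tail e = v ∧ G.head e = u

theorem buildTree_spec (hG : G.Reaching) (hσ : G.IsStrategy σ) (hL : IsListing G S L)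
    (hR : Ready G f b S L M) (hC : HoldsStrategy S σ M) (hB : HoldsBlocked B M) :
    Runs buildTree M fun M' k => k ≤ 200 * (G.n + S.length + 1) ∧ HoldsUp σ M' ∧
      (∀ v : Fin G.n, M'.arr .isFront v = 0) ∧ ∃ Ch, IsChildren σ B Ch ∧
        ∀ u : Fin G.n, Linked (M'.arr .sib) (M'.arr .child u) (Ch u) := by
  simp only [buildTree, block_cons_cons, block_singleton, runs_seq]
  refine (Runs.forTo_const (fun i M' => ∀ j < i, M'.arr .child j = 0 ∧ M'.arr .isFront j = 0 ∧
    M'.arr .up j = if M.arr .isEnd j = 0 then M.arr .first j else 0) 50 rfl rfl (by simp) ?_).mono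
    ?_
  · intro i M' hi hx hs hI
    have h1 : M'.arr .isEnd = M.arr .isEnd := hs.arr _ rfl
    have h2 : M'.arr .first = M.arr .first := hs.arr _ rfl
    simp [hx, Function.update_apply, h1, h2]
    grind
  rintro M1 k1 hs1 ⟨g1, hk1⟩
  rw [hR.n] at g1 hk1
  have hR1 := hR.of_same hs1 rfl
  have hC1 : HoldsStrategy S σ M1 := by simpa only [HoldsStrategy, hs1.arr .cur rfl] using hC
  refine (Runs.forTo_const (fun k M' =>
    (∀ (i : ℕ) (h : i < S.length), i < k → M'.arr .up S[i] = enc (σ S[i])) ∧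
    ∀ v : Fin G.n, v ∉ S → M'.arr .up v = M1.arr .up v) 20 rfl rfl (by simp) ?_).mono ?_
  · rintro k M' hk hx hs ⟨hI1, hI2⟩
    have hR' := hR1.of_same hs rfl
    have hkS : k < S.length := hR1.t ▸ hk
    have hcur : M'.arr .cur k = enc (σ S[k]) := by rw [hs.arr _ rfl]; exact hC1 k hkS
    simp only [runs_put, NExp.eval_get, NExp.eval_var, hx, hcur, hR'.sp k hkS, Mem.arr_setVar,
      Mem.arr_setArr, if_true, Function.update_apply, Fin.val_inj]
    refine ⟨by simp, fun i hi hik => ?_, fun v hv => ?_⟩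
    · split_ifs with h
      · rw [h]
      · refine hI1 i hi (lt_of_le_of_ne (by omega) ?_)
        rintro rfl
        exact h rfl
    · rw [if_neg, hI2 v hv]
      rintro rfl
      exact hv (List.getElem_mem _)
  rintro M2 k2 hs2 ⟨⟨g2, g3⟩, hk2⟩
  rw [hR1.t] at g2 hk2
  have hR2 := hR1.of_same hs2 rfl
  have hup : HoldsUp σ M2 := by
    refine holdsUp_of hG hσ hL hR2 (fun i hi => g2 i hi hi) fun v hv => ?_
    rw [g3 v hv, (g1 v v.isLt).2.2]
    have h2 : M2.arr .first = M.arr .first := (hs2.arr _ rfl).trans (hs1.arr _ rfl)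
    rw [h2]
    have := hR.isEnd v
    by_cases hv : G.IsEnd v <;> simp [hv, this]
  have hB2 : HoldsBlocked B M2 := by
    simpa only [HoldsBlocked, hs2.arr .blocked rfl, hs1.arr .blocked rfl] using hB
  refine (Runs.forTo_const (fun i M' => ∃ Ch, ChildrenInv σ B Ch i M') 60 rfl rfl ?_ ?_).mono ?_
  · refine ⟨fun _ => [], fun u => ?_⟩
    have h2 : M2.arr .child = M1.arr .child := hs2.arr _ rfl
    simp [Linked, h2, (g1 u u.isLt).1]
  · rintro i M' hi hx hs ⟨Ch, hI⟩
    have hR' := hR2.of_same hs rfl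
    have hin : i < G.n := hR2.n ▸ hi
    set v : Fin G.n := ⟨i, hin⟩ with hv
    have hvi : (v : ℕ) = i := rfl
    have hlt : ∀ w : Fin G.n, w.val < i + 1 ↔ w = v ∨ w.val < i := by
      intro w
      rw [Fin.ext_iff, hvi]
      omega
    have hB' : HoldsBlocked B M' := by
      simpa only [HoldsBlocked, hs.arr .blocked rfl] using hB2
    obtain ⟨o, ho1, ho2⟩ := hup v
    have hupi : M'.arr .up i = enc o := by rw [hs.arr _ rfl, ← hvi, ho1]
    have skip : (∀ e, Kept σ e → e ∉ B → G.tail e ≠ v) →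
        ChildrenInv σ B Ch (i + 1) (M'.setVar .v (i + 1)) := by
      intro h u
      obtain ⟨h1, h2, h3⟩ := hI u
      refine ⟨h1, h2, fun w => ?_⟩
      rw [h3, hlt]
      constructor
      · exact fun h => ⟨Or.inr h.1, h.2⟩
      · rintro ⟨rfl | h', e, h4, h5, h6, h7⟩
        · exact absurd h6 (h e h4 h5)
        · exact ⟨h', e, h4, h5, h6, h7⟩
    cases o with
    | none =>
      simp only [enc_none] at hupi
      simp [hx, hupi]
      refine ⟨Ch, skip fun e h1 _ h3 => ?_⟩
      have := (ho2 e).mpr ⟨h1, h3⟩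
      simp at this
    | some e =>
      obtain ⟨hk, ht⟩ := (ho2 e).mp rfl
      simp only [enc_some] at hupi
      by_cases heB : e ∈ B
      · have hb : M'.arr .blocked e = 1 := by simp [hB' e, heB]
        simp [hx, hupi, hb]
        refine ⟨Ch, skip fun e' h1 h2 h3 => ?_⟩
        have := (ho2 e').mpr ⟨h1, h3⟩
        obtain rfl := Option.some.inj this
        exact h2 heB
      · have hb : M'.arr .blocked e = 0 := by simp [hB' e, heB]
        simp [hx, hupi, hb, hR'.head]
        refine ⟨Function.update Ch (G.head e) (v :: Ch (G.head e)), fun u => ?_⟩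
        have hnot : ∀ u, v ∉ Ch u := fun u h => by
          simpa [hvi] using (((hI u).2.2 v).mp h).1
        have hcong : ∀ w : Fin G.n, w ≠ v →
            Function.update (M'.arr .sib) i (M'.arr .child (G.head e)) w = M'.arr .sib w := by
          intro w hw
          rw [Function.update_of_ne]
          exact fun h => hw (Fin.ext h)
        obtain ⟨h1, h2, h3⟩ := hI u
        have hmem : ∀ w, (w.val < i + 1 ∧ ∃ e, Kept σ e ∧ e ∉ B ∧ G.tail e = w ∧ G.head e = u) ↔
            (w = v ∧ u = G.head e) ∨ w ∈ Ch u := by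
          intro w
          rw [h3, hlt]
          constructor
          · rintro ⟨rfl | h', e', h4, h5, h6, h7⟩
            · obtain rfl := Option.some.inj ((ho2 e').mpr ⟨h4, h6⟩)
              exact Or.inl ⟨rfl, h7.symm⟩
            · exact Or.inr ⟨h', e', h4, h5, h6, h7⟩
          · rintro (⟨rfl, rfl⟩ | ⟨h', h4⟩)
            · exact ⟨Or.inl rfl, e, hk, heB, ht, rfl⟩
            · exact ⟨Or.inr h', h4⟩
        by_cases hu : u = G.head e
        · subst hu
          simp only [Mem.arr_setVar, Mem.arr_setArr, reduceCtorEq, if_true, if_false,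
            Function.update_self, List.nodup_cons, List.mem_cons, hmem, and_true]
          refine ⟨⟨rfl, ?_⟩, ⟨hnot _, h2⟩, fun w => trivial⟩
          rw [hvi, Function.update_self]
          exact h1.congr fun w hw => hcong w fun h => hnot _ (h ▸ hw)
        · have hu' : (u : ℕ) ≠ (G.head e : ℕ) := fun h => hu (Fin.ext h)
          simp only [Mem.arr_setVar, Mem.arr_setArr, reduceCtorEq, if_true, if_false,
            Function.update_of_ne hu, Function.update_of_ne hu', hmem, hu, and_false, false_or,
            implies_true, and_true]
          exact ⟨h1.congr fun w hw => hcong w fun h => hnot _ (h ▸ hw), h2⟩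
  rintro M3 k3 hs3 ⟨⟨Ch, g4⟩, hk3⟩
  rw [hR2.n] at g4 hk3
  refine ⟨by omega, ?_, fun v => ?_, Ch, ⟨fun u => (g4 u).2.1, fun u v => ?_⟩, fun u => (g4 u).1⟩
  · simpa only [HoldsUp, hs3.arr .up rfl] using hup
  · have h : M3.arr .isFront = M1.arr .isFront := (hs3.arr _ rfl).trans (hs2.arr _ rfl)
    rw [h]
    exact (g1 v v.isLt).2.1
  · rw [(g4 u).2.2]
    simp

end SplitFPT

/-! ### Breadth-first search -/

namespace SplitFPT

open AttackGraph

variable {G : AttackGraph} {f : ℕ∞ → ℝ} {b : ℕ} {S : List (Fin G.n)}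
  {L : Fin G.n → List (Fin G.m)} {M : Mem} {σ : Fin G.n → Option (Fin G.m)}
  {B : Finset (Fin G.m)}

/-- The last free edge on the simple path that starts at `v`. -/
noncomputable def lastFree (σ : Fin G.n → Option (Fin G.m)) (v : Fin G.n) : Option (Fin G.m) :=
  lastIn (free σ) (G.chain v)

open Classical in
/-- The invariant of `search`: the nodes in `Q` have been visited. -/
structure Visited (f : ℕ∞ → ℝ) (σ : Fin G.n → Option (Fin G.m)) (B : Finset (Fin G.m))
    (Q : List (Fin G.n)) (M : Mem) : Prop where
  nodup : Q.Nodup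
  reach : ∀ v ∈ Q, G.dist B v ≠ ⊤
  depth : ∀ v ∈ Q, (M.arr .depth v : ℕ∞) = G.dist B v
  front : ∀ v ∈ Q, M.arr .front v = enc ((lastFree σ v).map G.tail)
  closed : ∀ v ∈ Q, ∀ e, lastFree σ v = some e → G.tail e ∈ Q
  isFront : ∀ v : Fin G.n, M.arr .isFront v =
    if v ∈ Q ∧ ∃ e, lastFree σ v = some e ∧ G.tail e = v then 1 else 0
  total : M.rvar .total = ∑ v ∈ G.entry with v ∈ Q, f (G.dist B v)
  ben : ∀ e, G.tail e ∈ Q → lastFree σ (G.tail e) = some e →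
    M.rarr .ben (G.tail e) = ∑ v ∈ G.entry with v ∈ Q ∧ lastFree σ v = some e, f (G.dist B v)
  queue : ∀ (i : ℕ) (h : i < Q.length), M.arr .queue i = Q[i]
  qt : M.var .qt = Q.length

theorem sum_filter_append {Q : List (Fin G.n)} {c : Fin G.n} (hc : c ∉ Q) (P : Fin G.n → Prop)
    [DecidablePred P] (g : Fin G.n → ℝ) :
    ∑ v ∈ G.entry with v ∈ Q ++ [c] ∧ P v, g v =
      ∑ v ∈ G.entry with v ∈ Q ∧ P v, g v + if c ∈ G.entry ∧ P c then g c else 0 := by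
  have h1 : (G.entry.filter fun v => v ∈ Q ++ [c] ∧ P v) =
      (G.entry.filter fun v => v ∈ Q ∧ P v) ∪ G.entry.filter fun v => v = c ∧ P v := by
    ext v
    simp only [List.mem_append, List.mem_singleton, Finset.mem_filter, Finset.mem_union]
    tauto
  rw [h1, Finset.sum_union]
  · congr 1
    split_ifs with h
    · rw [Finset.sum_eq_single_of_mem c (by simpa using h)]
      intro v hv hne
      exact absurd (by simpa using (Finset.mem_filter.mp hv).2.1) hne
    · refine Finset.sum_eq_zero fun v hv => absurd ?_ h
      obtain ⟨h2, rfl, h3⟩ := Finset.mem_filter.mp hv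
      exact ⟨h2, h3⟩
  · rw [Finset.disjoint_filter]
    rintro v - ⟨h2, -⟩ ⟨rfl, -⟩
    exact hc h2

/-- What the memory has to hold for `search`. -/
structure SearchReady (G : AttackGraph) (f : ℕ∞ → ℝ) (b : ℕ) (S : List (Fin G.n))
    (L : Fin G.n → List (Fin G.m)) (σ : Fin G.n → Option (Fin G.m))
    (Ch : Fin G.n → List (Fin G.n)) (M : Mem) : Prop where
  ready : Ready G f b S L M
  mark : HoldsMark σ M
  up : HoldsUp σ M
  child : ∀ u : Fin G.n, Linked (M.arr .sib) (M.arr .child u) (Ch u)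

theorem SearchReady.of_same {Ch : Fin G.n → List (Fin G.n)} {c : Cmd} {M' : Mem}
    (h : SearchReady G f b S L σ Ch M) (hs : Same c M M') (hc : keepsReady c = true)
    (hc' : [Arr.mark, .up, .sib, .child].all (fun a => !c.SetsArr a) = true) :
    SearchReady G f b S L σ Ch M' := by
  simp only [List.all_cons, List.all_nil, Bool.and_eq_true, Bool.not_eq_true', and_true] at hc'
  obtain ⟨h1, h2, h3, h4⟩ := hc'
  constructor
  · exact h.ready.of_same hs hc
  · simpa only [HoldsMark, hs.arr _ h1] using h.mark
  · simpa only [HoldsUp, hs.arr _ h2] using h.up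
  · simpa only [hs.arr _ h3, hs.arr _ h4] using h.child

theorem lastFree_tail (hG : G.Reaching) {v : Fin G.n} {e : Fin G.m}
    (h : lastFree σ v = some e) : lastFree σ (G.tail e) = some e := by
  obtain ⟨h1, h2⟩ := mem_of_lastIn h
  unfold lastFree
  rw [hG.chain_tail (hG.not_isEnd_tail h1)]
  exact lastIn_eq_of_suffix (hG.route_suffix_chain h1) (mem_route_self e) h2 h

/-- Visiting `c` and appending it to the queue. -/
theorem visit_spec (hG : G.Reaching) (hσ : G.IsStrategy σ) (hB : Consistent σ B)
    {Ch : Fin G.n → List (Fin G.n)} (hS : SearchReady G f b S L σ Ch M) {Q : List (Fin G.n)}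
    (hV : Visited f σ B Q M) {e : Fin G.m} (he : Kept σ e) (heB : e ∉ B) (hu : G.head e ∈ Q)
    (hc : G.tail e ∉ Q) (hMc : M.var .c = G.tail e) (hMu : M.var .u = G.head e) :
    Runs (.seq visit (.seq (.put .queue Var.qt Var.c) (.set .qt (Var.qt + 1)))) M fun M' k =>
      k ≤ 100 ∧ Visited f σ B (Q ++ [G.tail e]) M' := by
  classical
  set c := G.tail e with hcdef
  set u := G.head e with hudef
  have huc : (u : ℕ) ≠ c := fun h => hc (Fin.ext h ▸ hu)
  have hdc : G.dist B c = G.dist B u + 1 := hB.dist_tail hG hσ he heB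
  have hdepth : ((M.arr .depth u + 1 : ℕ) : ℕ∞) = G.dist B c := by
    rw [hdc, ← hV.depth u hu]
    push_cast
    rfl
  have hlast : lastFree σ c = (lastFree σ u).or (if e ∈ free σ then some e else none) :=
    lastIn_chain_tail hG he
  have hfu := hV.front u hu
  have hup : M.arr .up c = e + 1 := hS.up.eq_add_one he
  have hfree : M.arr .blk e = 1 ∧ M.arr .mark e = 0 ↔ e ∈ free σ := by
    rw [hS.ready.blk, hS.mark, AttackGraph.mem_free]
  have hentry := hS.ready.entry c
  have hf : M.rarr .f (M.arr .depth u + 1) = f (G.dist B c) := by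
    rw [hS.ready.f _ (lt_of_dist_eq hdepth.symm), hdepth]
  -- The new frontier edge is known to be `e` exactly if its test succeeds.
  have hself : (∃ e', lastFree σ c = some e' ∧ G.tail e' = c) ↔
      lastFree σ u = none ∧ e ∈ free σ := by
    rw [hlast]
    cases hl : lastFree σ u with
    | none =>
      by_cases hef : e ∈ free σ
      · simpa [hef] using hcdef.symm
      · simp [hef]
    | some e' =>
      simp only [Option.some_or, Option.some.injEq, exists_eq_left', reduceCtorEq, false_and,
        iff_false]
      intro h
      exact hc (h ▸ hV.closed u hu e' hl)
  have key : ∀ M' : Mem,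
      M'.arr .depth = Function.update (M.arr .depth) c (M.arr .depth u + 1) →
      M'.arr .front = Function.update (M.arr .front) c (enc ((lastFree σ c).map G.tail)) →
      M'.arr .isFront = (if lastFree σ u = none ∧ e ∈ free σ then
        Function.update (M.arr .isFront) c 1 else M.arr .isFront) →
      M'.rvar .total = M.rvar .total + (if c ∈ G.entry then f (G.dist B c) else 0) →
      (∀ e', G.tail e' ∈ Q ++ [c] → lastFree σ (G.tail e') = some e' →
        M'.rarr .ben (G.tail e') = (if G.tail e' = c then 0 else M.rarr .ben (G.tail e')) +
          if c ∈ G.entry ∧ lastFree σ c = some e' then f (G.dist B c) else 0) →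
      M'.arr .queue = M.arr .queue →
      Visited f σ B (Q ++ [c]) ((M'.setArr .queue (M.var .qt) c).setVar .qt (M.var .qt + 1)) := by
    intro M' h1 h2 h3 h4 h5 h7
    have hne : ∀ v ∈ Q, (v : ℕ) ≠ c := fun v hv h => hc (Fin.ext h ▸ hv)
    constructor
    · simp only [List.nodup_append, hV.nodup, true_and, List.nodup_singleton, List.mem_singleton]
      rintro v hv _ rfl rfl
      exact hc hv
    · intro v hv
      rcases List.mem_append.mp hv with hv | hv
      · exact hV.reach v hv
      · rw [List.mem_singleton.mp hv, ← hdepth]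
        exact ENat.natCast_ne_top _
    · intro v hv
      simp only [Mem.arr_setVar, Mem.arr_setArr, reduceCtorEq, if_false, h1]
      rcases List.mem_append.mp hv with hv | hv
      · rw [Function.update_of_ne (hne v hv), hV.depth v hv]
      · rw [List.mem_singleton.mp hv, Function.update_self, hdepth]
    · intro v hv
      simp only [Mem.arr_setVar, Mem.arr_setArr, reduceCtorEq, if_false, h2]
      rcases List.mem_append.mp hv with hv | hv
      · rw [Function.update_of_ne (hne v hv), hV.front v hv]
      · rw [List.mem_singleton.mp hv, Function.update_self]
    · intro v hv e' he'
      rcases List.mem_append.mp hv with hv | hv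
      · exact List.mem_append_left _ (hV.closed v hv e' he')
      · rw [List.mem_singleton.mp hv, hlast] at he'
        cases hl : lastFree σ u with
        | some e'' =>
          rw [hl] at he'
          obtain rfl := Option.some.inj he'
          exact List.mem_append_left _ (hV.closed u hu e'' hl)
        | none =>
          rw [hl, Option.none_or] at he'
          split_ifs at he'
          obtain rfl := Option.some.inj he'
          simp [hcdef]
    · intro v
      simp only [Mem.arr_setVar, Mem.arr_setArr, reduceCtorEq, if_false, h3]
      by_cases hv : v = c
      · have h9 : c ∈ Q ++ [c] := by simp
        simp only [hv, h9, true_and, hself]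
        split_ifs with h
        · rw [Function.update_self]
        · rw [hV.isFront, if_neg]
          exact fun h => hc h.1
      · have hv' : (v : ℕ) ≠ c := fun h => hv (Fin.ext h)
        have : v ∈ Q ++ [c] ↔ v ∈ Q := by simp [hv]
        simp only [this]
        rw [← hV.isFront]
        split_ifs
        · rw [Function.update_of_ne hv']
        · rfl
    · have := sum_filter_append hc (fun _ => True) (fun v => f (G.dist B v))
      simp only [and_true] at this
      rw [this, ← hV.total, ← h4]
      simp
    · intro e' he' hl
      rw [sum_filter_append hc (fun v => lastFree σ v = some e')]
      simp only [Mem.rarr_setVar, Mem.rarr_setArr]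
      have h8 := h5 e' he' hl
      rw [h8]
      congr 1
      split_ifs with hec
      · -- No node whose path to the destination leads through `c` has been visited before `c`.
        rw [Finset.sum_eq_zero]
        intro v hv
        obtain ⟨-, hvQ, hvl⟩ := Finset.mem_filter.mp hv
        exact absurd (hec ▸ hV.closed v hvQ e' hvl) hc
      · refine hV.ben e' ?_ hl
        rcases List.mem_append.mp he' with h | h
        · exact h
        · exact absurd (List.mem_singleton.mp h) hec
    · intro i hi
      simp only [Mem.arr_setVar, Mem.arr_setArr, if_true, h7, hV.qt, Function.update_apply]
      simp only [List.length_append, List.length_singleton] at hi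
      split_ifs with h
      · subst h
        simp
      · rw [List.getElem_append_left (by omega), hV.queue i (by omega)]
    · simp [hV.qt]
  have hMqt : M.var .qt = Q.length := hV.qt
  simp only [visit, block_cons_cons, block_singleton, runs_seq, runs_when, runs_set, runs_put,
    runs_rset, runs_rput, Test.holds_and, Test.holds_eq, Test.holds_ne, NExp.eval_get,
    NExp.eval_var, NExp.eval_ofNat, NExp.eval_add, NExp.eval_sub, hMc, hMu, hup, Mem.var_setVar,
    Mem.arr_setVar, Mem.var_setArr, Mem.arr_setArr, reduceCtorEq, if_false, if_true,
    Nat.add_sub_cancel, Function.update_of_ne huc, Function.update_self, hfu, hfree, enc_eq_zero,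
    Option.map_eq_none_iff, Mem.rarr_setVar, Mem.rarr_setArr, Mem.rarr_setRArr, Mem.rvar_setVar,
    Mem.rvar_setArr, Mem.rvar_setRArr, Mem.var_setRVar, Mem.var_setRArr, Mem.arr_setRVar,
    Mem.arr_setRArr, Mem.rarr_setRVar, RExp.eval_zero, RExp.eval_add,
    RExp.eval_var, RExp.eval_get, hentry, hf]
  have hval : ∀ v : Fin G.n, (v : ℕ) = c ↔ v = c := fun v => Fin.val_inj
  refine ⟨fun h1 => ?_, fun h1 => ?_⟩
  · have hl : lastFree σ c = some e := by rw [hlast, h1.1, if_pos h1.2]; rfl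
    have hben : ∀ e', lastFree σ (G.tail e') = some e' → (G.tail e' = c ↔ e' = e) := by
      refine fun e' he' => ⟨fun h => ?_, fun h => h ▸ rfl⟩
      rw [h, hl] at he'
      exact (Option.some.inj he').symm
    have hfr : (c : ℕ) + 1 = enc ((lastFree σ c).map G.tail) := by rw [hl]; rfl
    refine ⟨fun h2 => ⟨fun _ => ⟨by simp, ?_⟩, fun h => absurd (Nat.succ_ne_zero _) h⟩,
      fun h2 => ⟨by simp, ?_⟩⟩
    · refine key _ ?_ ?_ ?_ ?_ ?_ ?_
      · simp
      · simp [hfr]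
      · simp [h1]
      · simp [h2]
      · intro e' h3 h4
        by_cases h5 : e' = e
        · simp [h5, h2, hl, ← hcdef]
        · simp [h2, hl, hval, hben e' h4, h5, Ne.symm h5]
      · simp
    · refine key _ ?_ ?_ ?_ ?_ ?_ ?_
      · simp
      · simp [hfr]
      · simp [h1]
      · simp [h2]
      · intro e' h3 h4
        by_cases h5 : e' = e
        · simp [h5, h2, ← hcdef]
        · simp [h2, hval, hben e' h4, h5]
      · simp
  · have hl : lastFree σ c = lastFree σ u := by
      rw [hlast]
      cases hlu : lastFree σ u with
      | some e' => rfl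
      | none => rw [if_neg fun h => h1 ⟨hlu, h⟩]; rfl
    have hne : ∀ e', lastFree σ (G.tail e') = some e' → G.tail e' ≠ c := fun e' he' h =>
      h1 (hself.mp ⟨e', by rw [← h]; exact he', h⟩)
    refine ⟨fun h2 => ⟨fun h3 => ⟨by simp, ?_⟩, fun h3 => ⟨by simp, ?_⟩⟩, fun h2 => ⟨by simp, ?_⟩⟩
    · rw [Ne, enc_eq_zero, Option.map_eq_none_iff] at h3
      obtain ⟨e₀, he₀⟩ := Option.ne_none_iff_exists'.mp h3
      refine key _ ?_ ?_ ?_ ?_ ?_ ?_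
      · simp
      · simp [hl]
      · simp [h1]
      · simp [h2]
      · intro e' h4 h5
        simp only [he₀, Option.map_some, enc_some, Nat.add_sub_cancel, Mem.rarr_setRArr, if_true,
          Mem.rarr_setRVar, Mem.rarr_setVar, Mem.rarr_setArr, Function.update_apply, Fin.val_inj,
          if_neg (hne e' h5), hl, h2, true_and, Option.some.injEq]
        have h6 : G.tail e' = G.tail e₀ ↔ e₀ = e' := by
          refine ⟨fun h => ?_, fun h => h ▸ rfl⟩
          rw [h, lastFree_tail hG he₀] at h5
          exact Option.some.inj h5
        by_cases h7 : e₀ = e'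
        · simp [h7]
        · simp [h6, h7]
      · simp
    · rw [Ne, not_not, enc_eq_zero, Option.map_eq_none_iff] at h3
      refine key _ ?_ ?_ ?_ ?_ ?_ ?_
      · simp
      · simp [hl]
      · simp [h1]
      · simp [h2]
      · intro e' h4 h5
        simp [hne e' h5, hl, h3]
      · simp
    · refine key _ ?_ ?_ ?_ ?_ ?_ ?_
      · simp
      · simp [hl]
      · simp [h1]
      · simp [h2]
      · intro e' h4 h5
        simp [hne e' h5, h2]
      · simp

/-- The loop over the children of `u`. -/
theorem searchChildren_spec (hG : G.Reaching) (hσ : G.IsStrategy σ) (hB : Consistent σ B)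
    {Ch : Fin G.n → List (Fin G.n)} (hCh : IsChildren σ B Ch) {u : Fin G.n}
    (l : List (Fin G.n)) (hl : ∀ v ∈ l, v ∈ Ch u) (hl' : l.Nodup)
    (hS : SearchReady G f b S L σ Ch M) {Q : List (Fin G.n)} (hV : Visited f σ B Q M)
    (hu : u ∈ Q) (hlQ : ∀ v ∈ l, v ∉ Q) (hMu : M.var .u = u)
    (hp : Linked (M.arr .sib) (M.var .p) l) :
    Runs (.while (.ne Var.p 0) (.block [
      .set .c (Var.p - 1),
      visit,
      .put .queue Var.qt Var.c,
      .set .qt (Var.qt + 1),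
      .set .p Arr.sib⟦Var.c⟧])) M fun M' k => k ≤ l.length * 150 + 5 ∧
        Visited f σ B (Q ++ l) M' := by
  induction l generalizing M Q with
  | nil =>
    have hp0 : M.var .p = 0 := hp
    exact Runs.while_false (by simp [hp0]) ⟨by simp, by simpa using hV⟩
  | cons c l ih =>
    obtain ⟨hp1, hp2⟩ := hp
    refine Runs.while_true (by simp [hp1]) ?_
    obtain ⟨e, he, heB, hec, heu⟩ := (hCh.mem u c).mp (hl c (by simp))
    simp only [block_cons_cons, block_singleton]
    rw [runs_seq, runs_set]
    simp only [NExp.eval_sub, NExp.eval_var, NExp.eval_ofNat, hp1, Nat.add_sub_cancel]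
    have hS1 : SearchReady G f b S L σ Ch (M.setVar .c c) :=
      hS.of_same (Exec.set M .c (.lit c)).same rfl rfl
    have hV1 : Visited f σ B Q (M.setVar .c c) := by
      obtain ⟨g1, g2, g3, g4, g5, g6, g7, g8, g9, g10⟩ := hV
      exact ⟨g1, g2, g3, g4, g5, g6, g7, g8, g9, by simpa using g10⟩
    have h1 := visit_spec hG hσ hB hS1 hV1 he heB (heu ▸ hu) (hec ▸ hlQ c (by simp)) (by simp [hec])
      (by simp [heu, hMu])
    -- Regroup the body of the loop.
    suffices h2 : Runs (.seq (.seq visit (.seq (.put .queue Var.qt Var.c) (.set .qt (Var.qt + 1))))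
        (.set .p Arr.sib⟦Var.c⟧)) (M.setVar .c c) fun M1 k1 => Runs (.while (.ne Var.p 0) (.block [
          .set .c (Var.p - 1), visit, .put .queue Var.qt Var.c, .set .qt (Var.qt + 1),
          .set .p Arr.sib⟦Var.c⟧])) M1 fun M2 k2 => k1 + k2 ≤ (l.length + 1) * 150 - 20 ∧
            Visited f σ B (Q ++ c :: l) M2 by
      simp only [runs_seq] at h2 ⊢
      refine h2.mono fun M3 k3 _ h3 => h3.mono fun M4 k4 _ h4 => h4.mono fun M5 k5 _ h5 => ?_
      simp only [runs_set] at h5 ⊢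
      refine h5.mono fun M6 k6 _ h6 => ⟨?_, h6.2⟩
      have h7 := h6.1
      simp only [List.length_cons, NExp.cost_var, NExp.cost_ofNat, NExp.cost_sub, NExp.cost_get,
        Test.cost_ne] at h7 ⊢
      omega
    rw [runs_seq]
    refine h1.mono ?_
    rintro M1 k1 hs1 ⟨hk1, hV2⟩
    rw [hec] at hV2
    have hS2 := hS1.of_same hs1 rfl rfl
    have hc2 : M1.var .c = c := by rw [hs1.var _ rfl]; simp
    have hu2 : M1.var .u = u := by rw [hs1.var _ rfl]; simpa using hMu
    have hsib : M1.arr .sib = M.arr .sib := by rw [hs1.arr _ rfl]; simp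
    simp only [runs_set, NExp.eval_get, NExp.eval_var, hc2, hsib]
    have hS3 : SearchReady G f b S L σ Ch (M1.setVar .p (M.arr .sib c)) :=
      hS2.of_same (Exec.set M1 .p (.lit (M.arr .sib c))).same rfl rfl
    have hV3 : Visited f σ B (Q ++ [c]) (M1.setVar .p (M.arr .sib c)) := by
      obtain ⟨g1, g2, g3, g4, g5, g6, g7, g8, g9, g10⟩ := hV2
      exact ⟨g1, g2, g3, g4, g5, g6, g7, g8, g9, by simpa using g10⟩
    refine (ih (fun v hv => hl v (by simp [hv])) (List.nodup_cons.mp hl').2 hS3 hV3 (by simp [hu])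
      (fun v hv => ?_) (by simpa using hu2) (by simpa [hsib] using hp2)).mono ?_
    · have : v ≠ c := by
        rintro rfl
        exact (List.nodup_cons.mp hl').1 hv
      simp [hlQ v (by simp [hv]), this]
    · rintro M2 k2 - ⟨hk2, hV4⟩
      refine ⟨?_, by simpa using hV4⟩
      simp only [NExp.cost_get, NExp.cost_var]
      omega

theorem Visited.congr {Q : List (Fin G.n)} {M' : Mem} (h : Visited f σ B Q M)
    (ha : M'.arr = M.arr) (hr : M'.rvar = M.rvar) (hra : M'.rarr = M.rarr)
    (hv : M'.var .qt = M.var .qt) : Visited f σ B Q M' := by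
  obtain ⟨g1, g2, g3, g4, g5, g6, g7, g8, g9, g10⟩ := h
  constructor
  · exact g1
  · exact g2
  · rw [ha]; exact g3
  · rw [ha]; exact g4
  · exact g5
  · rw [ha]; exact g6
  · rw [hr]; exact g7
  · rw [hra]; exact g8
  · rw [ha]; exact g9
  · rw [hv]; exact g10

/-- The search visits exactly the nodes that can reach the destination. -/
theorem search_visited (hG : G.Reaching) (hσ : G.IsStrategy σ) (hB : Consistent σ B)
    {Ch : Fin G.n → List (Fin G.n)} (hCh : IsChildren σ B Ch)
    (hS : SearchReady G f b S L σ Ch M) (hF : ∀ v : Fin G.n, M.arr .isFront v = 0) :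
    Runs search M fun M' k => k ≤ 400 * (G.n + 1) ∧ ∃ Q, Visited f σ B Q M' ∧
      ∀ v, v ∈ Q ↔ G.dist B v ≠ ⊤ := by
  have hR := hS.ready
  have hnpos : 0 < G.n := G.da.pos
  have hda0 : lastFree σ G.da = none := by
    unfold lastFree
    rw [hG.chain_of_isEnd isEnd_da, lastIn_nil]
  unfold search
  simp only [block_cons_cons, block_singleton]
  rw [runs_seq, runs_rset, runs_seq, runs_put, runs_seq, runs_put, runs_seq]
  simp only [RExp.eval_zero, NExp.eval_var, NExp.eval_ofNat, Mem.var_setRVar, Mem.var_setArr, hR.da]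
  set M0 := ((M.setRVar .total 0).setArr .depth G.da 0).setArr .front G.da 0 with hM0
  have hS0 : SearchReady G f b S L σ Ch M0 :=
    hS.of_same (Exec.seq (Exec.rset M .total .zero) (Exec.seq (Exec.put _ .depth (.lit G.da) (.lit 0))
      (Exec.put _ .front (.lit G.da) (.lit 0)))).same rfl rfl
  have hfirst : Runs (.when (.eq Arr.entry⟦Var.da⟧ 1) (.rset .total (RVar.total + .get .f 0))) M0
      fun M' k => k ≤ 20 ∧ M'.arr = M0.arr ∧
        M'.rvar .total = if G.da ∈ G.entry then f 0 else 0 := by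
    have h1 : M0.var .da = G.da := hS0.ready.da
    have h2 := hS0.ready.entry G.da
    have h3 : M0.rarr .f 0 = f 0 := by simpa using hS0.ready.f 0 hnpos
    have h4 : M0.rvar .total = 0 := by simp [hM0]
    simp [h1, h2, h3, h4]
    exact ⟨fun h => by simp [h], fun h => by simp [h]⟩
  refine hfirst.mono ?_
  rintro M1 k1 hs1 ⟨hk1, ha1, ht1⟩
  have hS1 := hS0.of_same hs1 rfl rfl
  simp only [runs_seq, runs_put, runs_set, NExp.eval_ofNat, NExp.eval_var, hS1.ready.da]
  set M2 := ((M1.setArr .queue 0 G.da).setVar .qh 0).setVar .qt 1 with hM2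
  have hS2 : SearchReady G f b S L σ Ch M2 :=
    hS1.of_same (Exec.seq (Exec.put M1 .queue (.lit 0) (.lit G.da)) (Exec.seq (Exec.set _ .qh (.lit 0))
      (Exec.set _ .qt (.lit 1)))).same rfl rfl
  have hV2 : Visited f σ B [G.da] M2 := by
    constructor
    · simp
    · simp [dist_da]
    · simp [hM2, ha1, hM0, dist_da]
    · simp [hM2, ha1, hM0, hda0]
    · simp [hda0]
    · intro v
      rw [if_neg]
      · simpa [hM2, ha1, hM0] using hF v
      · rintro ⟨hv, e, he, -⟩
        rw [List.mem_singleton.mp hv, hda0] at he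
        simp at he
    · have := sum_filter_append (G := G) (Q := []) (c := G.da) (by simp) (fun _ => True)
        (fun v => f (G.dist B v))
      simp only [List.nil_append, List.not_mem_nil, and_true, Finset.filter_false,
        Finset.sum_empty, zero_add, dist_da] at this
      rw [this, hM2]
      simpa using ht1
    · intro e he hl
      rw [List.mem_singleton.mp he, hda0] at hl
      simp at hl
    · intro i hi
      have : i = 0 := by simpa using hi
      subst this
      simp [hM2]
    · simp [hM2]
  refine (Runs.while (fun M' K => ∃ Q, Visited f σ B Q M' ∧ M'.var .qh ≤ Q.length ∧ G.da ∈ Q ∧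
      (∀ (i : ℕ) (h : i < Q.length), i < M'.var .qh → ∀ w ∈ Ch Q[i], w ∈ Q) ∧
      (∀ w ∈ Q, w ≠ G.da → ∃ (i : ℕ) (h : i < Q.length), i < M'.var .qh ∧ w ∈ Ch Q[i]) ∧
      K = (G.n - M'.var .qh) * 50 + (G.n - Q.length) * 150) (K := G.n * 50 + (G.n - 1) * 150)
      ?_ ?_).mono ?_
  · exact ⟨[G.da], hV2, by simp [hM2], by simp, by simp [hM2], by simp, by simp [hM2]⟩
  · rintro M3 K hs3 ⟨Q, hV, hqh, hda, hdone, hpar, rfl⟩ hlt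
    simp only [Test.holds_lt, NExp.eval_var, hV.qt] at hlt
    have hQn : Q.length ≤ G.n := by simpa using hV.nodup.length_le_card
    set q := M3.var .qh with hq
    set u := Q[q] with hu
    have hS3 := hS2.of_same hs3 rfl rfl
    have huQ : u ∈ Q := List.getElem_mem _
    rw [runs_seq, runs_set, runs_seq, runs_set, runs_seq, runs_set]
    simp only [NExp.eval_get, NExp.eval_var, NExp.eval_add, NExp.eval_ofNat, ← hq, hV.queue q hlt,
      ← hu, Mem.var_setVar, Mem.arr_setVar, reduceCtorEq, if_false, if_true]
    set M4 := ((M3.setVar .u u).setVar .qh (q + 1)).setVar .p (M3.arr .child u) with hM4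
    have hS4 : SearchReady G f b S L σ Ch M4 :=
      hS3.of_same (Exec.seq (Exec.set M3 .u (.lit u)) (Exec.seq (Exec.set _ .qh (.lit (q + 1)))
        (Exec.set _ .p (.lit (M3.arr .child u))))).same rfl rfl
    have hV4 : Visited f σ B Q M4 := hV.congr rfl rfl rfl (by simp [hM4])
    -- The only parent of a child of `u` is `u`, which has not been treated before.
    have hnew : ∀ v ∈ Ch u, v ∉ Q := by
      intro v hv hvQ
      obtain ⟨e, he, heB, rfl, heu⟩ := (hCh.mem u v).mp hv
      obtain ⟨i, hi, hiq, hvi⟩ := hpar _ hvQ (hσ.tail_ne_da he)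
      obtain ⟨e', he', -, ht, heu'⟩ := (hCh.mem _ _).mp hvi
      obtain rfl := IsStrategy.kept_unique he' he ht
      have h1 : Q[i] = Q[q] := by rw [← heu', heu]
      have := (List.Nodup.getElem_inj_iff hV.nodup).mp h1
      omega
    refine (searchChildren_spec hG hσ hB hCh (Ch u) (fun v hv => hv) (hCh.nodup u) hS4 hV4 huQ
      hnew (by simp [hM4]) (by simpa [hM4] using hS3.child u)).mono ?_
    rintro M5 k5 hs5 ⟨hk5, hV5⟩
    have hqh5 : M5.var .qh = q + 1 := by
      rw [hs5.var _ rfl]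
      simp [hM4]
    have hQn5 : (Q ++ Ch u).length ≤ G.n := by simpa using hV5.nodup.length_le_card
    rw [List.length_append] at hQn5
    refine ⟨_, ⟨Q ++ Ch u, hV5, ?_, by simp [hda], ?_, ?_, rfl⟩, ?_⟩
    · rw [hqh5, List.length_append]
      omega
    · intro i hi hiq w hw
      rw [hqh5] at hiq
      rw [List.getElem_append_left (by omega)] at hw
      by_cases hiq' : i = q
      · subst hiq'
        exact List.mem_append_right _ hw
      · exact List.mem_append_left _ (hdone i (by omega) (by omega) w hw)
    · intro w hw hne
      rcases List.mem_append.mp hw with hw | hw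
      · obtain ⟨i, hi, hiq, h⟩ := hpar w hw hne
        refine ⟨i, by rw [List.length_append]; omega, by omega, ?_⟩
        rwa [List.getElem_append_left hi]
      · refine ⟨q, by rw [List.length_append]; omega, by omega, ?_⟩
        rwa [List.getElem_append_left hlt]
    · rw [hqh5, List.length_append]
      simp only [NExp.cost_get, NExp.cost_var, NExp.cost_add, NExp.cost_ofNat, Test.cost_lt]
      omega
  · rintro M3 k3 - ⟨⟨_, Q, hV, hqh, hda, hdone, -, -⟩, hlt, hk3⟩
    simp only [Test.holds_lt, NExp.eval_var, hV.qt, not_lt] at hlt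
    refine ⟨?_, Q, hV, fun v => ⟨hV.reach v, fun hd => ?_⟩⟩
    · simp only [RExp.cost_zero, NExp.cost_var, NExp.cost_ofNat, Test.cost_lt] at hk3 ⊢
      omega
    · obtain ⟨k, hk⟩ := ENat.ne_top_iff_exists.mp hd
      induction k generalizing v with
      | zero =>
        by_cases hv : v = G.da
        · rwa [hv]
        · obtain ⟨e, he, heB, rfl⟩ := hB.exists_kept hG hσ hv hd
          rw [hB.dist_tail hG hσ he heB] at hk
          exact absurd hk.symm (by simp)
      | succ k ih =>
        by_cases hv : v = G.da
        · rwa [hv]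
        · obtain ⟨e, he, heB, rfl⟩ := hB.exists_kept hG hσ hv hd
          rw [hB.dist_tail hG hσ he heB] at hk
          have hk' : (k : ℕ∞) = G.dist B (G.head e) := by
            push_cast at hk
            exact WithTop.add_right_cancel ENat.one_ne_top hk
          have hh := ih (G.head e) (by rw [← hk']; exact ENat.natCast_ne_top _) hk'
          obtain ⟨i, hi, hiu⟩ := List.getElem_of_mem hh
          exact hdone i hi (by omega) _ ((hCh.mem _ _).mpr ⟨e, he, heB, rfl, hiu.symm⟩)

/-- The frontier edges in `F` are offered for blocking, with their gains as benefits. -/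
structure Offered (f : ℕ∞ → ℝ) (σ : Fin G.n → Option (Fin G.m)) (F : Finset (Fin G.m))
    (M : Mem) : Prop where
  isFront : ∀ v : Fin G.n, M.arr .isFront v = 1 ↔ ∃ e ∈ F, G.tail e = v
  ben : ∀ e ∈ F, M.rarr .ben (G.tail e) = gain f σ e

theorem search_spec (hG : G.Reaching) (hσ : G.IsStrategy σ) (hB : Consistent σ B)
    (hT : ∀ e ∈ B, Terminal σ e) (hf0 : f ⊤ = 0)
    {Ch : Fin G.n → List (Fin G.n)} (hCh : IsChildren σ B Ch)
    (hS : SearchReady G f b S L σ Ch M) (hF : ∀ v : Fin G.n, M.arr .isFront v = 0) :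
    Runs search M fun M' k => k ≤ 400 * (G.n + 1) ∧ M'.rvar .total = G.totalRate f B ∧
      ∃ F : Finset (Fin G.m), (∀ e, e ∈ F ↔ Frontier σ B e) ∧ Offered f σ F M' := by
  classical
  refine (search_visited hG hσ hB hCh hS hF).mono ?_
  rintro M' k - ⟨hk, Q, hV, hQ⟩
  have hreach : ∀ v e, lastFree σ v = some e → e ∉ B → ∀ e' ∈ G.chain v, e' ∉ B := by
    intro v e he heB e' he' he'B
    obtain ⟨e'', h1, h2⟩ := (hG.exists_mem_chain hT v).mp ⟨e', he', he'B⟩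
    rw [lastFree] at he
    rw [he] at h2
    exact heB (Option.some.inj h2 ▸ h1)
  have hself : ∀ e, ¬ G.IsEnd (G.tail e) → (lastFree σ (G.tail e) = some e ↔ Terminal σ e) := by
    intro e he
    rw [lastFree, hG.chain_tail he, Terminal]
  have hfrontier : ∀ e, Frontier σ B e ↔
      G.tail e ∈ Q ∧ lastFree σ (G.tail e) = some e := by
    intro e
    rw [hQ, hB.dist_ne_top hG hσ]
    constructor
    · rintro ⟨h1, h2, h3, h4⟩
      have h5 := (hself e h1).mpr h2
      exact ⟨⟨hreach _ e h5 h3, h4⟩, h5⟩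
    · rintro ⟨⟨h1, h2⟩, h3⟩
      have h4 := (mem_of_lastIn h3).1
      have h5 := hG.not_isEnd_tail h4
      exact ⟨h5, (hself e h5).mp h3, h1 e h4, h2⟩
  refine ⟨hk, ?_, Finset.univ.filter fun e => Frontier σ B e, by simp, ?_, ?_⟩
  · rw [hV.total, totalRate, Finset.sum_filter]
    refine Finset.sum_congr rfl fun v _ => ?_
    split_ifs with hv
    · rfl
    · rw [hQ, not_not] at hv
      rw [hv, hf0]
  · intro v
    rw [hV.isFront]
    simp only [ite_eq_left_iff, zero_ne_one, imp_false, not_not, Finset.mem_filter,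
      Finset.mem_univ, true_and, hfrontier]
    constructor
    · rintro ⟨h1, e, h2, rfl⟩
      exact ⟨e, ⟨h1, h2⟩, rfl⟩
    · rintro ⟨e, ⟨h1, h2⟩, rfl⟩
      exact ⟨h1, e, h2, rfl⟩
  · intro e he
    have he' := (Finset.mem_filter.mp he).2
    obtain ⟨h1, h2⟩ := (hfrontier e).mp he'
    rw [hV.ben e h1 h2, gain, Finset.sum_filter, Finset.sum_filter]
    refine Finset.sum_congr rfl fun v _ => ?_
    by_cases hl : lastFree σ v = some e
    · have hl' : lastIn (free σ) (G.chain v) = some e := hl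
      rw [if_pos hl']
      have h3 := hreach v e hl he'.2.2.1
      by_cases hv : v ∈ Q
      · rw [if_pos ⟨hv, hl⟩, hB.dist_eq_stratDist hG hσ ((hQ v).mp hv)]
      · rw [if_neg fun h => hv h.1]
        rw [hQ, hB.dist_ne_top hG hσ, not_and, not_not] at hv
        rw [hv h3, hf0]
    · have hl' : ¬ lastIn (free σ) (G.chain v) = some e := hl
      rw [if_neg hl', if_neg fun h => hl h.2]

end SplitFPT

/-! ### Spending the remaining budget -/

namespace SplitFPT

open AttackGraph

variable {G : AttackGraph} {f : ℕ∞ → ℝ} {b : ℕ} {S : List (Fin G.n)}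
  {L : Fin G.n → List (Fin G.m)} {M : Mem} {σ : Fin G.n → Option (Fin G.m)}
  {B : Finset (Fin G.m)}

/-- The loop of `greedy` that finds a most beneficial frontier edge. -/
theorem select_spec (hR : Ready G f b S L M) (hw : M.var .w = 0) :
    Runs (.forTo .v Var.n
      (.when (.and (.eq Arr.isFront⟦Var.v⟧ 1)
          (.or (.eq Var.w 0) (.rlt (.get .ben (Var.w - 1)) (.get .ben Var.v))))
        (.set .w (Var.v + 1)))) M fun M' k => k ≤ 50 * (G.n + 1) ∧
      ((M'.var .w = 0 ∧ ∀ v : Fin G.n, M.arr .isFront v ≠ 1) ∨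
        ∃ v : Fin G.n, M'.var .w = v + 1 ∧ M.arr .isFront v = 1 ∧
          ∀ v' : Fin G.n, M.arr .isFront v' = 1 → M.rarr .ben v' ≤ M.rarr .ben v) := by
  refine (Runs.forTo_const (fun i M' => (M'.var .w = 0 ∧ ∀ j < i, M.arr .isFront j ≠ 1) ∨
    ∃ v < i, M'.var .w = v + 1 ∧ M.arr .isFront v = 1 ∧
      ∀ j < i, M.arr .isFront j = 1 → M.rarr .ben j ≤ M.rarr .ben v) 40 rfl rfl ?_ ?_).mono ?_
  · simp [hw]
  · intro i M' hi hx hs hI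
    have h1 : M'.arr .isFront = M.arr .isFront := hs.arr _ rfl
    have h2 : M'.rarr .ben = M.rarr .ben := hs.rarr _ rfl
    simp only [runs_when, runs_set, Test.holds_and, Test.holds_eq, Test.holds_or, Test.holds_rlt,
      NExp.eval_get, NExp.eval_var, NExp.eval_add, NExp.eval_sub, NExp.eval_ofNat, RExp.eval_get,
      hx, h1, h2]
    refine ⟨fun ⟨h3, h4⟩ => ⟨by simp, Or.inr ⟨i, by omega, by simp, h3, ?_⟩⟩,
      fun h3 => ⟨by simp, ?_⟩⟩
    · intro j hj hj1
      by_cases hji : j = i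
      · rw [hji]
      · rcases hI with ⟨-, hI⟩ | ⟨v, hv, hwv, -, hI⟩
        · exact absurd hj1 (hI j (by omega))
        · rw [hwv, Nat.add_sub_cancel] at h4
          rcases h4 with h4 | h4
          · omega
          · exact (hI j (by omega) hj1).trans h4.le
    · rcases hI with ⟨hw0, hI⟩ | ⟨v, hv, hwv, hv1, hI⟩
      · refine Or.inl ⟨by simpa using hw0, fun j hj => ?_⟩
        by_cases hji : j = i
        · exact fun h => h3 ⟨hji ▸ h, Or.inl hw0⟩
        · exact hI j (by omega)
      · refine Or.inr ⟨v, by omega, by simpa using hwv, hv1, fun j hj hj1 => ?_⟩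
        by_cases hji : j = i
        · by_contra hlt
          rw [not_le] at hlt
          exact h3 ⟨hji ▸ hj1, Or.inr (by rw [hwv, Nat.add_sub_cancel, ← hji]; exact hlt)⟩
        · exact hI j (by omega) hj1
  · rintro M' k - ⟨hI, hk⟩
    rw [hR.n] at hI hk
    refine ⟨by omega, ?_⟩
    rcases hI with ⟨hw0, hI⟩ | ⟨v, hv, hwv, hv1, hI⟩
    · exact Or.inl ⟨hw0, fun v => hI v v.isLt⟩
    · exact Or.inr ⟨⟨v, hv⟩, hwv, hv1, fun v' => hI v' v'.isLt⟩

/-- Adding a most valuable remaining element to a most valuable set with at most `k` elements gives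
a most valuable set with at most `k + 1` elements. -/
theorem sum_le_sum_insert {α : Type*} [DecidableEq α] {F X : Finset α} {g : α → ℝ} {k : ℕ} {a : α}
    (ha : a ∈ F \ X) (ha0 : 0 ≤ g a) (hmax : ∀ y ∈ F \ X, g y ≤ g a)
    (hX : ∀ Y ⊆ F, Y.card ≤ k → ∑ y ∈ Y, g y ≤ ∑ x ∈ X, g x) (hg : ∀ x ∈ X, 0 ≤ g x)
    {Y : Finset α} (hY : Y ⊆ F) (hk : Y.card ≤ k + 1) :
    ∑ y ∈ Y, g y ≤ ∑ x ∈ insert a X, g x := by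
  rw [Finset.sum_insert (Finset.mem_sdiff.mp ha).2]
  by_cases hYX : Y ⊆ X
  · have := Finset.sum_le_sum_of_subset_of_nonneg hYX fun x hx _ => hg x hx
    linarith
  · obtain ⟨y, hy, hyX⟩ := Finset.not_subset.mp hYX
    rw [← Finset.add_sum_erase Y g hy]
    refine add_le_add (hmax y (Finset.mem_sdiff.mpr ⟨hY hy, hyX⟩))
      (hX _ ((Finset.erase_subset _ _).trans hY) ?_)
    rw [Finset.card_erase_of_mem hy]
    omega

theorem greedy_spec (hR : Ready G f b S L M) (hU : HoldsUp σ M) (hB : HoldsBlocked B M)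
    {F : Finset (Fin G.m)} (hF : ∀ e ∈ F, Frontier σ B e) (hO : Offered f σ F M)
    (hf : Antitone f) (hf0 : f ⊤ = 0) (hused : M.var .used ≤ b) :
    Runs greedy M fun M' k => k ≤ 150 * (b * (G.n + 1) + 1) ∧ ∃ X ⊆ F,
      X.card ≤ b - M.var .used ∧ HoldsBlocked (B ∪ X) M' ∧
      M'.rvar .total = M.rvar .total - ∑ e ∈ X, gain f σ e ∧
      ∀ Y ⊆ F, Y.card ≤ b - M.var .used → ∑ e ∈ Y, gain f σ e ≤ ∑ e ∈ X, gain f σ e := by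
  classical
  have hg : ∀ e, 0 ≤ gain f σ e := gain_nonneg hf hf0
  unfold greedy
  simp only [block_cons_cons, block_singleton]
  rw [runs_seq, runs_set]
  simp only [NExp.eval_var]
  set u := M.var .used with hu
  have hR0 : Ready G f b S L (M.setVar .r u) :=
    hR.of_same (Exec.set M .r (.lit u)).same rfl
  refine (Runs.while (fun M' K => ∃ X ⊆ F, u ≤ M'.var .r ∧ M'.var .r ≤ b ∧
      X.card ≤ M'.var .r - u ∧ HoldsBlocked (B ∪ X) M' ∧ Offered f σ (F \ X) M' ∧
      M'.rvar .total = M.rvar .total - ∑ e ∈ X, gain f σ e ∧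
      (∀ Y ⊆ F, Y.card ≤ M'.var .r - u → ∑ e ∈ Y, gain f σ e ≤ ∑ e ∈ X, gain f σ e) ∧
      K = (b - M'.var .r) * (140 * (G.n + 1))) (K := (b - u) * (140 * (G.n + 1))) ?_ ?_).mono ?_
  · refine ⟨∅, by simp, by simp, by simpa using hused, by simp,
      by simpa [HoldsBlocked] using hB, ?_, by simp, ?_,
      by simp⟩
    · simpa using ⟨by simpa using hO.isFront, by simpa using hO.ben⟩
    · intro Y hY hY0
      have : Y = ∅ := by simpa using hY0
      simp [this]
  · rintro M1 K hs1 ⟨X, hXF, hur, hrb, hXc, hB1, hO1, ht1, hX, rfl⟩ hlt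
    have hR1 := hR0.of_same hs1 rfl
    have hU1 : HoldsUp σ M1 := by
      have h : M1.arr .up = M.arr .up := hs1.arr _ rfl
      simpa only [HoldsUp, h] using hU
    simp only [Test.holds_lt, NExp.eval_var, hR1.b] at hlt
    rw [runs_seq, runs_set, runs_seq]
    have hR2 : Ready G f b S L (M1.setVar .w 0) :=
      hR1.of_same (Exec.set M1 .w (.lit 0)).same rfl
    refine (select_spec hR2 (by simp)).mono ?_
    rintro M2 k2 hs2 ⟨hk2, hsel⟩
    have a2 : M2.arr = M1.arr := by
      funext a
      rw [hs2.arr a (by cases a <;> rfl)]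
      rfl
    have b2 : M2.rarr = M1.rarr := by
      funext a
      rw [hs2.rarr a (by cases a <;> rfl)]
      rfl
    have t2 : M2.rvar = M1.rvar := by
      funext a
      rw [hs2.rvar a (by cases a <;> rfl)]
      rfl
    have r2 : M2.var .r = M1.var .r := by
      rw [hs2.var _ rfl]
      simp
    simp only [Mem.arr_setVar, Mem.rarr_setVar] at hsel
    have hstep : (b - (M1.var .r + 1)) * (140 * (G.n + 1)) + 140 * (G.n + 1) =
        (b - M1.var .r) * (140 * (G.n + 1)) := by
      rw [← Nat.succ_mul]
      congr 1
      omega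
    rcases hsel with ⟨hw, hno⟩ | ⟨v, hw, hv1, hmax⟩
    -- No frontier edge is left, so `X` contains all of `F`.
    · simp only [runs_seq, runs_when, Test.holds_ne, NExp.eval_var, NExp.eval_ofNat, hw, ne_eq,
        not_true, false_imp_iff, not_false_eq_true, true_imp_iff, true_and, runs_set, NExp.eval_add,
        r2]
      have hempty : F \ X = ∅ := by
        rw [Finset.eq_empty_iff_forall_notMem]
        intro e he
        exact hno _ ((hO1.isFront (G.tail e)).mpr ⟨e, he, rfl⟩)
      refine ⟨_, ⟨X, hXF, by simp; omega, by simp; omega, by simp; omega, ?_, ?_, ?_, ?_, rfl⟩, ?_⟩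
      · simpa only [HoldsBlocked, Mem.arr_setVar, a2] using hB1
      · exact ⟨by simpa only [Mem.arr_setVar, a2] using hO1.isFront,
          by simpa only [Mem.rarr_setVar, b2] using hO1.ben⟩
      · simpa only [Mem.rvar_setVar, t2] using ht1
      · intro Y hY _
        refine Finset.sum_le_sum_of_subset_of_nonneg ?_ fun e _ _ => hg e
        exact hY.trans (Finset.sdiff_eq_empty_iff_subset.mp hempty)
      · simp
        omega
    · obtain ⟨e, he, rfl⟩ := (hO1.isFront v).mp hv1
      obtain ⟨heF, heX⟩ := Finset.mem_sdiff.mp he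
      have hend := (hF e heF).1
      have hup : M2.arr .up (G.tail e) = e + 1 := by
        rw [a2]
        exact hU1.eq_add_one (Or.inl hend)
      have hben : M2.rarr .ben (G.tail e) = gain f σ e := by rw [b2, hO1.ben e he]
      simp only [runs_seq, runs_when, Test.holds_ne, NExp.eval_var, NExp.eval_ofNat, hw, ne_eq,
        Nat.add_eq_zero_iff, one_ne_zero, and_false, not_true, false_imp_iff, not_false_eq_true,
        true_imp_iff, and_true, runs_set, NExp.eval_add, NExp.eval_sub, Nat.add_sub_cancel,
        runs_put, NExp.eval_get, Mem.var_setArr, Mem.arr_setArr, reduceCtorEq, if_false, hup,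
        runs_rset, RExp.eval_sub, RExp.eval_var, RExp.eval_get, Mem.rvar_setArr, Mem.rarr_setArr,
        hben, Mem.var_setRVar, r2]
      refine ⟨_, ⟨insert e X, Finset.insert_subset heF hXF, by simp; omega, by simp; omega, ?_, ?_,
        ?_, ?_, ?_, rfl⟩, ?_⟩
      · rw [Finset.card_insert_of_notMem heX]
        simp
        omega
      · intro e'
        simp only [Mem.arr_setVar, Mem.arr_setRVar, Mem.arr_setArr, if_true, reduceCtorEq, if_false,
          a2, Function.update_apply, Fin.val_inj, hB1 e', Finset.mem_union, Finset.mem_insert]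
        by_cases h : e' = e <;> simp [h]
      · constructor
        · intro v
          simp only [Mem.arr_setVar, Mem.arr_setRVar, Mem.arr_setArr, if_true, reduceCtorEq,
            if_false, a2, Function.update_apply, Fin.val_inj]
          split_ifs with h
          · simp only [Finset.mem_sdiff, Finset.mem_insert, false_iff]
            rintro ⟨e', ⟨-, h'⟩, rfl⟩
            exact h' (Or.inl (edge_unique hend h rfl))
          · rw [hO1.isFront]
            constructor
            · rintro ⟨e', h', rfl⟩
              refine ⟨e', ?_, rfl⟩
              simp only [Finset.mem_sdiff, Finset.mem_insert, not_or] at h' ⊢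
              exact ⟨h'.1, fun h'' => h (h'' ▸ rfl), h'.2⟩
            · rintro ⟨e', h', rfl⟩
              refine ⟨e', ?_, rfl⟩
              simp only [Finset.mem_sdiff, Finset.mem_insert, not_or] at h' ⊢
              exact ⟨h'.1, h'.2.2⟩
        · intro e' he'
          simp only [Mem.rarr_setVar, Mem.rarr_setRVar, Mem.rarr_setArr, b2]
          refine hO1.ben e' ?_
          simp only [Finset.mem_sdiff, Finset.mem_insert, not_or] at he' ⊢
          exact ⟨he'.1, he'.2.2⟩
      · rw [Finset.sum_insert heX]
        simp only [Mem.rvar_setVar, Mem.rvar_setRVar, if_true, t2, ht1]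
        ring
      · intro Y hY hYc
        refine sum_le_sum_insert (k := M1.var .r - u) he (hg e) ?_ hX (fun x _ => hg x) hY ?_
        · intro y hy
          have := hmax _ ((hO1.isFront (G.tail y)).mpr ⟨y, hy, rfl⟩)
          rwa [hO1.ben y hy, hO1.ben e he] at this
        · simp at hYc
          omega
      · simp
        omega
  · rintro M1 k1 hs1 ⟨⟨_, X, hXF, hur, hrb, hXc, hB1, -, ht1, hX, -⟩, hlt, hk1⟩
    have hb1 : M1.var .b = b := (hs1.var _ rfl).trans hR0.b
    simp only [Test.holds_lt, NExp.eval_var, hb1, not_lt] at hlt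
    have hrb' : M1.var .r = b := by omega
    rw [hrb'] at hXc hX
    refine ⟨?_, X, hXF, hXc, hB1, ht1, hX⟩
    have h1 : (b - u) * (140 * (G.n + 1)) ≤ b * (140 * (G.n + 1)) :=
      Nat.mul_le_mul_right _ (Nat.sub_le _ _)
    have h2 : b * (140 * (G.n + 1)) = 140 * (b * (G.n + 1)) := by ring
    simp only [NExp.cost_var, Test.cost_lt] at hk1 ⊢
    omega

end SplitFPT

/-! ### Treating a strategy -/

namespace SplitFPT

open AttackGraph

variable {G : AttackGraph} {f : ℕ∞ → ℝ} {b : ℕ} {S : List (Fin G.n)}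
  {L : Fin G.n → List (Fin G.m)} {M : Mem} {σ : Fin G.n → Option (Fin G.m)}
  {B : Finset (Fin G.m)}

/-- If a defence has been found, then the memory holds it together with its value. -/
def HoldsBest (G : AttackGraph) (f : ℕ∞ → ℝ) (b : ℕ) (M : Mem) : Prop :=
  M.var .found = 0 ∨ M.var .found = 1 ∧ G.Feasible b (output G M) ∧
    M.rvar .best = G.totalRate f (output G M)

/-- A defence has been found, and its value is at most `x`. -/
def Found (x : ℝ) (M : Mem) : Prop := M.var .found = 1 ∧ M.rvar .best ≤ x

theorem record_spec (hR : Ready G f b S L M) (hB : HoldsBlocked B M) (hfeas : G.Feasible b B)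
    (ht : M.rvar .total = G.totalRate f B) (hM : HoldsBest G f b M) :
    Runs record M fun M' k => k ≤ 40 * (G.m + 1) ∧ HoldsBest G f b M' ∧
      Found (G.totalRate f B) M' ∧ ∀ x, Found x M → Found x M' := by
  simp only [record, runs_when, Test.holds_or, Test.holds_eq, Test.holds_rlt, NExp.eval_var,
    NExp.eval_ofNat, RExp.eval_var, block_cons_cons, block_singleton, runs_seq, runs_set, runs_rset]
  refine ⟨fun h => ?_, fun h => ?_⟩
  · refine (Runs.forTo_const (fun i M' => ∀ j < i, M'.arr .out j = M.arr .blocked j) 20 rfl rfl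
      (by simp) ?_).mono ?_
    · intro i M' hi hx hs hI
      have hb : M'.arr .blocked = M.arr .blocked := by rw [hs.arr _ rfl]; simp
      simp [hx, Function.update_apply, hb]
      grind
    · rintro M' k hs ⟨hI, hk⟩
      simp only [Mem.var_setRVar, Mem.var_setVar, reduceCtorEq, if_false, hR.m] at hI hk
      have hout : output G M' = B := by
        ext e
        simp only [output, Finset.mem_filter, Finset.mem_univ, true_and, hI e e.isLt, hB e]
        simp
      have hfound : M'.var .found = 1 := by rw [hs.var _ rfl]; simp
      have hbest : M'.rvar .best = G.totalRate f B := by rw [hs.rvar _ rfl]; simpa using ht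
      refine ⟨?_, Or.inr ⟨hfound, hout ▸ hfeas, hout ▸ hbest⟩, ⟨hfound, hbest.le⟩, fun x hx => ?_⟩
      · simp
        omega
      · refine ⟨hfound, ?_⟩
        rcases h with h | h
        · rw [hx.1] at h
          omega
        · rw [hbest, ← ht]
          exact h.le.trans hx.2
  · rw [not_or, not_lt] at h
    refine ⟨by simp; omega, hM, ⟨?_, ht ▸ h.2⟩, fun x hx => hx⟩
    exact (hM.resolve_left h.1).1

theorem ForceInv.consistent {M : Mem} (h : ForceInv σ (fun _ => True) B M)
    (hv : M.var .valid = 1) : Consistent σ B :=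
  ⟨fun e he => (AttackGraph.mem_free.mp (h.free e he)).2, fun r hr => h.hit hv r trivial hr⟩

theorem ForceInv.terminal {M : Mem} {R : Fin G.m → Prop} (hG : G.Reaching)
    (h : ForceInv σ R B M) : ∀ e ∈ B, Terminal σ e := fun e he =>
  let ⟨_, _, hr⟩ := h.origin e he
  hG.terminal_of_lastIn hr

/-- If a feasible defence makes the attacker follow `σ`, then `forceBlocks` finds `σ` valid. -/
theorem ForceInv.valid_of_consistent {M : Mem} {R : Fin G.m → Prop} (h : ForceInv σ R B M)
    {B' : Finset (Fin G.m)} (hB' : Consistent σ B') (hBb : B' ⊆ G.blockable) :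
    M.var .valid = 1 := by
  refine h.valid.resolve_left fun h0 => ?_
  obtain ⟨r, hr, hl⟩ := h.invalid h0
  obtain ⟨e, he, heB⟩ := hB'.2 r hr
  exact lastIn_eq_none.mp hl e he (AttackGraph.mem_free.mpr ⟨hBb heB, hB'.1 e heB⟩)

/-- Blocking frontier edges in addition to a consistent defence. -/
theorem totalRate_union (hG : G.Reaching) (hσ : G.IsStrategy σ) (hB : Consistent σ B)
    (hT : ∀ e ∈ B, Terminal σ e) (hf0 : f ⊤ = 0) {X : Finset (Fin G.m)}
    (hX : ∀ e ∈ X, Frontier σ B e) :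
    G.totalRate f (B ∪ X) = G.totalRate f B - ∑ e ∈ X, gain f σ e := by
  classical
  have hT' : ∀ e ∈ B ∪ X, Terminal σ e := by
    intro e he
    exact (Finset.mem_union.mp he).elim (hT e) fun h => (hX e h).2.1
  have hB' : Consistent σ (B ∪ X) := by
    refine ⟨fun e he => (AttackGraph.mem_free.mp (hT' e he).mem_free).2, fun r hr => ?_⟩
    obtain ⟨e, h1, h2⟩ := hB.2 r hr
    exact ⟨e, h1, Finset.mem_union_left _ h2⟩
  rw [hB'.totalRate_eq hG hσ hT' hf0, hB.totalRate_eq hG hσ hT hf0, Finset.sum_union]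
  · ring
  · rw [Finset.disjoint_left]
    exact fun e he he' => (hX e he').2.2.1 he

/-- A consistent defence is not better than the best extension of `B` by frontier edges. -/
theorem totalRate_le_of_consistent (hG : G.Reaching) (hσ : G.IsStrategy σ) (hB : Consistent σ B)
    (hT : ∀ e ∈ B, Terminal σ e)
    (horigin : ∀ e ∈ B, ∃ r, Forced σ r ∧ lastIn (AttackGraph.free σ) (G.route r) = some e)
    (hf : Antitone f) (hf0 : f ⊤ = 0) {B' : Finset (Fin G.m)} (hB' : Consistent σ B')
    (hfeas : G.Feasible b B') :
    B.card ≤ b ∧ ∀ X : Finset (Fin G.m), (∀ Y : Finset (Fin G.m), (∀ e ∈ Y, Frontier σ B e) →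
      Y.card ≤ b - B.card → ∑ e ∈ Y, gain f σ e ≤ ∑ e ∈ X, gain f σ e) →
        G.totalRate f B - ∑ e ∈ X, gain f σ e ≤ G.totalRate f B' := by
  classical
  obtain ⟨A, hA1, hA2, hA3, hA4⟩ := hB'.exists_terminal hG hσ hfeas.1 hf hf0
  have hBA : B ⊆ A := fun e he => by
    obtain ⟨r, hr, hl⟩ := horigin e he
    exact hA3 r e hr hl
  have hAb : A.card ≤ b := hA1.trans hfeas.2
  refine ⟨(Finset.card_le_card hBA).trans hAb, fun X hX => ?_⟩
  have h1 := hX ((A \ B).filter fun e => Frontier σ B e)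
    (fun e he => (Finset.mem_filter.mp he).2) ?_
  · have h2 : ∑ e ∈ A \ B, gain f σ e =
        ∑ e ∈ (A \ B).filter fun e => Frontier σ B e, gain f σ e := by
      rw [Finset.sum_filter]
      refine Finset.sum_congr rfl fun e he => ?_
      split_ifs with h
      · rfl
      · exact gain_eq_zero hG hσ hf0 (Finset.mem_sdiff.mp he).2 h
    have h3 := Finset.sum_sdiff hBA (f := gain f σ)
    rw [hB.totalRate_eq hG hσ hT hf0]
    linarith
  · refine (Finset.card_filter_le _ _).trans ?_
    rw [Finset.card_sdiff_of_subset hBA]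
    omega

/-- A bound for the number of steps that a strategy takes, up to a constant factor. -/
noncomputable def stepBound (G : AttackGraph) (b : ℕ) : ℕ :=
  G.feedback ^ 2 + G.feedback * G.maxPathLength + b * G.n

theorem m_add_n_le (G : AttackGraph) {b : ℕ} (hb : 1 ≤ b) :
    G.m + G.n + 1 ≤ 3 * stepBound G b ∧ G.feedback ≤ stepBound G b ∧ b * G.n ≤ stepBound G b ∧
      G.feedback ^ 2 ≤ stepBound G b ∧ G.feedback * G.maxPathLength ≤ stepBound G b := by
  have h1 := G.m_le
  have h2 : G.n ≤ b * G.n := Nat.le_mul_of_pos_left _ hb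
  have h3 : G.feedback ≤ G.feedback ^ 2 := Nat.le_self_pow (by norm_num) _
  have h4 : 0 < G.n := G.da.pos
  unfold stepBound
  omega

theorem tryStrategy_spec (hG : G.Reaching) (hσ : G.IsStrategy σ) (hL : IsListing G S L)
    (hR : Ready G f b S L M) (hC : HoldsStrategy S σ M) (hM : HoldsBest G f b M)
    (hf : Antitone f) (hf0 : f ⊤ = 0) (hb : 1 ≤ b) :
    Runs tryStrategy M fun M' k => k ≤ 10000 * stepBound G b ∧ HoldsBest G f b M' ∧
      (∀ x, Found x M → Found x M') ∧
      ∀ B', G.Feasible b B' → G.response B' = σ → Found (G.totalRate f B') M' := by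
  obtain ⟨n1, n2, n3, n4, n5⟩ := m_add_n_le G hb
  have n6 := hL.length_S_le hG
  simp only [tryStrategy]
  rw [block_cons_cons, runs_seq]
  refine (reset_spec hR).mono ?_
  rintro M1 k1 hs1 ⟨hk1, hz, hd⟩
  have hR1 := hR.of_same hs1 rfl
  have hC1 : HoldsStrategy S σ M1 := by simpa only [HoldsStrategy, hs1.arr .cur rfl] using hC
  rw [block_cons_cons, runs_seq]
  refine (markTaken_spec hG hσ hL hR1 hC1 fun e => (hz e).1).mono ?_
  rintro M2 k2 hs2 ⟨hk2, hmark, hroute⟩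
  have hR2 := hR1.of_same hs2 rfl
  have hC2 : HoldsStrategy S σ M2 := by simpa only [HoldsStrategy, hs2.arr .cur rfl] using hC1
  rw [block_cons_cons, runs_seq]
  refine (distances_spec hG hσ hL hR2 hC2 hroute fun v => ?_).mono ?_
  · rw [hs2.arr _ rfl]
    exact hd v
  rintro M3 k3 hs3 ⟨hk3, hdist⟩
  have hF3 : ForceReady G f b S L σ M3 := by
    refine ⟨hR2.of_same hs3 rfl, ?_, ?_, hdist⟩
    · simpa only [HoldsStrategy, hs3.arr .cur rfl] using hC2
    · simpa only [HoldsMark, hs3.arr .mark rfl] using hmark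
  rw [block_cons_cons, runs_seq]
  refine (forceBlocks_spec hG hL hF3 fun e => ?_).mono ?_
  · rw [hs3.arr _ rfl, hs2.arr _ rfl]
    exact (hz e).2
  rintro M4 k4 hs4 ⟨hk4, B, hI⟩
  have hF4 := hF3.of_same hs4 rfl rfl
  have hR4 := hF4.ready
  have hfound : M4.var .found = M.var .found := by
    rw [hs4.var _ rfl, hs3.var _ rfl, hs2.var _ rfl, hs1.var _ rfl]
  have hbest : M4.rvar .best = M.rvar .best := by
    rw [hs4.rvar _ rfl, hs3.rvar _ rfl, hs2.rvar _ rfl, hs1.rvar _ rfl]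
  have hout : M4.arr .out = M.arr .out := by
    rw [hs4.arr _ rfl, hs3.arr _ rfl, hs2.arr _ rfl, hs1.arr _ rfl]
  have hM4 : HoldsBest G f b M4 := by
    simpa only [HoldsBest, output, hfound, hbest, hout] using hM
  have hmono : ∀ x, Found x M → Found x M4 := by
    intro x hx
    simpa only [Found, hfound, hbest] using hx
  have hcost : k1 + k2 + k3 + k4 ≤ 3000 * stepBound G b := by
    have c1 : S.length * (100 * (G.maxPathLength + 1)) ≤ 200 * stepBound G b := by
      have h1 : S.length * (100 * (G.maxPathLength + 1)) ≤
          G.feedback * (100 * (G.maxPathLength + 1)) := Nat.mul_le_mul_right _ n6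
      have h2 : G.feedback * (100 * (G.maxPathLength + 1)) =
          100 * (G.feedback * G.maxPathLength) + 100 * G.feedback := by ring
      omega
    have c2 : S.length * (S.length * 60 + 20) ≤ 80 * stepBound G b := by
      have h1 : S.length * (S.length * 60 + 20) ≤ G.feedback * (G.feedback * 60 + 20) :=
        Nat.mul_le_mul n6 (by omega)
      have h2 : G.feedback * (G.feedback * 60 + 20) =
          60 * G.feedback ^ 2 + 20 * G.feedback := by ring
      omega
    have c3 : 700 * G.feedback * (G.maxPathLength + 1) ≤ 1400 * stepBound G b := by
      have h2 : 700 * G.feedback * (G.maxPathLength + 1) =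
          700 * (G.feedback * G.maxPathLength) + 700 * G.feedback := by ring
      omega
    omega
  simp only [block_singleton, runs_when, Test.holds_and, Test.holds_eq, Test.holds_le,
    NExp.eval_var, NExp.eval_ofNat, hR4.b, Test.cost_and, Test.cost_eq, Test.cost_le, NExp.cost_var,
    NExp.cost_ofNat]
  have hT := hI.terminal hG
  refine ⟨fun ⟨hval, hub⟩ => ?_, fun hno => ⟨by omega, hM4, hmono, ?_⟩⟩
  · have hcons := hI.consistent hval
    rw [block_cons_cons, runs_seq]
    refine (buildTree_spec hG hσ hL hR4 hF4.cur hI.blocked).mono ?_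
    rintro M5 k5 hs5 ⟨hk5, hup, hfr, Ch, hCh, hlink⟩
    have hS5 : SearchReady G f b S L σ Ch M5 := by
      refine ⟨hR4.of_same hs5 rfl, ?_, hup, hlink⟩
      simpa only [HoldsMark, hs5.arr .mark rfl] using hF4.mark
    rw [block_cons_cons, runs_seq]
    refine (search_spec hG hσ hcons hT hf0 hCh hS5 hfr).mono ?_
    rintro M6 k6 hs6 ⟨hk6, htot, F, hF, hO⟩
    have hS6 := hS5.of_same hs6 rfl rfl
    have hB6 : HoldsBlocked B M6 := by
      simpa only [HoldsBlocked, hs6.arr .blocked rfl, hs5.arr .blocked rfl] using hI.blocked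
    have hused : M6.var .used = B.card := by
      rw [hs6.var _ rfl, hs5.var _ rfl, hI.used]
    rw [hI.used] at hub
    rw [block_cons_cons, runs_seq]
    refine (greedy_spec hS6.ready hS6.up hB6 (fun e he => (hF e).mp he) hO hf hf0
      (by rw [hused]; exact hub)).mono ?_
    rintro M7 k7 hs7 ⟨hk7, X, hXF, hXc, hB7, ht7, hX⟩
    rw [hused] at hXc hX
    have hXfr : ∀ e ∈ X, Frontier σ B e := fun e he => (hF e).mp (hXF he)
    have htotal : M7.rvar .total = G.totalRate f (B ∪ X) := by
      rw [ht7, htot, totalRate_union hG hσ hcons hT hf0 hXfr]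
    have hfeas : G.Feasible b (B ∪ X) := by
      refine ⟨Finset.union_subset (fun e he => ?_) fun e he => ?_, ?_⟩
      · exact (AttackGraph.mem_free.mp (hI.free e he)).1
      · exact (AttackGraph.mem_free.mp (hXfr e he).2.1.mem_free).1
      · have := Finset.card_union_le B X
        omega
    have hM7 : HoldsBest G f b M7 := by
      simpa only [HoldsBest, output, hs7.var .found rfl, hs6.var .found rfl, hs5.var .found rfl,
        hs7.rvar .best rfl, hs6.rvar .best rfl, hs5.rvar .best rfl, hs7.arr .out rfl,
        hs6.arr .out rfl, hs5.arr .out rfl] using hM4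
    rw [block_singleton]
    refine (record_spec (hS6.ready.of_same hs7 rfl) hB7 hfeas htotal hM7).mono ?_
    rintro M8 k8 - ⟨hk8, hM8, hfb, hfm⟩
    refine ⟨?_, hM8, fun x hx => hfm x ?_, fun B' hB' hresp => ?_⟩
    · have h1 : b * (G.n + 1) = b * G.n + b := by ring
      have h2 : b ≤ b * G.n := Nat.le_mul_of_pos_right _ G.da.pos
      have h3 : G.n ≤ b * G.n := Nat.le_mul_of_pos_left _ hb
      have h4 : 0 < G.n := G.da.pos
      omega
    · simpa only [Found, hs7.var .found rfl, hs6.var .found rfl, hs5.var .found rfl,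
        hs7.rvar .best rfl, hs6.rvar .best rfl, hs5.rvar .best rfl] using hmono x hx
    · have hc' : Consistent σ B' := hresp ▸ hG.consistent_response B'
      refine ⟨hfb.1, hfb.2.trans ?_⟩
      rw [totalRate_union hG hσ hcons hT hf0 hXfr]
      exact (totalRate_le_of_consistent hG hσ hcons hT hI.origin hf hf0 hc' hB').2 X
        fun Y hY hYc => hX Y (fun e he => (hF e).mpr (hY e he)) hYc
  · intro B' hB' hresp
    have hc' : Consistent σ B' := hresp ▸ hG.consistent_response B'
    have hval := hI.valid_of_consistent hc' hB'.1
    refine absurd ⟨hval, ?_⟩ hno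
    rw [hI.used]
    exact (totalRate_le_of_consistent hG hσ (hI.consistent hval) hT hI.origin hf hf0 hc' hB').1

end SplitFPT

/-! ### Going through all strategies -/

namespace SplitFPT

open AttackGraph

variable {G : AttackGraph} {f : ℕ∞ → ℝ} {b : ℕ} {S : List (Fin G.n)}
  {L : Fin G.n → List (Fin G.m)} {M : Mem} {σ τ : Fin G.n → Option (Fin G.m)}

/-- The position of a choice among "no route" and the routes in `l`. -/
def digit {k : ℕ} (l : List (Fin k)) : Option (Fin k) → ℕ
  | none => 0
  | some e => l.idxOf e + 1

theorem digit_injective {k : ℕ} {l : List (Fin k)} {o o' : Option (Fin k)} (ho : ∀ e ∈ o, e ∈ l)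
    (h : digit l o = digit l o') : o = o' := by
  cases o <;> cases o' <;> simp [digit] at h ⊢
  exact (List.idxOf_inj (ho _ rfl)).mp h

theorem digit_lt {k : ℕ} {l : List (Fin k)} {o : Option (Fin k)} (ho : ∀ e ∈ o, e ∈ l) :
    digit l o < l.length + 1 := by
  cases o with
  | none => simp [digit]
  | some e => simpa [digit] using List.idxOf_lt_length_of_mem (ho e rfl)

theorem Linked.exists_next {k : ℕ} {next : ℕ → ℕ} {p : ℕ} {l : List (Fin k)}
    (h : Linked next p l) (hl : l.Nodup) {e : Fin k} (he : e ∈ l) :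
    ∃ o : Option (Fin k), next e = enc o ∧ (∀ e' ∈ o, e' ∈ l) ∧
      (o ≠ none ∧ digit l o = digit l (some e) + 1 ∨
        o = none ∧ digit l (some e) + 1 = l.length + 1) := by
  induction l generalizing p with
  | nil => simp at he
  | cons a l ih =>
    rw [List.nodup_cons] at hl
    by_cases hea : e = a
    · subst hea
      refine ⟨l.head?, h.2.eq_enc_head, fun e' he' => List.mem_cons_of_mem _
        (List.mem_of_mem_head? he'), ?_⟩
      cases l with
      | nil => simp [digit]
      | cons c l =>
        have hc : e ≠ c := fun hc => hl.1 (by simp [hc])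
        simp [digit, List.idxOf_cons_ne _ hc]
    · obtain ⟨o, h1, h2, h3⟩ := ih h.2 hl.2 (by simpa [hea] using he)
      refine ⟨o, h1, fun e' he' => List.mem_cons_of_mem _ (h2 e' he'), ?_⟩
      have hae : a ≠ e := fun h => hea h.symm
      cases o with
      | none => simpa [digit, List.idxOf_cons_ne _ hae] using h3
      | some c =>
        have hc : a ≠ c := fun hc => hl.1 (hc ▸ h2 c rfl)
        simpa [digit, List.idxOf_cons_ne _ hae, List.idxOf_cons_ne _ hc] using h3

/-- The stored value that `nextStrategy` computes from the stored choice `o` is the next choice, or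
"no route" if `o` is the last one. -/
theorem Linked.exists_succ {k : ℕ} {next : ℕ → ℕ} {p : ℕ} {l : List (Fin k)}
    (h : Linked next p l) (hl : l.Nodup) {o : Option (Fin k)} (ho : ∀ e ∈ o, e ∈ l) :
    ∃ o' : Option (Fin k), (if enc o = 0 then p else next (enc o - 1)) = enc o' ∧
      (∀ e' ∈ o', e' ∈ l) ∧
      (o' ≠ none ∧ digit l o' = digit l o + 1 ∨ o' = none ∧ digit l o + 1 = l.length + 1) := by
  cases o with
  | some e => simpa using h.exists_next hl (ho e rfl)
  | none =>
    refine ⟨l.head?, by simpa using h.eq_enc_head, fun e' he' => List.mem_of_mem_head? he', ?_⟩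
    cases l <;> simp [digit]

/-- The number of a strategy in the mixed radix system whose digits, least significant one first,
are the choices at the nodes of a list. -/
def number (L : Fin G.n → List (Fin G.m)) (σ : Fin G.n → Option (Fin G.m)) : List (Fin G.n) → ℕ
  | [] => 0
  | v :: l => digit (L v) (σ v) + ((L v).length + 1) * number L σ l

/-- The number of all choices at the nodes of a list. -/
def choices (L : Fin G.n → List (Fin G.m)) (l : List (Fin G.n)) : ℕ :=
  (l.map fun v => (L v).length + 1).prod

theorem number_congr {l : List (Fin G.n)} (h : ∀ v ∈ l, σ v = τ v) :
    number L σ l = number L τ l := by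
  induction l with
  | nil => rfl
  | cons v l ih =>
    simp only [number]
    rw [h v (by simp), ih fun w hw => h w (by simp [hw])]

theorem number_none (l : List (Fin G.n)) : number L (fun _ => none) l = 0 := by
  induction l with
  | nil => rfl
  | cons v l ih => simp [number, digit, ih]

theorem IsListing.mem_of_isStrategy (hL : IsListing G S L) (hσ : G.IsStrategy σ) (v : Fin G.n) :
    ∀ e ∈ σ v, e ∈ L v := fun e he => (hL.mem_L v e).mpr (hσ v e he).2

theorem IsListing.number_lt (hL : IsListing G S L) (hσ : G.IsStrategy σ) (l : List (Fin G.n)) :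
    number L σ l < choices L l := by
  induction l with
  | nil => simp [number, choices]
  | cons v l ih =>
    have h := digit_lt (hL.mem_of_isStrategy hσ v)
    simp only [choices, List.map_cons, List.prod_cons, number] at ih ⊢
    calc _ < (L v).length + 1 + ((L v).length + 1) * number L σ l := by omega
      _ = ((L v).length + 1) * (number L σ l + 1) := by ring
      _ ≤ _ := Nat.mul_le_mul_left _ ih

theorem IsListing.eq_of_number (hL : IsListing G S L) (hσ : G.IsStrategy σ) (hτ : G.IsStrategy τ)
    {l : List (Fin G.n)} (h : number L σ l = number L τ l) : ∀ v ∈ l, σ v = τ v := by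
  induction l with
  | nil => simp
  | cons v l ih =>
    have h1 := digit_lt (hL.mem_of_isStrategy hσ v)
    have h2 := digit_lt (hL.mem_of_isStrategy hτ v)
    simp only [number] at h
    have h3 := congrArg (· % ((L v).length + 1)) h
    have h4 := congrArg (· / ((L v).length + 1)) h
    simp only [Nat.add_mul_mod_self_left, Nat.mod_eq_of_lt h1, Nat.mod_eq_of_lt h2] at h3
    simp only [Nat.add_mul_div_left _ _ (Nat.succ_pos _), Nat.div_eq_of_lt h1,
      Nat.div_eq_of_lt h2, zero_add] at h4
    intro w hw
    rcases List.mem_cons.mp hw with rfl | hw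
    · exact digit_injective (hL.mem_of_isStrategy hσ w) h3
    · exact ih h4 w hw

theorem IsListing.number_injective (hL : IsListing G S L) (hσ : G.IsStrategy σ)
    (hτ : G.IsStrategy τ) (h : number L σ S = number L τ S) : σ = τ := by
  funext v
  by_cases hv : v ∈ G.splitting
  · exact hL.eq_of_number hσ hτ h v ((hL.mem_S v).mpr hv)
  · have h0 : ∀ {ρ : Fin G.n → Option (Fin G.m)}, G.IsStrategy ρ → ρ v = none := fun hρ =>
      Option.eq_none_iff_forall_ne_some.mpr fun e he => hv (hρ v e he).1
    rw [h0 hσ, h0 hτ]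

theorem IsListing.choices_eq (hL : IsListing G S L) : choices L S = G.strategyCount := by
  rw [choices, hL.prod_S, strategyCount]
  exact Finset.prod_congr rfl fun v _ => by rw [hL.length_L]

theorem isStrategy_update (hσ : G.IsStrategy σ) (hL : IsListing G S L) {v : Fin G.n} (hv : v ∈ S)
    {o : Option (Fin G.m)} (ho : ∀ e ∈ o, e ∈ L v) :
    G.IsStrategy (Function.update σ v o) := by
  intro w e he
  by_cases hw : w = v
  · subst hw
    rw [Function.update_self] at he
    exact ⟨(hL.mem_S w).mp hv, (hL.mem_L w e).mp (ho e he)⟩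
  · rw [Function.update_of_ne hw] at he
    exact hσ w e he

/-- The loop of `nextStrategy`, started at the first node of the final segment `l` of `S`. -/
theorem carry_spec (hL : IsListing G S L) {d l : List (Fin G.n)} (hS : S = d ++ l)
    (hσ : G.IsStrategy σ) (hR : Ready G f b S L M) (hC : HoldsStrategy S σ M)
    (hk : M.var .k = d.length) (hc : M.var .carry = 1) :
    Runs (.while (.and (.lt Var.k Var.t) (.eq Var.carry 1)) (.block [
      .ite (.eq Arr.cur⟦Var.k⟧ 0)
        (.put .cur Var.k Arr.first⟦Arr.sp⟦Var.k⟧⟧)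
        (.put .cur Var.k Arr.next⟦Arr.cur⟦Var.k⟧ - 1⟧),
      .when (.ne Arr.cur⟦Var.k⟧ 0) (.set .carry 0),
      .set .k (Var.k + 1)])) M fun M' k => k ≤ 100 * (l.length + 1) ∧
        ∃ σ', G.IsStrategy σ' ∧ HoldsStrategy S σ' M' ∧ (∀ v ∉ l, σ' v = σ v) ∧
          (M'.var .carry = 0 ∧ number L σ' l = number L σ l + 1 ∨
            M'.var .carry = 1 ∧ number L σ l + 1 = choices L l) := by
  induction l generalizing d M σ with
  | nil =>
    refine Runs.while_false ?_ ?_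
    · simp [hk, hR.t, hS]
    · exact ⟨by simp, σ, hσ, hC, fun _ _ => rfl, .inr ⟨hc, rfl⟩⟩
  | cons v l ih =>
    have hlt : d.length < S.length := by simp [hS]
    have hv : S[d.length] = v := by simp [hS]
    have hvS : v ∈ S := by simp [hS]
    have hvl : v ∉ l := by
      have := hL.nodup_S
      rw [hS, List.nodup_append] at this
      exact (List.nodup_cons.mp this.2.1).1
    have hcur : M.arr .cur d.length = enc (σ v) := hv ▸ hC _ hlt
    have hsp : M.arr .sp d.length = v := hv ▸ hR.sp _ hlt
    obtain ⟨o, ho, hoL, hod⟩ :=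
      (hR.first v).exists_succ (hL.nodup_L v) (hL.mem_of_isStrategy hσ v)
    have hσ' := isStrategy_update hσ hL hvS hoL
    have hput : ∀ (M1 : Mem), M1.arr .cur = Function.update (M.arr .cur) d.length (enc o) →
        HoldsStrategy S (Function.update σ v o) M1 := by
      intro M1 h1 i hi
      rw [h1]
      by_cases hid : i = d.length
      · subst hid
        simp [hv]
      · have : S[i] ≠ v := fun h => hid ((hL.nodup_S.getElem_inj_iff).mp (h.trans hv.symm))
        rw [Function.update_of_ne hid, Function.update_of_ne this, hC i hi]
    refine Runs.while_true (by simp [hk, hR.t, hlt, hc]) ?_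
    refine Runs.mono (Q := fun M1 k1 => M1.arr .cur = Function.update (M.arr .cur) d.length (enc o) ∧
      M1.var .k = d.length + 1 ∧ M1.var .carry = (if o = none then 1 else 0) ∧ k1 ≤ 80) ?_ ?_
    · have hfin : ∀ k0, k0 ≤ 40 → Runs (.block [.when (.ne Arr.cur⟦Var.k⟧ 0) (.set .carry 0),
          .set .k (Var.k + 1)]) (M.setArr .cur d.length (enc o)) fun M1 k1 =>
          M1.arr .cur = Function.update (M.arr .cur) d.length (enc o) ∧
          M1.var .k = d.length + 1 ∧ M1.var .carry = (if o = none then 1 else 0) ∧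
            k0 + k1 ≤ 80 := by
        intro k0 hk0
        cases o <;> simp [hk, hc] <;> omega
      rw [block_cons_cons, runs_seq, runs_ite]
      constructor
      · intro h0
        have h0' : enc (σ v) = 0 := by simpa [hk, hcur] using h0
        rw [if_pos h0'] at ho
        simp only [runs_put, NExp.eval_get, NExp.eval_var, hk, hsp, ho]
        exact hfin _ (by simp)
      · intro h0
        have h0' : enc (σ v) ≠ 0 := by simpa [hk, hcur] using h0
        rw [if_neg h0'] at ho
        simp only [runs_put, NExp.eval_get, NExp.eval_var, NExp.eval_sub, NExp.eval_ofNat, hk,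
          hcur, ho]
        exact hfin _ (by simp)
    · rintro M1 k1 hs1 ⟨h1, h2, h3, h4⟩
      have hR1 := hR.of_same hs1 rfl
      rcases hod with ⟨hne, hd⟩ | ⟨rfl, hd⟩
      · refine Runs.while_false (by simp [h3, hne]) ⟨?_, _, hσ', hput M1 h1, ?_, .inl ⟨?_, ?_⟩⟩
        · simp
          omega
        · intro w hw
          exact Function.update_of_ne (fun h => hw (by simp [h])) _ _
        · rw [h3, if_neg hne]
        · simp only [number, Function.update_self, hd]
          rw [number_congr (τ := σ) fun w hw => Function.update_of_ne (ne_of_mem_of_not_mem hw hvl) _ _]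
          ring
      · refine (ih (d := d ++ [v]) (by simp [hS]) hσ' hR1 (hput M1 h1) (by simp [h2])
          (by simp [h3])).mono ?_
        rintro M2 k2 - ⟨hk2, σ2, hσ2, hC2, hout, hnum⟩
        have hv2 : σ2 v = none := by rw [hout v hvl, Function.update_self]
        rw [number_congr (σ := Function.update σ v none) (τ := σ)
          fun w hw => Function.update_of_ne (ne_of_mem_of_not_mem hw hvl) _ _] at hnum
        refine ⟨?_, σ2, hσ2, hC2, fun w hw => ?_, ?_⟩
        · simp
          omega
        · rw [List.mem_cons, not_or] at hw
          rw [hout w hw.2, Function.update_of_ne hw.1]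
        · have hsum : digit (L v) (σ v) + ((L v).length + 1) * number L σ l + 1 =
              ((L v).length + 1) * (number L σ l + 1) := by
            rw [mul_add, ← hd]
            omega
          refine hnum.imp (fun h => ⟨h.1, ?_⟩) fun h => ⟨h.1, ?_⟩
          · have h0 : digit (L v) none = 0 := rfl
            simp only [number, hv2, h0, hsum, h.2, zero_add]
          · simp only [number, hsum, h.2, choices, List.map_cons, List.prod_cons]

/-- The number of the strategy goes up by one, or the last strategy has been reached. -/
theorem nextStrategy_spec (hL : IsListing G S L) (hσ : G.IsStrategy σ) (hR : Ready G f b S L M)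
    (hC : HoldsStrategy S σ M) (hrun : M.var .run = 1) :
    Runs nextStrategy M fun M' k => k ≤ 200 * (S.length + 1) ∧
      ((M'.var .run = 1 ∧ ∃ σ', G.IsStrategy σ' ∧ HoldsStrategy S σ' M' ∧
          number L σ' S = number L σ S + 1) ∨
        M'.var .run = 0 ∧ number L σ S + 1 = G.strategyCount) := by
  unfold nextStrategy
  rw [block_cons_cons, runs_seq, runs_set, block_cons_cons, runs_seq, runs_set, block_cons_cons,
    runs_seq]
  refine (carry_spec (f := f) (b := b) hL (d := []) (l := S) (M := (M.setVar .k 0).setVar .carry 1) rfl hσ ?_ ?_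
    ?_ ?_).mono ?_
  · exact hR.of_same (c := .block [.set .k 0, .set .carry 1])
      (Exec.seq (.set M .k 0) (.set _ .carry 1)).same rfl
  · simpa [HoldsStrategy] using hC
  · simp
  · simp
  · rintro M1 k1 hs1 ⟨hk1, σ', hσ', hC', -, h⟩
    have hrun1 : M1.var .run = 1 := by rw [hs1.var .run rfl]; simpa using hrun
    rw [block_singleton, runs_when]
    rcases h with h | h
    · refine ⟨fun h1 => by simp [h.1] at h1, fun _ => ⟨?_, .inl ⟨hrun1, σ', hσ', hC', h.2⟩⟩⟩
      simp
      omega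
    · refine ⟨fun _ => ?_, fun h1 => by simp [h.1] at h1⟩
      rw [runs_set, ← hL.choices_eq]
      refine ⟨?_, .inr ⟨by simp, h.2⟩⟩
      simp
      omega

theorem program_spec (hG : G.Reaching) (hf : Antitone f) (hf0 : f ⊤ = 0) (hb : 1 ≤ b) :
    Runs program (input G f b) fun M k =>
      G.Feasible b (output G M) ∧ M.rvar .best = G.totalRate f (output G M) / G.entry.card ∧
      (∀ B', G.Feasible b B' → G.totalRate f (output G M) ≤ G.totalRate f B') ∧
      k ≤ 20000 * (G.strategyCount * stepBound G b) := by
  obtain ⟨n1, n2, -, -, -⟩ := m_add_n_le G hb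
  have hpos : 0 < G.strategyCount := Finset.prod_pos fun _ _ => Nat.succ_pos _
  have hbound : stepBound G b ≤ G.strategyCount * stepBound G b := Nat.le_mul_of_pos_left _ hpos
  unfold program
  rw [block_cons_cons, runs_seq]
  refine (prepare_spec G f b).mono ?_
  rintro M0 k0 - ⟨hk0, S, L, hL, hR0, hcur⟩
  have n3 := hL.length_S_le hG
  simp only [block_cons_cons, block_singleton, runs_seq, runs_set]
  -- Every defence whose best response has a smaller number than the current strategy has been
  -- accounted for. The budget pays for the current strategy and those that follow it.
  refine (Runs.while (K := (G.strategyCount - 0) * (11000 * stepBound G b))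
    (fun M K => Ready G f b S L M ∧ HoldsBest G f b M ∧
      ((M.var .run = 1 ∧ ∃ σ, G.IsStrategy σ ∧ HoldsStrategy S σ M ∧
          (∀ B', G.Feasible b B' → number L (G.response B') S < number L σ S →
            Found (G.totalRate f B') M) ∧
          K = (G.strategyCount - number L σ S) * (11000 * stepBound G b)) ∨
        M.var .run = 0 ∧ ∀ B', G.Feasible b B' → Found (G.totalRate f B') M)) ?_ ?_).mono ?_
  · refine ⟨?_, .inl (by simp), .inl ⟨by simp, fun _ => none, ?_, ?_, ?_, ?_⟩⟩
    · exact hR0.of_same (c := .block [.set .found 0, .set .run 1])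
        (Exec.seq (.set M0 .found 0) (.set _ .run 1)).same rfl
    · intro v e he
      simp at he
    · intro i hi
      simpa using hcur i hi
    · intro B' _ hlt
      simp [number_none] at hlt
    · rw [number_none]
  · rintro M K - ⟨hR, hM, h⟩ hrun
    have hrun : M.var .run = 1 := by simpa using hrun
    rcases h with ⟨-, σ, hσ, hC, hdone, rfl⟩ | h
    · rw [runs_seq]
      refine (tryStrategy_spec hG hσ hL hR hC hM hf hf0 hb).mono ?_
      rintro M1 k1 hs1 ⟨hk1, hM1, hold, hnew⟩
      have hC1 : HoldsStrategy S σ M1 := by simpa only [HoldsStrategy, hs1.arr .cur rfl] using hC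
      have hR1 := hR.of_same hs1 rfl
      have hdone1 : ∀ B', G.Feasible b B' →
          number L (G.response B') S < number L σ S + 1 → Found (G.totalRate f B') M1 := by
        intro B' hB' hlt
        rcases (Nat.lt_succ_iff.mp hlt).lt_or_eq with hlt | heq
        · exact hold _ (hdone B' hB' hlt)
        · exact hnew B' hB' (hL.number_injective isStrategy_response hσ heq)
      refine (nextStrategy_spec hL hσ hR1 hC1 ((hs1.var .run rfl).trans hrun)).mono ?_
      rintro M2 k2 hs2 ⟨hk2, h⟩
      have hfound : ∀ x, Found x M1 → Found x M2 := fun x hx => by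
        simpa only [Found, hs2.var .found rfl, hs2.rvar .best rfl] using hx
      have hM2 : HoldsBest G f b M2 := by
        simpa only [HoldsBest, output, hs2.var .found rfl, hs2.rvar .best rfl,
          hs2.arr .out rfl] using hM1
      have hR2 := hR1.of_same hs2 rfl
      have hlt := hL.number_lt hσ S
      rw [hL.choices_eq] at hlt
      have hK : (G.strategyCount - (number L σ S + 1)) * (11000 * stepBound G b) +
          11000 * stepBound G b = (G.strategyCount - number L σ S) * (11000 * stepBound G b) := by
        rw [← Nat.succ_mul]
        congr 1
        omega
      rcases h with ⟨hrun2, σ', hσ', hC', hnum⟩ | ⟨hrun2, hnum⟩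
      · refine ⟨_, ⟨hR2, hM2, .inl ⟨hrun2, σ', hσ', hC', fun B' hB' hlt => ?_, rfl⟩⟩, ?_⟩
        · exact hfound _ (hdone1 B' hB' (hnum ▸ hlt))
        · rw [hnum, ← hK]
          simp
          omega
      · refine ⟨0, ⟨hR2, hM2, .inr ⟨hrun2, fun B' hB' => ?_⟩⟩, ?_⟩
        · have := hL.number_lt (isStrategy_response (G := G) (B := B')) S
          rw [hL.choices_eq] at this
          exact hfound _ (hdone1 B' hB' (hnum ▸ this))
        · rw [← hK]
          simp
          omega
    · omega
  · rintro M k - ⟨⟨K, hR, hM, h⟩, hrun, hk⟩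
    have hrun : M.var .run ≠ 1 := by simpa using hrun
    rcases h with h | ⟨-, hall⟩
    · exact absurd h.1 hrun
    have hfound := (hall ∅ ⟨Finset.empty_subset _, by simp⟩).1
    obtain ⟨-, hfeas, hbest⟩ := hM.resolve_left (by omega)
    rw [runs_rset]
    refine ⟨hfeas, ?_, fun B' hB' => ?_, ?_⟩
    · simp [hbest, hR.s, output]
    · have := (hall B' hB').2
      rw [hbest] at this
      exact this
    · rw [Nat.sub_zero, Nat.mul_left_comm] at hk
      simp at hk ⊢
      omega

end SplitFPT

theorem proposition3 :
    ∃ C : ℕ, ∀ (G : AttackGraph) (f : ℕ∞ → ℝ) (b : ℕ),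
      (∀ v, ∃ p, G.IsWalk p v G.da) → G.entry.Nonempty →
      Antitone f → f ⊤ = 0 → 1 ≤ b →
      G.strategyCount ≤ 3 ^ G.feedback ∧
      ∃ (M : Mem) (k : ℕ),
        Exec SplitFPT.program (SplitFPT.input G f b) M k ∧
        G.IsOptimal f b (SplitFPT.output G M) ∧
        M.rvar .best = G.successRate f (SplitFPT.output G M) ∧
        k ≤ C * (3 ^ G.feedback *
          (G.feedback ^ 2 + G.feedback * G.maxPathLength + b * G.n)) := by
  refine ⟨20000, fun G f b hG hs hf hf0 hb => ?_⟩
  have hG : G.Reaching := hG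
  obtain ⟨M, k, hexec, hfeas, hbest, hopt, hk⟩ := SplitFPT.program_spec hG hf hf0 hb
  refine ⟨hG.strategyCount_le, M, k, hexec, ⟨hfeas, fun B' hB' => ?_⟩, ?_, hk.trans ?_⟩
  · exact mul_le_mul_of_nonneg_left (hopt B' hB') (by positivity)
  · rw [hbest, AttackGraph.successRate, AttackGraph.totalRate]
    ring
  · exact Nat.mul_le_mul_left _ (Nat.mul_le_mul_right _ hG.strategyCount_le)
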